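/- Let $n\ge 1$ and let $M$ be a non-empty smooth (Hausdorff, second countable) manifold of dimension $4n+3$ with an almost $3$-contact metric structure $(\varphi_i,\xi_i,\eta_i,g)$, $i=1,2,3$; that is, $g$ is a smooth Riemannian metric, the $(1,1)$-tensor fields $\varphi_i$, the vector fields $\xi_i$ and the $1$-forms $\eta_i$ are smooth, $\varphi_i^2=-\mathrm{Id}+\eta_i\otimes\xi_i$, $\eta_i(\xi_i)=1$, $g(\varphi_iX,\varphi_iY)=g(X,Y)-\eta_i(X)\eta_i(Y)$, and for every even permutation $(i,j,k)$ of $(1,2,3)$ $$\varphi_k=\varphi_i\varphi_j-\eta_j\otimes\xi_i=-\varphi_j\varphi_i+\eta_i\otimes\xi_j,\quad \xi_k=\varphi_i\xi_j=-\varphi_j\xi_i,\quad \eta_k=\eta_i\circ\varphi_j=-\eta_j\circ\varphi_i .$$ Assume that it is a $3$-$(\alpha,\delta)$-Sasaki manifold: $\alpha\neq0$ and $\delta$ are real constants and $d\eta_i=2\alpha\Phi_i+2(\alpha-\delta)\,\eta_j\wedge\eta_k$ for every even permutation $(i,j,k)$ of $(1,2,3)$, where $\Phi_i(X,Y)=g(X,\varphi_iY)$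 and $d\eta(X,Y)=X\eta(Y)-Y\eta(X)-\eta([X,Y])$. Let $\mathcal H=\bigcap_i\ker\eta_i$. 1. The distribution $\mathcal H$, the metric $g|_{\mathcal H}$ and the bundle $\mathbb Q$ spanned by $I_i=\varphi_i|_{\mathcal H}$ form a quaternionic contact structure, with global contact forms $\tilde\eta_i=-\frac1\alpha\eta_i$ (so $2g(I_iX,Y)=d\tilde\eta_i(X,Y)$ for $X,Y\in\mathcal H$) and Reeb vector fields $\tilde\xi_i=-\alpha\xi_i$. It is qc-Einstein with $S=2\alpha\delta$: it has a Biquard connection, whose qc Ricci tensor and qc scalar curvature satisfy $\mathrm{Ric}(X,Y)=\frac{\mathrm{Scal}}{4n}g(X,Y)$ for $X,Y\in\mathcal H$ and $\mathrm{Scal}=8n(n+2)S$ with $S=2\alpha\delta$. Moreover $d\tilde\eta_i=2\omega_i+S\,\tilde\eta_j\wedge\tilde\eta_k$ for every even permutation $(i,j,k)$, where $\omega_i$ is the $2$-form with $\tilde\xi_r\lrcorner\,\omega_i=0$ for $r=1,2,3$ and $2\omega_i=d\tilde\eta_i$ on $\mathcal H$. 2. The Ricci tensor of the Riemannian metric $g$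 is $$\mathrm{Ric}^g=2\alpha\big(2\delta(n+2)-3\alpha\big)g+2(\alpha-\delta)\big((2n+3)\alpha-\delta\big)\sum_{i=1}^3\eta_i\otimes\eta_i .$$ 3. The metric $g$ is Einstein ($\mathrm{Ric}^g=c\,g$ for a constant $c$) if and only if $\delta=\alpha$ or $\delta=(2n+3)\alpha$. -/

import Mathlib

open Bundle Manifold ContDiff VectorField

noncomputable section
namespace SasakiGeom

/-! ### Calculus on manifolds: exterior derivative, curvature, Levi-Civita connection -/

section Basic

variable {E : Type*} [NormedAddCommGroup E] [NormedSpace ℝ E]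
  {HM : Type*} [TopologicalSpace HM] {I : ModelWithCorners ℝ E HM}
  {M : Type*} [TopologicalSpace M] [ChartedSpace HM M] [IsManifold I ∞ M]

/-- Smoothness of a vector field at `x`. -/
abbrev SmoothFieldAt (X : Π x : M, TangentSpace I x) (x : M) : Prop := CMDiffAt ∞ (T% X) x

/-- Differentiability of a vector field at `x`. -/
abbrev DiffFieldAt (X : Π x : M, TangentSpace I x) (x : M) : Prop := MDiffAt (T% X) x

/-- Smoothness on `U` of a 1-form, as a section of the cotangent bundle. -/
def SmoothOneFormOn (η : Π x : M, TangentSpace I x →L[ℝ] ℝ) (U : Set M) : Prop :=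
  ContMDiffOn I (I.prod 𝓘(ℝ, E →L[ℝ] ℝ)) ∞
    (fun x ↦ TotalSpace.mk' (E →L[ℝ] ℝ)
      (E := fun x : M ↦ (TangentSpace I x →L[ℝ] Bundle.Trivial M ℝ x)) x (η x)) U

/-- Smoothness of a (1,1)-tensor field, as a section of the endomorphism bundle. -/
def SmoothEndomorphism (φ : Π x : M, TangentSpace I x →L[ℝ] TangentSpace I x) : Prop :=
  ContMDiff I (I.prod 𝓘(ℝ, E →L[ℝ] E)) ∞
    (fun x ↦ TotalSpace.mk' (E →L[ℝ] E)
      (E := fun x : M ↦ (TangentSpace I x →L[ℝ] TangentSpace I x)) x (φ x))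

/-- The exterior derivative of a 1-form,
`dη(X, Y) = X(η(Y)) - Y(η(X)) - η([X, Y])`, evaluated on tangent vectors `v, w` at `x` by means of
Mathlib's extension of `v, w` to vector fields; for a smooth `η` any other extensions give the
same value, see `extDerivOneForm_apply`. -/
def extDerivOneForm (η : Π x : M, TangentSpace I x →L[ℝ] ℝ) (x : M) (v w : TangentSpace I x) : ℝ :=
  d% (fun y ↦ η y (FiberBundle.extend E w y)) x v
    - d% (fun y ↦ η y (FiberBundle.extend E v y)) x w
    - η x (mlieBracket I (FiberBundle.extend E v) (FiberBundle.extend E w) x)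

theorem mdifferentiableAt_oneForm_apply {η : Π x : M, TangentSpace I x →L[ℝ] ℝ} {U : Set M}
    (hη : SmoothOneFormOn η U) {x : M} (hU : U ∈ nhds x) {X : Π x : M, TangentSpace I x}
    (hX : MDiffAt (T% X) x) : MDiffAt (fun y ↦ η y (X y)) x := by
  have : MDifferentiableAt I (I.prod 𝓘(ℝ))
      (fun m ↦ TotalSpace.mk' ℝ (E := Bundle.Trivial M ℝ) m (η m (X m))) x := by
    apply MDifferentiableAt.clm_bundle_apply (F₁ := E)
    · exact (hη.contMDiffAt hU).mdifferentiableAt (by simp)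
    · exact hX
  simp only [mdifferentiableAt_totalSpace] at this
  exact this.2

theorem extDerivOneForm_apply [FiniteDimensional ℝ E]
    {η : Π x : M, TangentSpace I x →L[ℝ] ℝ} {U : Set M}
    (hη : SmoothOneFormOn η U) {x : M} (hU : U ∈ nhds x) {X Y : Π x : M, TangentSpace I x}
    (hX : MDiffAt (T% X) x) (hY : MDiffAt (T% Y) x) :
    extDerivOneForm η x (X x) (Y x) =
      d% (fun y ↦ η y (Y y)) x (X x) - d% (fun y ↦ η y (X y)) x (Y x)
        - η x (mlieBracket I X Y x) := by
  let Φ := fun X Y : Π x : M, TangentSpace I x ↦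
    d% (fun y ↦ η y (Y y)) x (X x) - d% (fun y ↦ η y (X y)) x (Y x) - η x (mlieBracket I X Y x)
  have h₁ : ∀ Z : Π x : M, TangentSpace I x, MDiffAt (T% Z) x → TensorialAt I E (Φ · Z) x := by
    refine fun Z _ ↦ ⟨fun {f σ} hf hσ ↦ ?_, fun {σ σ'} hσ hσ' ↦ ?_⟩
    · have h := mvfderiv_fun_mul hf (mdifferentiableAt_oneForm_apply hη hU hσ)
      simp [Φ, h, mlieBracket_smul_left hf hσ]
      ring
    · have h := mvfderiv_fun_add (mdifferentiableAt_oneForm_apply hη hU hσ)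
        (mdifferentiableAt_oneForm_apply hη hU hσ')
      simp [Φ, h, mlieBracket_add_left hσ hσ']
      ring
  have h₂ : ∀ Z : Π x : M, TangentSpace I x, MDiffAt (T% Z) x → TensorialAt I E (Φ Z) x := by
    refine fun Z _ ↦ ⟨fun {f σ} hf hσ ↦ ?_, fun {σ σ'} hσ hσ' ↦ ?_⟩
    · have h := mvfderiv_fun_mul hf (mdifferentiableAt_oneForm_apply hη hU hσ)
      simp [Φ, h, mlieBracket_smul_right hf hσ]
      ring
    · have h := mvfderiv_fun_add (mdifferentiableAt_oneForm_apply hη hU hσ)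
        (mdifferentiableAt_oneForm_apply hη hU hσ')
      simp [Φ, h, mlieBracket_add_right hσ hσ']
      ring
  have key : Φ (FiberBundle.extend E (X x)) (FiberBundle.extend E (Y x)) = Φ X Y :=
    TensorialAt.pointwise₂ h₁ h₂ (FiberBundle.mdifferentiableAt_extend ..) hX
      (FiberBundle.mdifferentiableAt_extend ..) hY (by simp) (by simp)
  simpa [Φ, extDerivOneForm] using key

end Basic

section LeviCivita

variable {E : Type*} [NormedAddCommGroup E] [NormedSpace ℝ E]
  {HM : Type*} [TopologicalSpace HM] {I : ModelWithCorners ℝ E HM}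
  {M : Type*} [TopologicalSpace M] [ChartedSpace HM M] [IsManifold I ∞ M]
  (g : ContMDiffRiemannianMetric I ∞ E (fun x : M ↦ TangentSpace I x))

theorem mdifferentiableAt_metric {x : M} {X Y : Π x : M, TangentSpace I x}
    (hX : MDiffAt (T% X) x) (hY : MDiffAt (T% Y) x) :
    MDiffAt (fun y ↦ g.inner y (X y) (Y y)) x := by
  have : MDifferentiableAt I (I.prod 𝓘(ℝ))
      (fun m ↦ TotalSpace.mk' ℝ (E := Bundle.Trivial M ℝ) m (g.inner m (X m) (Y m))) x := by
    apply MDifferentiableAt.clm_bundle_apply₂ (F₁ := E) (F₂ := E)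
    · exact g.contMDiff.mdifferentiableAt (by simp)
    · exact hX
    · exact hY
  simp only [mdifferentiableAt_totalSpace] at this
  exact this.2

theorem metric_ext {x : M} {u v : TangentSpace I x}
    (h : ∀ w, g.inner x u w = g.inner x v w) : u = v := by
  by_contra hne
  have h1 := g.pos x (u - v) (sub_ne_zero.2 hne)
  simp [h] at h1

/-- Right-hand side of the Koszul formula for `2 g(∇_X Y, Z)` at `x`. -/
def koszul (Y X Z : Π x : M, TangentSpace I x) (x : M) : ℝ :=
  d% (fun y ↦ g.inner y (Y y) (Z y)) x (X x) + d% (fun y ↦ g.inner y (X y) (Z y)) x (Y x)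
    - d% (fun y ↦ g.inner y (X y) (Y y)) x (Z x)
    + g.inner x (mlieBracket I X Y x) (Z x) - g.inner x (mlieBracket I X Z x) (Y x)
    - g.inner x (mlieBracket I Y Z x) (X x)

variable {x : M} {Y : Π x : M, TangentSpace I x}

theorem koszul_tensorial_left [CompleteSpace E] (hY : MDiffAt (T% Y) x)
    {Z : Π x : M, TangentSpace I x} (hZ : MDiffAt (T% Z) x) :
    TensorialAt I E (fun X ↦ koszul g Y X Z x) x where
  smul {f X} hf hX := by
    have h1 := mvfderiv_fun_mul hf (mdifferentiableAt_metric g hX hZ)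
    have h2 := mvfderiv_fun_mul hf (mdifferentiableAt_metric g hX hY)
    simp [koszul, h1, h2, mlieBracket_smul_left hf hX]
    ring
  add {X X'} hX hX' := by
    have h1 := mvfderiv_fun_add (mdifferentiableAt_metric g hX hZ)
      (mdifferentiableAt_metric g hX' hZ)
    have h2 := mvfderiv_fun_add (mdifferentiableAt_metric g hX hY)
      (mdifferentiableAt_metric g hX' hY)
    simp [koszul, h1, h2, mlieBracket_add_left hX hX']
    ring

theorem koszul_tensorial_right [CompleteSpace E] (hY : MDiffAt (T% Y) x)
    {X : Π x : M, TangentSpace I x} (hX : MDiffAt (T% X) x) :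
    TensorialAt I E (fun Z ↦ koszul g Y X Z x) x where
  smul {f Z} hf hZ := by
    have h1 := mvfderiv_fun_mul hf (mdifferentiableAt_metric g hX hZ)
    have h2 := mvfderiv_fun_mul hf (mdifferentiableAt_metric g hY hZ)
    simp [koszul, h1, h2, mlieBracket_smul_right hf hZ]
    rw [g.symm x (Z x) (Y x), g.symm x (Z x) (X x)]
    ring
  add {Z Z'} hZ hZ' := by
    have h1 := mvfderiv_fun_add (mdifferentiableAt_metric g hX hZ)
      (mdifferentiableAt_metric g hX hZ')
    have h2 := mvfderiv_fun_add (mdifferentiableAt_metric g hY hZ)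
      (mdifferentiableAt_metric g hY hZ')
    simp [koszul, h1, h2, mlieBracket_add_right hZ hZ']
    ring

variable [FiniteDimensional ℝ E]

/-- Metric connection with vanishing torsion. -/
def IsLeviCivita (D : CovariantDerivative I E (fun x : M ↦ TangentSpace I x)) : Prop :=
  (∀ (x : M) (X Y : Π x : M, TangentSpace I x), MDiffAt (T% X) x → MDiffAt (T% Y) x →
    ∀ v : TangentSpace I x, d% (fun y ↦ g.inner y (X y) (Y y)) x v =
      g.inner x (D X x v) (Y x) + g.inner x (X x) (D Y x v)) ∧
  D.torsion = 0

instance (x : M) : FiniteDimensional ℝ (TangentSpace I x) :=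
  inferInstanceAs (FiniteDimensional ℝ E)

instance (x : M) : T2Space (TangentSpace I x) :=
  inferInstanceAs (T2Space E)

theorem exists_sharp (x : M) (B : TangentSpace I x →L[ℝ] TangentSpace I x →L[ℝ] ℝ) :
    ∃ A : TangentSpace I x →L[ℝ] TangentSpace I x, ∀ v w, g.inner x (A v) w = B v w := by
  let G : TangentSpace I x →ₗ[ℝ] Module.Dual ℝ (TangentSpace I x) :=
    { toFun v := (g.inner x v : TangentSpace I x →ₗ[ℝ] ℝ)
      map_add' v w := by ext; simp
      map_smul' c v := by ext; simp }
  have hG : Function.Injective G := by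
    rw [injective_iff_map_eq_zero]
    intro v hv
    by_contra h
    have h1 := g.pos x v h
    have h2 : G v v = 0 := by rw [hv]; rfl
    exact h1.ne' h2
  let e := LinearEquiv.ofInjectiveOfFinrankEq G hG (Subspace.dual_finrank_eq).symm
  let B' : TangentSpace I x →ₗ[ℝ] Module.Dual ℝ (TangentSpace I x) :=
    { toFun v := (B v : TangentSpace I x →ₗ[ℝ] ℝ)
      map_add' v w := by ext; simp
      map_smul' c v := by ext; simp }
  refine ⟨LinearMap.toContinuousLinearMap (e.symm.toLinearMap ∘ₗ B'), fun v w ↦ ?_⟩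
  have : G (e.symm (B' v)) = B' v := e.apply_symm_apply (B' v)
  exact congrArg (fun f : Module.Dual ℝ (TangentSpace I x) ↦ f w) this

/-- Existence of the Levi-Civita connection. -/
theorem exists_isLeviCivita : ∃ D, IsLeviCivita g D := by
  have key : ∀ (Y : Π x : M, TangentSpace I x) (x : M),
      ∃ A : TangentSpace I x →L[ℝ] TangentSpace I x, MDiffAt (T% Y) x →
        ∀ X Z : Π x : M, TangentSpace I x, MDiffAt (T% X) x → MDiffAt (T% Z) x →
          2 * g.inner x (A (X x)) (Z x) = koszul g Y X Z x := by
    intro Y x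
    by_cases hY : MDiffAt (T% Y) x
    · obtain ⟨A, hA⟩ := exists_sharp g x (TensorialAt.mkHom₂ (F := E) (F' := E)
        (fun X Z ↦ koszul g Y X Z x) x (fun Z hZ ↦ koszul_tensorial_left g hY hZ)
        (fun X hX ↦ koszul_tensorial_right g hY hX))
      refine ⟨(1 / 2 : ℝ) • A, fun _ X Z hX hZ ↦ ?_⟩
      have := hA (X x) (Z x)
      rw [TensorialAt.mkHom₂_apply _ _ hX hZ] at this
      simp [this]
    · exact ⟨0, fun h ↦ absurd h hY⟩
  choose D hD using key
  have ext' : ∀ {x : M} (A A' : TangentSpace I x →L[ℝ] TangentSpace I x),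
      (∀ X Z : Π x : M, TangentSpace I x, MDiffAt (T% X) x → MDiffAt (T% Z) x →
        2 * g.inner x (A (X x)) (Z x) = 2 * g.inner x (A' (X x)) (Z x)) → A = A' := by
    intro x A A' h
    ext1 v
    refine metric_ext g fun w ↦ ?_
    have := h (FiberBundle.extend E v) (FiberBundle.extend E w)
      (FiberBundle.mdifferentiableAt_extend ..) (FiberBundle.mdifferentiableAt_extend ..)
    simpa using this
  refine ⟨⟨D, ?_, ?_⟩, ?_, ?_⟩
  · intro Y Y' x hY hY' _
    refine ext' _ _ fun X Z hX hZ ↦ ?_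
    have h1 := mvfderiv_fun_add (mdifferentiableAt_metric g hY hZ)
      (mdifferentiableAt_metric g hY' hZ)
    have h2 := mvfderiv_fun_add (mdifferentiableAt_metric g hX hY)
      (mdifferentiableAt_metric g hX hY')
    rw [hD _ x (mdifferentiableAt_add_section hY hY') X Z hX hZ]
    simp only [add_apply, map_add, mul_add]
    rw [hD _ x hY X Z hX hZ, hD _ x hY' X Z hX hZ]
    simp [koszul, h1, h2, mlieBracket_add_left hY hY', mlieBracket_add_right hY hY']
    ring
  · intro Y f x hY hf _
    refine ext' _ _ fun X Z hX hZ ↦ ?_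
    have h1 := mvfderiv_fun_mul hf (mdifferentiableAt_metric g hY hZ)
    have h2 := mvfderiv_fun_mul hf (mdifferentiableAt_metric g hX hY)
    rw [hD _ x (hf.smul_section hY) X Z hX hZ]
    have h3 := hD _ x hY X Z hX hZ
    simp only [koszul] at h3
    simp [koszul, h1, h2, mlieBracket_smul_left hf hY, mlieBracket_smul_right hf hY]
    rw [g.symm x (Y x) (X x)]
    linear_combination -(f x) * h3
  · intro x X Y hX hY v
    have hv := FiberBundle.mdifferentiableAt_extend I E v
    have h1 := hD _ x hX _ _ hv hY
    have h2 := hD _ x hY _ _ hv hX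
    simp only [koszul, FiberBundle.extend_apply_self] at h1 h2
    change _ = g.inner x (D X x v) (Y x) + g.inner x (X x) (D Y x v)
    rw [g.symm x (X x) (D Y x v)]
    have e1 : (fun y ↦ g.inner y (Y y) (X y)) = fun y ↦ g.inner y (X y) (Y y) :=
      funext fun y ↦ g.symm y _ _
    have e2 := mlieBracket_swap_apply (I := I) (V := X) (W := Y) (x := x)
    rw [e1] at h2
    rw [e2, map_neg, neg_apply] at h1
    linarith
  · rw [CovariantDerivative.torsion_eq_zero_iff]
    intro X Y x hX hY
    change D Y x (X x) - D X x (Y x) = _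
    refine metric_ext g fun w ↦ ?_
    have hw := FiberBundle.mdifferentiableAt_extend I E w
    have h1 := hD _ x hY _ _ hX hw
    have h2 := hD _ x hX _ _ hY hw
    simp only [koszul, FiberBundle.extend_apply_self] at h1 h2
    have e1 : (fun y ↦ g.inner y (Y y) (X y)) = fun y ↦ g.inner y (X y) (Y y) :=
      funext fun y ↦ g.symm y _ _
    have e2 := mlieBracket_swap_apply (I := I) (V := Y) (W := X) (x := x)
    rw [e1, e2, map_neg, neg_apply] at h2
    rw [map_sub, sub_apply]
    linarith

/-- The Levi-Civita connection of `g`. -/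
def leviCivita : CovariantDerivative I E (fun x : M ↦ TangentSpace I x) :=
  (exists_isLeviCivita g).choose

end LeviCivita

section Curvature

variable {E : Type*} [NormedAddCommGroup E] [NormedSpace ℝ E]
  {HM : Type*} [TopologicalSpace HM] {I : ModelWithCorners ℝ E HM}
  {M : Type*} [TopologicalSpace M] [ChartedSpace HM M] [IsManifold I ∞ M]

/-- Curvature `R(X, Y)Z = ∇_X ∇_Y Z - ∇_Y ∇_X Z - ∇_[X,Y] Z` on vector fields, at `x`
(`D Z x v` is Mathlib's notation for `∇_v Z`). -/
def curvatureField (D : CovariantDerivative I E (fun x : M ↦ TangentSpace I x))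
    (X Y Z : Π x : M, TangentSpace I x) (x : M) : TangentSpace I x :=
  D (fun y ↦ D Z y (Y y)) x (X x) - D (fun y ↦ D Z y (X y)) x (Y x)
    - D Z x (mlieBracket I X Y x)

/-- The curvature tensor `R(u, v)w` on tangent vectors at `x`, computed with Mathlib's extensions of
`u, v, w` to vector fields that are smooth near `x`; by tensoriality the choice does not matter. -/
def curvature (D : CovariantDerivative I E (fun x : M ↦ TangentSpace I x)) (x : M)
    (u v w : TangentSpace I x) : TangentSpace I x :=
  curvatureField D (FiberBundle.extend E u) (FiberBundle.extend E v) (FiberBundle.extend E w) x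

variable [FiniteDimensional ℝ E]

/-- The Ricci tensor of the metric `g`: `Ric(v, w)` is the trace of `u ↦ R(u, v)w`, where `R` is the
curvature of the Levi-Civita connection (the trace is written out in a basis). -/
def ricci (g : ContMDiffRiemannianMetric I ∞ E (fun x : M ↦ TangentSpace I x)) (x : M)
    (v w : TangentSpace I x) : ℝ :=
  ∑ a, (Module.finBasis ℝ (TangentSpace I x)).repr
    (curvature (leviCivita g) x (Module.finBasis ℝ (TangentSpace I x) a) v w) a

/-- `g` is Einstein: its Ricci tensor is a constant multiple of `g`. -/
def IsEinstein (g : ContMDiffRiemannianMetric I ∞ E (fun x : M ↦ TangentSpace I x)) : Prop :=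
  ∃ c : ℝ, ∀ (x : M) (v w : TangentSpace I x), ricci g x v w = c * g.inner x v w

end Curvature

/-! ### Quaternionic contact structures in dimension `4n + 3` -/

section QuaternionicContact

/-- Tangent space of a `(4n+3)`-dimensional manifold. -/
abbrev Tan (n : ℕ) {M : Type*} [TopologicalSpace M]
    [ChartedSpace (EuclideanSpace ℝ (Fin (4 * n + 3))) M] (x : M) : Type :=
  TangentSpace (𝓡 (4 * n + 3)) x

variable {n : ℕ} {M : Type*} [TopologicalSpace M]
  [ChartedSpace (EuclideanSpace ℝ (Fin (4 * n + 3))) M] [IsManifold (𝓡 (4 * n + 3)) ∞ M]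

/-- A horizontal metric (as a field of bilinear forms) and a field `Q` of spaces of endomorphisms on
a distribution `H`; the axioms are in `IsQuaternionicContact`. -/
structure QCData (n : ℕ) (M : Type*) [TopologicalSpace M]
    [ChartedSpace (EuclideanSpace ℝ (Fin (4 * n + 3))) M] where
  H : Π x : M, Submodule ℝ (Tan n x)
  metric : Π x : M, LinearMap.BilinForm ℝ (H x)
  Q : Π x : M, Submodule ℝ (Module.End ℝ (H x))

namespace QCData

variable (𝒬 : QCData n M)

/-- A horizontal vector field, seen as a vector field. -/
def toField (X : Π x : M, 𝒬.H x) : Π x : M, Tan n x := fun x ↦ (X x : Tan n x)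

/-- A local contact form `(η₁, η₂, η₃)` with the associated almost complex structures
`(J₁, J₂, J₃)` on the open set `U`. -/
structure IsFrameOn (U : Set M) (η : Fin 3 → Π x : M, Tan n x →L[ℝ] ℝ)
    (J : Fin 3 → Π x : M, Module.End ℝ (𝒬.H x)) : Prop where
  isOpen : IsOpen U
  smooth_η : ∀ i, SmoothOneFormOn (η i) U
  linearIndependent : ∀ x ∈ U, LinearIndependent ℝ (fun i ↦ η i x)
  mem_H_iff : ∀ x ∈ U, ∀ v, v ∈ 𝒬.H x ↔ ∀ i, η i x v = 0
  smooth_J : ∀ i, ∀ x ∈ U, ∀ X : Π x : M, 𝒬.H x, SmoothFieldAt (𝒬.toField X) x →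
    SmoothFieldAt (𝒬.toField fun y ↦ J i y (X y)) x
  span_J : ∀ x ∈ U, 𝒬.Q x = Submodule.span ℝ (Set.range fun i ↦ J i x)
  J_sq : ∀ i, ∀ x ∈ U, J i x * J i x = -1
  J_mul : ∀ x ∈ U, J 0 x * J 1 x = J 2 x
  metric_J : ∀ i, ∀ x ∈ U, ∀ v w, 𝒬.metric x (J i x v) (J i x w) = 𝒬.metric x v w
  contact : ∀ i, ∀ x ∈ U, ∀ v w : 𝒬.H x,
    2 * 𝒬.metric x (J i x v) w = extDerivOneForm (η i) x (v : Tan n x) (w : Tan n x)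

/-- Quaternionic contact structure: `H` has a smooth Riemannian metric and a compatible bundle `Q`,
which locally come from three 1-forms with common kernel `H`. -/
structure IsQuaternionicContact : Prop where
  metric_symm : ∀ x v w, 𝒬.metric x v w = 𝒬.metric x w v
  metric_pos : ∀ x v, v ≠ 0 → 0 < 𝒬.metric x v v
  metric_smooth : ∀ (x : M) (X Y : Π x : M, 𝒬.H x),
    SmoothFieldAt (𝒬.toField X) x → SmoothFieldAt (𝒬.toField Y) x →
    ContMDiffAt (𝓡 (4 * n + 3)) 𝓘(ℝ) ∞ (fun y ↦ 𝒬.metric y (X y) (Y y)) x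
  exists_frame : ∀ p : M, ∃ U : Set M, p ∈ U ∧ ∃ η J, 𝒬.IsFrameOn U η J

/-- The Reeb vector fields of a local contact form `η` on `U`: `η_i(ξ_j) = δ_ij`,
`(ξ_i ⌟ dη_i)|_H = 0` and `(ξ_i ⌟ dη_j)|_H = -(ξ_j ⌟ dη_i)|_H`. -/
structure IsReebOn (U : Set M) (η : Fin 3 → Π x : M, Tan n x →L[ℝ] ℝ)
    (ξ : Fin 3 → Π x : M, Tan n x) : Prop where
  smooth_ξ : ∀ i, ∀ x ∈ U, SmoothFieldAt (ξ i) x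
  dual : ∀ x ∈ U, ∀ i j, η i x (ξ j x) = if i = j then 1 else 0
  deriv_self : ∀ x ∈ U, ∀ i, ∀ v : 𝒬.H x, extDerivOneForm (η i) x (ξ i x) (v : Tan n x) = 0
  deriv_swap : ∀ x ∈ U, ∀ i j, ∀ v : 𝒬.H x,
    extDerivOneForm (η j) x (ξ i x) (v : Tan n x) = -extDerivOneForm (η i) x (ξ j x) (v : Tan n x)

/-- `g`-orthonormal bases of `H` at `x`. -/
def IsOrthonormalFrame (x : M) (e : Fin (4 * n) → 𝒬.H x) : Prop :=
  ∀ a b, 𝒬.metric x (e a) (e b) = if a = b then 1 else 0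

open Classical in
/-- The projection of the tangent space onto `H` along a complement `V` of `H`
(used only for complements). -/
def hProj (V : Π x : M, Submodule ℝ (Tan n x)) (x : M) : Tan n x →ₗ[ℝ] 𝒬.H x :=
  if h : IsCompl (𝒬.H x) (V x) then (𝒬.H x).projectionOnto (V x) h else 0

/-- The `H`-component of `∇_u Y` for a horizontal vector field `Y`. -/
def hCov (V : Π x : M, Submodule ℝ (Tan n x))
    (D : CovariantDerivative (𝓡 (4 * n + 3)) (EuclideanSpace ℝ (Fin (4 * n + 3)))
      (fun x : M ↦ TangentSpace (𝓡 (4 * n + 3)) x))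
    (Y : Π x : M, 𝒬.H x) (x : M) (u : Tan n x) : 𝒬.H x :=
  𝒬.hProj V x (D (𝒬.toField Y) x u)

/-- `D` is the Biquard connection, with vertical distribution `V` (spanned by the Reeb fields):
* `D` preserves the splitting `TM = H ⊕ V` and the horizontal metric;
* the torsion of horizontal `X, Y` is `T(X, Y) = -[X, Y]_V`;
* for `ξ` in `V`, the endomorphism `T(ξ, ·)` of `H` is orthogonal to `sp(n) ⊕ sp(1)` in `gl(H)`,
  where `sp(1) = Q` and `sp(n)` consists of the skew endomorphisms commuting with `Q`;
* `D` preserves `Q`, and the identification `V → Q`, `ξ_i ↦ J_i`, is parallel: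
  `∇_u J_i = ∑_j a_ij J_j` and `∇_u ξ_i = ∑_j a_ij ξ_j` with the same coefficients. -/
structure IsBiquard (V : Π x : M, Submodule ℝ (Tan n x))
    (D : CovariantDerivative (𝓡 (4 * n + 3)) (EuclideanSpace ℝ (Fin (4 * n + 3)))
      (fun x : M ↦ TangentSpace (𝓡 (4 * n + 3)) x)) : Prop where
  smooth : D.ContMDiffCovariantDerivative ∞
  isCompl : ∀ x, IsCompl (𝒬.H x) (V x)
  preserves_H : ∀ (x : M) (Y : Π x : M, Tan n x), (∀ y, Y y ∈ 𝒬.H y) → DiffFieldAt Y x →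
    ∀ u : Tan n x, D Y x u ∈ 𝒬.H x
  preserves_V : ∀ (x : M) (Y : Π x : M, Tan n x), (∀ y, Y y ∈ V y) → DiffFieldAt Y x →
    ∀ u : Tan n x, D Y x u ∈ V x
  metric : ∀ (x : M) (Y Z : Π x : M, 𝒬.H x), DiffFieldAt (𝒬.toField Y) x →
    DiffFieldAt (𝒬.toField Z) x → ∀ u : Tan n x,
    mvfderiv (𝓡 (4 * n + 3)) (fun y ↦ 𝒬.metric y (Y y) (Z y)) x u =
      𝒬.metric x (𝒬.hCov V D Y x u) (Z x) + 𝒬.metric x (Y x) (𝒬.hCov V D Z x u)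
  torsion_H : ∀ (x : M) (X Y : Π x : M, 𝒬.H x), DiffFieldAt (𝒬.toField X) x →
    DiffFieldAt (𝒬.toField Y) x →
    D.torsion x (X x : Tan n x) (Y x : Tan n x) =
      -(mlieBracket (𝓡 (4 * n + 3)) (𝒬.toField X) (𝒬.toField Y) x
        - 𝒬.hProj V x (mlieBracket (𝓡 (4 * n + 3)) (𝒬.toField X) (𝒬.toField Y) x))
  torsion_V_mem : ∀ x, ∀ ξ ∈ V x, ∀ v : 𝒬.H x, D.torsion x ξ (v : Tan n x) ∈ 𝒬.H x
  torsion_V_orthogonal : ∀ x, ∀ ξ ∈ V x, ∀ A : Module.End ℝ (𝒬.H x),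
    (A ∈ 𝒬.Q x ∨ ((∀ v w, 𝒬.metric x (A v) w = -𝒬.metric x v (A w)) ∧
      ∀ J ∈ 𝒬.Q x, A * J = J * A)) →
    ∀ e : Fin (4 * n) → 𝒬.H x, 𝒬.IsOrthonormalFrame x e →
      ∑ a, 𝒬.metric x (A (e a)) (𝒬.hProj V x (D.torsion x ξ (e a : Tan n x))) = 0
  parallel : ∀ p : M, ∃ U : Set M, p ∈ U ∧ ∃ η J ξ, 𝒬.IsFrameOn U η J ∧ 𝒬.IsReebOn U η ξ ∧
    (∀ x ∈ U, V x = Submodule.span ℝ (Set.range fun i ↦ ξ i x)) ∧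
    ∀ x ∈ U, ∀ u : Tan n x, ∃ a : Fin 3 → Fin 3 → ℝ,
      (∀ i, ∀ Y : Π x : M, 𝒬.H x, DiffFieldAt (𝒬.toField Y) x →
        𝒬.hCov V D (fun y ↦ J i y (Y y)) x u - J i x (𝒬.hCov V D Y x u) =
          ∑ j, a i j • J j x (Y x)) ∧
      ∀ i, D (ξ i) x u = ∑ j, a i j • ξ j x

/-- The qc Ricci tensor `∑_a g(R(e_a, v)w, e_a)` on `H`, for an orthonormal basis `e` of `H`. -/
def qcRicci (V : Π x : M, Submodule ℝ (Tan n x))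
    (D : CovariantDerivative (𝓡 (4 * n + 3)) (EuclideanSpace ℝ (Fin (4 * n + 3)))
      (fun x : M ↦ TangentSpace (𝓡 (4 * n + 3)) x))
    (x : M) (e : Fin (4 * n) → 𝒬.H x) (v w : 𝒬.H x) : ℝ :=
  ∑ a, 𝒬.metric x
    (𝒬.hProj V x (curvature D x (e a : Tan n x) (v : Tan n x) (w : Tan n x))) (e a)

/-- The qc scalar curvature, the horizontal trace of the qc Ricci tensor. -/
def qcScal (V : Π x : M, Submodule ℝ (Tan n x))
    (D : CovariantDerivative (𝓡 (4 * n + 3)) (EuclideanSpace ℝ (Fin (4 * n + 3)))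
      (fun x : M ↦ TangentSpace (𝓡 (4 * n + 3)) x))
    (x : M) (e : Fin (4 * n) → 𝒬.H x) : ℝ :=
  ∑ b, 𝒬.qcRicci V D x e (e b) (e b)

/-- Quaternionic contact Einstein: `Ric = Scal / (4n) g` on `H` for the Ricci tensor of the Biquard
connection, where the constant `S` is given by `8n(n+2) S = Scal`. (The Biquard connection is unique.) -/
def IsQCEinstein (S : ℝ) : Prop :=
  𝒬.IsQuaternionicContact ∧ ∃ V D, 𝒬.IsBiquard V D ∧
    ∀ (x : M) (e : Fin (4 * n) → 𝒬.H x), 𝒬.IsOrthonormalFrame x e →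
      (∀ v w, 𝒬.qcRicci V D x e v w = 𝒬.qcScal V D x e / (4 * n) * 𝒬.metric x v w) ∧
      8 * n * (n + 2) * S = 𝒬.qcScal V D x e

end QCData

/-- The fundamental 2-form `ω` of a contact form `η_i` with Reeb fields `ξ`:
`2ω(v, w) = dη_i(v_H, w_H)`, where `v_H = v - ∑_j η_j(v) ξ_j`. -/
def qcFundamentalForm (η : Fin 3 → Π x : M, Tan n x →L[ℝ] ℝ) (ξ : Fin 3 → Π x : M, Tan n x)
    (i : Fin 3) (x : M) (v w : Tan n x) : ℝ :=
  1 / 2 * extDerivOneForm (η i) x (v - ∑ j, η j x v • ξ j x) (w - ∑ j, η j x w • ξ j x)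

end QuaternionicContact

/-! ### Almost 3-contact metric structures -/

section Sasaki

variable {n : ℕ} {M : Type*} [TopologicalSpace M]
  [ChartedSpace (EuclideanSpace ℝ (Fin (4 * n + 3))) M] [IsManifold (𝓡 (4 * n + 3)) ∞ M]

/-- An almost 3-contact metric structure `(φ_i, ξ_i, η_i, g)` on a `(4n+3)`-manifold. The indices
`1, 2, 3` are `0, 1, 2 : Fin 3`, so that `(i, i + 1, i + 2)` are the even permutations. -/
structure AlmostThreeContactMetric (n : ℕ) (M : Type*) [TopologicalSpace M]
    [ChartedSpace (EuclideanSpace ℝ (Fin (4 * n + 3))) M] [IsManifold (𝓡 (4 * n + 3)) ∞ M] where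
  g : ContMDiffRiemannianMetric (𝓡 (4 * n + 3)) ∞ (EuclideanSpace ℝ (Fin (4 * n + 3)))
    (fun x : M ↦ TangentSpace (𝓡 (4 * n + 3)) x)
  φ : Fin 3 → Π x : M, Tan n x →L[ℝ] Tan n x
  ξ : Fin 3 → Π x : M, Tan n x
  η : Fin 3 → Π x : M, Tan n x →L[ℝ] ℝ
  smooth_φ : ∀ i, SmoothEndomorphism (φ i)
  smooth_ξ : ∀ i, ∀ x, SmoothFieldAt (ξ i) x
  smooth_η : ∀ i, SmoothOneFormOn (η i) Set.univ
  φ_sq : ∀ i x v, φ i x (φ i x v) = -v + η i x v • ξ i x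
  η_ξ : ∀ i x, η i x (ξ i x) = 1
  φ_eq : ∀ i x v, φ (i + 2) x v = φ i x (φ (i + 1) x v) - η (i + 1) x v • ξ i x
  φ_eq' : ∀ i x v, φ (i + 2) x v = -φ (i + 1) x (φ i x v) + η i x v • ξ (i + 1) x
  ξ_eq : ∀ i x, ξ (i + 2) x = φ i x (ξ (i + 1) x)
  ξ_eq' : ∀ i x, ξ (i + 2) x = -φ (i + 1) x (ξ i x)
  η_eq : ∀ i x v, η (i + 2) x v = η i x (φ (i + 1) x v)
  η_eq' : ∀ i x v, η (i + 2) x v = -η (i + 1) x (φ i x v)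
  metric_φ : ∀ i x v w, g.inner x (φ i x v) (φ i x w) = g.inner x v w - η i x v * η i x w

namespace AlmostThreeContactMetric

variable (𝒮 : AlmostThreeContactMetric n M)

/-- The fundamental 2-forms `Φ_i(X, Y) = g(X, φ_i Y)`. -/
def Φ (i : Fin 3) (x : M) (v w : Tan n x) : ℝ := 𝒮.g.inner x v (𝒮.φ i x w)

/-- 3-(α,δ)-Sasaki: `α ≠ 0` and `dη_i = 2α Φ_i + 2(α - δ) η_j ∧ η_k` for even `(i, j, k)`. -/
def IsThreeSasaki (α δ : ℝ) : Prop :=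
  α ≠ 0 ∧ ∀ (i : Fin 3) (x : M) (v w : Tan n x),
    extDerivOneForm (𝒮.η i) x v w = 2 * α * 𝒮.Φ i x v w +
      2 * (α - δ) * (𝒮.η (i + 1) x v * 𝒮.η (i + 2) x w - 𝒮.η (i + 1) x w * 𝒮.η (i + 2) x v)

/-- The horizontal distribution `H = ⋂ ker η_i`. -/
def horizontal (x : M) : Submodule ℝ (Tan n x) :=
  ⨅ i, LinearMap.ker (𝒮.η i x : Tan n x →ₗ[ℝ] ℝ)

theorem mem_horizontal {x : M} {v : Tan n x} : v ∈ 𝒮.horizontal x ↔ ∀ i, 𝒮.η i x v = 0 := by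
  simp [horizontal]

theorem φ_ξ (i : Fin 3) (x : M) : 𝒮.φ i x (𝒮.ξ i x) = 0 := by
  have h : 𝒮.φ i x (𝒮.φ i x (𝒮.ξ i x)) = 0 := by simp [𝒮.φ_sq, 𝒮.η_ξ]
  have h2 := 𝒮.φ_sq i x (𝒮.φ i x (𝒮.ξ i x))
  rw [h, map_zero] at h2
  have h3 : 𝒮.φ i x (𝒮.ξ i x) = 𝒮.η i x (𝒮.φ i x (𝒮.ξ i x)) • 𝒮.ξ i x := by
    have := congrArg (𝒮.φ i x (𝒮.ξ i x) + ·) h2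
    simpa using this
  have h4 := h
  rw [h3, map_smul, h3, smul_smul] at h4
  have h5 := congrArg (𝒮.η i x) h4
  simp [𝒮.η_ξ] at h5
  rw [h3, h5, zero_smul]

theorem η_φ (i : Fin 3) (x : M) (v : Tan n x) : 𝒮.η i x (𝒮.φ i x v) = 0 := by
  have h := 𝒮.φ_sq i x (𝒮.φ i x v)
  rw [𝒮.φ_sq i x v, map_add, map_neg, map_smul, φ_ξ, smul_zero, add_zero] at h
  have h2 := congrArg (𝒮.η i x) h
  simpa [𝒮.η_ξ] using h2

theorem φ_mem_horizontal (i : Fin 3) (x : M) (v : Tan n x) (hv : v ∈ 𝒮.horizontal x) :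
    𝒮.φ i x v ∈ 𝒮.horizontal x := by
  rw [mem_horizontal] at hv ⊢
  have h1 : 𝒮.η (i + 1) x (𝒮.φ i x v) = 0 := by
    have := 𝒮.η_eq' i x v
    rw [hv] at this
    linarith
  have h2 : 𝒮.η (i + 2) x (𝒮.φ i x v) = 0 := by
    have := 𝒮.η_eq (i + 2) x v
    rw [hv, show i + 2 + 1 = i by omega] at this
    exact this.symm
  intro j
  have : j = i ∨ j = i + 1 ∨ j = i + 2 := by omega
  rcases this with rfl | rfl | rfl
  exacts [𝒮.η_φ _ x v, h1, h2]

/-- The endomorphism `φ_i|_H` of the horizontal distribution. -/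
def horizontalEnd (i : Fin 3) (x : M) : Module.End ℝ (𝒮.horizontal x) :=
  (𝒮.φ i x : Tan n x →ₗ[ℝ] Tan n x).restrict (𝒮.φ_mem_horizontal i x)

/-- The underlying data: the distribution `H`, the metric `g|_H`, and the span of the `φ_i|_H`. -/
def qcData : QCData n M where
  H := 𝒮.horizontal
  metric x := LinearMap.mk₂ ℝ (fun v w ↦ 𝒮.g.inner x (v : Tan n x) (w : Tan n x))
    (by intros; simp) (by intros; simp) (by intros; simp) (by intros; simp)
  Q x := Submodule.span ℝ (Set.range fun i ↦ 𝒮.horizontalEnd i x)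

end AlmostThreeContactMetric

end Sasaki

end SasakiGeom

end

open SasakiGeom

/-! The Biquard connection is written down explicitly, and both curvature statements are read off
from it. Split `φ_i` into its horizontal part `φH i` and the vertical rotation `N i`. The structure
equation then says that `dη_i` is represented by `Ω_i = 2α φH_i + 2δ N_i`. Let `∇` be the metric
connection `∇^g + A` whose torsion is `T(u,v) = Σ g(θ_l u, v) ξ_l` with `θ_l = -2α φH_l + 2δ N_l`.

The central point is that `∇` only rotates the triple: `∇ξ_i = 2δ(η_{i+2} ⊗ ξ_{i+1} - η_{i+1} ⊗
ξ_{i+2})`, and likewise for `φ_i`. Differentiating the structure identities shows that `(∇φ, ∇ξ)`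
satisfies a linear system, `Deformation`, which the rotation satisfies too. Subtract the rotation.
The formula for `dη_i` makes the remaining `k = ∇ξ - rot` symmetric, and `d(dη_i) = 0`, divided by
`2α ≠ 0`, makes the cyclic sums of the remaining `p = ∇φ - rot` vanish. A pointwise rigidity result
(`Deformation.k_eq_zero`, `Deformation.p_eq_zero`), akin to the fact that closed Kähler forms of an
almost hyperhermitian structure are parallel, forces both to be zero (`Deformation.eq_rot`,
`IsThreeSasaki.cov_eq_rot`).

Rotations leave `Σ θ_l ⊗ ξ_l` invariant, so `T` and `A` are `∇`-parallel. Three facts about the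
curvature `R` of `∇` follow: its commutator with `φ_i` is a combination of the other two `φ` with
coefficients `4αδ g(u, φH_l v)`; its first Bianchi identity has no derivative terms; and the
Levi-Civita curvature equals `R` plus terms algebraic in `A`. From the first two, traces over a
horizontal orthonormal frame give the horizontal Ricci tensor `4αδ(n+2) g`
(`BiquardCurvature.ricciH_eq`), hence qc-Einstein with `S = 2αδ`. Tracing the algebraic terms
(`HorizontalFrame.trace_contorsionCurvature`) and adding gives `Ric^g`. Comparing a unit horizontal
vector with `ξ_0` gives the Einstein criterion. The Biquard axioms hold because `∇` preserves both
distributions and `T(ξ, X) = 0` for vertical `ξ` and horizontal `X`. -/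

noncomputable section
namespace SasakiGeom

set_option linter.unusedSectionVars false

/-! ### Global smooth vector fields, and the bracket as a commutator of derivations. -/

section SmoothFields

variable {E : Type*} [NormedAddCommGroup E] [NormedSpace ℝ E]
  {HM : Type*} [TopologicalSpace HM] {I : ModelWithCorners ℝ E HM}
  {M : Type*} [TopologicalSpace M] [ChartedSpace HM M] [IsManifold I ∞ M]

/-- Global smoothness of a vector field. -/
def SmoothField (X : Π x : M, TangentSpace I x) : Prop := ∀ x, SmoothFieldAt X x

namespace SmoothField

variable {X Y : Π x : M, TangentSpace I x} {f : M → ℝ}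

theorem contMDiff (hX : SmoothField X) : CMDiff ∞ (T% X) := hX

theorem diffAt (hX : SmoothField X) (x : M) : MDiffAt (T% X) x :=
  (hX x).mdifferentiableAt (by simp)

theorem add (hX : SmoothField X) (hY : SmoothField Y) : SmoothField (X + Y) :=
  ContMDiff.add_section hX hY

theorem add' (hX : SmoothField X) (hY : SmoothField Y) : SmoothField (fun y ↦ X y + Y y) :=
  ContMDiff.add_section hX hY

theorem sub' (hX : SmoothField X) (hY : SmoothField Y) : SmoothField (fun y ↦ X y - Y y) :=
  ContMDiff.sub_section hX hY

theorem smul (hf : CMDiff ∞ f) (hX : SmoothField X) : SmoothField (f • X) :=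
  ContMDiff.smul_section hf hX

theorem smul' (hf : CMDiff ∞ f) (hX : SmoothField X) : SmoothField (fun y ↦ f y • X y) :=
  ContMDiff.smul_section hf hX

theorem const_smul (c : ℝ) (hX : SmoothField X) : SmoothField (c • X) :=
  ContMDiff.const_smul_section hX

theorem const_smul' (c : ℝ) (hX : SmoothField X) : SmoothField (fun y ↦ c • X y) :=
  ContMDiff.const_smul_section hX

theorem sum {ι : Type*} [Fintype ι] {X : ι → Π x : M, TangentSpace I x}
    (hX : ∀ i, SmoothField (X i)) : SmoothField (fun y ↦ ∑ i, X i y) :=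
  ContMDiff.sum_section fun i _ ↦ hX i

theorem mlieBracket [CompleteSpace E] (hX : SmoothField X) (hY : SmoothField Y) :
    SmoothField (mlieBracket I X Y) := by
  intro x
  have : IsManifold I ((⊤ : ℕ∞) + 1 : WithTop ℕ∞) M := by simpa
  have : IsManifold I (minSmoothness ℝ 2) M := by
    simpa only [minSmoothness_of_isRCLikeNormedField] using
      IsManifold.of_le (m := 2) (n := ∞) (WithTop.coe_le_coe.2 le_top)
  exact ContMDiffAt.mlieBracket_vectorField (m := ⊤) (n := ⊤) (hX x) (hY x) (by simp)

end SmoothField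

theorem contMDiff_mvfderiv_apply {X : Π x : M, TangentSpace I x} {f : M → ℝ}
    (hf : CMDiff ∞ f) (hX : SmoothField X) : CMDiff ∞ (fun y ↦ d% f y (X y)) := by
  have h1 := (hf.contMDiff_tangentMap (m := ∞) (by simp)).comp hX.contMDiff
  exact (contMDiff_snd_tangentBundle_modelSpace ℝ 𝓘(ℝ, ℝ)).comp h1

theorem mdifferentiableAt_of_contMDiff {f : M → ℝ} (hf : CMDiff ∞ f) (x : M) : MDiffAt f x :=
  (hf x).mdifferentiableAt (by simp)

/-- Every vector extends to a global smooth vector field that agrees near the base point with a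
given field smooth on a neighbourhood. -/
theorem exists_smoothField_eventuallyEq [FiniteDimensional ℝ E] [T2Space M] {x : M}
    {s : Set M} (hs : s ∈ nhds x) {Y : Π x : M, TangentSpace I x} (hY : CMDiff[s] ∞ (T% Y)) :
    ∃ X : Π x : M, TangentSpace I x, SmoothField X ∧ ∀ᶠ y in nhds x, X y = Y y := by
  obtain ⟨u, hus, huo, hxu⟩ := mem_nhds_iff.1 hs
  obtain ⟨χ, -, hχ⟩ := (SmoothBumpFunction.nhds_basis_tsupport (I := I) x).mem_iff.1
    (huo.mem_nhds hxu)
  refine ⟨fun y ↦ χ y • Y y, ?_, ?_⟩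
  · exact ContMDiffOn.smul_section_of_tsupport χ.contMDiff.contMDiffOn huo hχ (hY.mono hus)
  · filter_upwards [χ.eventuallyEq_one] with y hy
    simp [hy]

theorem exists_smoothField_extend [FiniteDimensional ℝ E] [T2Space M] {x : M}
    (v : TangentSpace I x) : ∃ X : Π x : M, TangentSpace I x, SmoothField X ∧ X x = v ∧
      ∀ᶠ y in nhds x, X y = FiberBundle.extend E v y := by
  obtain ⟨s, hs, h⟩ := FiberBundle.exists_contMDiffOn_extend (k := ∞) I E v
  obtain ⟨X, hX, hXe⟩ := exists_smoothField_eventuallyEq hs h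
  exact ⟨X, hX, by simpa using hXe.self_of_nhds, hXe⟩

theorem exists_smoothField_eq [FiniteDimensional ℝ E] [T2Space M] {x : M}
    (v : TangentSpace I x) : ∃ X : Π x : M, TangentSpace I x, SmoothField X ∧ X x = v := by
  obtain ⟨X, hX, h, -⟩ := exists_smoothField_extend v
  exact ⟨X, hX, h⟩

/-- The Lie bracket acts on functions as the commutator of derivations. -/
theorem mvfderiv_mlieBracket [CompleteSpace E] {X Y Z : Π x : M, TangentSpace I x} {f : M → ℝ}
    (hf : CMDiff ∞ f) (hX : SmoothField X) (hY : SmoothField Y) (hZ : SmoothField Z) {x : M}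
    (hZx : Z x ≠ 0) :
    d% f x (mlieBracket I X Y x) =
      d% (fun y ↦ d% f y (Y y)) x (X x) - d% (fun y ↦ d% f y (X y)) x (Y x) := by
  have hM : IsManifold I (minSmoothness ℝ 3) M := by
    simp only [minSmoothness_of_isRCLikeNormedField]
    exact IsManifold.of_le (m := 3) (n := ∞) (WithTop.coe_le_coe.2 le_top)
  have h2 : ∀ {W : Π x : M, TangentSpace I x}, SmoothField W →
      CMDiffAt (minSmoothness ℝ 2) (T% W) x := by
    intro W hW
    simp only [minSmoothness_of_isRCLikeNormedField]
    exact (hW x).of_le (WithTop.coe_le_coe.2 le_top)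
  have key : ∀ {W : Π x : M, TangentSpace I x}, SmoothField W →
      mlieBracket I W (f • Z) = (fun y ↦ d% f y (W y)) • Z + f • mlieBracket I W Z := by
    intro W hW
    funext y
    simp [mlieBracket_smul_right (mdifferentiableAt_of_contMDiff hf y) (hZ.diffAt y)]
  have jac := leibniz_identity_mlieBracket_apply (h2 hX) (h2 hY) (h2 (hZ.smul hf))
  have jac' := leibniz_identity_mlieBracket_apply (h2 hX) (h2 hY) (h2 hZ)
  have e : ∀ {V W : Π x : M, TangentSpace I x}, SmoothField V → SmoothField W →
      mlieBracket I V ((fun y ↦ d% f y (W y)) • Z + f • mlieBracket I W Z) x =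
        d% (fun y ↦ d% f y (W y)) x (V x) • Z x + d% f x (W x) • mlieBracket I V Z x +
        (d% f x (V x) • mlieBracket I W Z x + f x • mlieBracket I V (mlieBracket I W Z) x) := by
    intro V W hV hW
    rw [mlieBracket_add_right ((hZ.smul (contMDiff_mvfderiv_apply hf hW)).diffAt x)
      (((hW.mlieBracket hZ).smul hf).diffAt x),
      mlieBracket_smul_right (mdifferentiableAt_of_contMDiff (contMDiff_mvfderiv_apply hf hW) x)
        (hZ.diffAt x),
      mlieBracket_smul_right (mdifferentiableAt_of_contMDiff hf x) ((hW.mlieBracket hZ).diffAt x)]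
  -- The Jacobi identity for `X, Y, fZ`, reduced by the one for `X, Y, Z`, leaves only a multiple of
  -- `Z x`. Its coefficient is the difference of the two sides, so it vanishes because `Z x ≠ 0`.
  rw [key hX, key hY, e hX hY, e hY hX, key (hX.mlieBracket hY), jac'] at jac
  have : (d% f x (mlieBracket I X Y x) -
      (d% (fun y ↦ d% f y (Y y)) x (X x) - d% (fun y ↦ d% f y (X y)) x (Y x))) • Z x = 0 := by
    rw [Pi.add_apply, Pi.smul_apply', Pi.smul_apply', smul_add] at jac
    rw [sub_smul, sub_smul]
    have := sub_eq_zero.2 jac.symm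
    rw [← this]
    abel
  exact sub_eq_zero.1 ((smul_eq_zero.1 this).resolve_right hZx)

end SmoothFields
end SasakiGeom
end

noncomputable section
namespace SasakiGeom

set_option linter.unusedSectionVars false

/-! ### Smoothness of fields and endomorphisms tested against smooth vector fields. -/

section MetricSmooth

variable {E : Type*} [NormedAddCommGroup E] [NormedSpace ℝ E]
  {HM : Type*} [TopologicalSpace HM] {I : ModelWithCorners ℝ E HM}
  {M : Type*} [TopologicalSpace M] [ChartedSpace HM M] [IsManifold I ∞ M]
  (g : ContMDiffRiemannianMetric I ∞ E (fun x : M ↦ TangentSpace I x))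

theorem contMDiffAt_metric {X Y : Π x : M, TangentSpace I x} {x : M}
    (hX : SmoothFieldAt X x) (hY : SmoothFieldAt Y x) :
    CMDiffAt ∞ (fun y ↦ g.inner y (X y) (Y y)) x := by
  have : ContMDiffAt I (I.prod 𝓘(ℝ)) ∞
      (fun m ↦ TotalSpace.mk' ℝ (E := Bundle.Trivial M ℝ) m (g.inner m (X m) (Y m))) x := by
    apply ContMDiffAt.clm_bundle_apply₂ (F₁ := E) (F₂ := E)
    · exact g.contMDiff x
    · exact hX
    · exact hY
  simp only [contMDiffAt_totalSpace] at this
  exact this.2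

theorem contMDiff_metric {X Y : Π x : M, TangentSpace I x}
    (hX : SmoothField X) (hY : SmoothField Y) :
    CMDiff ∞ (fun y ↦ g.inner y (X y) (Y y)) :=
  fun x ↦ contMDiffAt_metric g (hX x) (hY x)

variable [FiniteDimensional ℝ E] [T2Space M]

/-- Global smooth fields that near `x` are the frame of the preferred trivialization at `x`. -/
theorem exists_smooth_frame (x : M) {ι : Type*} (b : ι → E) :
    ∃ Z : ι → Π y : M, TangentSpace I y, (∀ a, SmoothField (Z a)) ∧
      ∀ a, ∀ᶠ y in nhds x, Z a y = (trivializationAt E (TangentSpace I) x).symm y (b a) := by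
  have : ∀ a, ∃ Z : Π y : M, TangentSpace I y, SmoothField Z ∧
      ∀ᶠ y in nhds x, Z y = (trivializationAt E (TangentSpace I) x).symm y (b a) := by
    intro a
    set t := trivializationAt E (TangentSpace I : M → Type _) x with ht
    have hx : x ∈ t.baseSet := FiberBundle.mem_baseSet_trivializationAt' x
    obtain ⟨Z, hZ, hZx, h⟩ := exists_smoothField_extend (I := I) (t.symm x (b a))
    refine ⟨Z, hZ, h.mono fun y hy ↦ hy.trans ?_⟩
    rw [FiberBundle.extend, ← ht, t.apply_mk_symm hx]
  choose Z hZ using this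
  exact ⟨Z, fun a ↦ (hZ a).1, fun a ↦ (hZ a).2⟩

/-- A vector field is smooth if its inner products with smooth vector fields are smooth. -/
theorem smoothField_of_inner {W : Π x : M, TangentSpace I x}
    (hW : ∀ Z : Π x : M, TangentSpace I x, SmoothField Z →
      CMDiff ∞ (fun y ↦ g.inner y (W y) (Z y))) : SmoothField W := by
  intro x
  rw [SmoothFieldAt, contMDiffAt_section]
  set t := trivializationAt E (TangentSpace I : M → Type _) x
  have hx : x ∈ t.baseSet := FiberBundle.mem_baseSet_trivializationAt' x
  let b := Module.finBasis ℝ E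
  obtain ⟨Z, hZ, hZe⟩ := exists_smooth_frame (I := I) x b
  let c : Fin (Module.finrank ℝ E) → E →L[ℝ] ℝ := fun a ↦ LinearMap.toContinuousLinearMap (b.coord a)
  -- `G y` is the Gram form of the local frame `Z` and `ψ y` collects the inner products of `W` with
  -- it. Near `x` the coordinates of `W` solve `G y w = ψ y`, so they equal `(G y)⁻¹ (ψ y)`, and
  -- operator inversion is smooth at the invertible `G x`.
  let G : M → E →L[ℝ] E →L[ℝ] ℝ := fun y ↦
    ∑ a, ∑ a', g.inner y (Z a y) (Z a' y) • (c a).smulRight (c a')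
  let ψ : M → E →L[ℝ] ℝ := fun y ↦ ∑ a, g.inner y (W y) (Z a y) • c a
  have hG : CMDiff ∞ G := contMDiff_finsetSum fun a _ ↦ contMDiff_finsetSum fun a' _ ↦
    (contMDiff_metric g (hZ a) (hZ a')).smul contMDiff_const
  have hψ : CMDiff ∞ ψ := contMDiff_finsetSum fun a _ ↦ (hW _ (hZ a)).smul contMDiff_const
  have hGapp : ∀ y w, G y w = ∑ a', g.inner y (∑ a, b.coord a w • Z a y) (Z a' y) • c a' := by
    intro y w
    ext v
    simp only [G, c, sum_apply, smul_apply, ContinuousLinearMap.smulRight_apply, map_sum, map_smul,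
      smul_eq_mul, LinearMap.coe_toContinuousLinearMap']
    rw [Finset.sum_comm]
    refine Finset.sum_congr rfl fun a' _ ↦ ?_
    rw [Finset.sum_mul]
    exact Finset.sum_congr rfl fun a _ ↦ by ring
  have hexp : ∀ y, (∀ a, Z a y = t.symm y (b a)) → y ∈ t.baseSet → ∀ w : E,
      ∑ a, b.coord a w • Z a y = t.symm y w := by
    intro y hy hyt w
    have hs : ∀ w : E, t.symm y w = t.symmL ℝ y w := fun w ↦ (t.symmL_apply hyt w).symm
    conv_rhs => rw [hs, ← b.sum_repr w, map_sum]
    refine Finset.sum_congr rfl fun a _ ↦ ?_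
    rw [map_smul, hy, hs]; rfl
  -- Positive definiteness: a kernel element gives a tangent vector orthogonal to the whole frame,
  -- hence to itself.
  have hinj : Function.Injective (G x) := by
    rw [injective_iff_map_eq_zero]
    intro w hw
    have hZx : ∀ a, Z a x = t.symm x (b a) := fun a ↦ (hZe a).self_of_nhds
    rw [hGapp, hexp x hZx hx] at hw
    have h1 : ∀ a, g.inner x (t.symm x w) (Z a x) = 0 := by
      intro a
      have := congrArg (fun f : E →L[ℝ] ℝ ↦ f (b a)) hw
      simpa [c, Finsupp.single_apply] using this
    by_contra hne
    have hne' : t.symm x w ≠ 0 := by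
      intro h0
      apply hne
      have := t.apply_mk_symm hx w
      rw [h0] at this
      have h2 : (t ⟨x, (0 : TangentSpace I x)⟩).2 = w := congrArg Prod.snd this
      rw [← h2]
      have h3 : (t ⟨x, (0 : TangentSpace I x)⟩).2 = t.continuousLinearMapAt ℝ x 0 := by
        rw [Trivialization.continuousLinearMapAt_apply, Trivialization.coe_linearMapAt_of_mem _ hx]
      rw [h3, map_zero]
    have h2 := g.pos x _ hne'
    rw [← hexp x hZx hx w, map_sum] at h2
    rw [hexp x hZx hx w] at h2
    simp [h1] at h2
  let e : E ≃L[ℝ] (E →L[ℝ] ℝ) :=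
    (LinearEquiv.ofInjectiveOfFinrankEq (G x : E →ₗ[ℝ] (E →L[ℝ] ℝ)) hinj
      (by rw [← (LinearMap.toContinuousLinearMap (𝕜 := ℝ) (E := E) (F' := ℝ)).finrank_eq]
          exact Subspace.dual_finrank_eq.symm)).toContinuousLinearEquiv
  have he : (e : E →L[ℝ] (E →L[ℝ] ℝ)) = G x := rfl
  have hinv : CMDiffAt ∞ (fun y ↦ ContinuousLinearMap.inverse (G y)) x :=
    ContMDiffAt.comp (I' := 𝓘(ℝ, E →L[ℝ] E →L[ℝ] ℝ)) x
      (he ▸ (contDiffAt_map_inverse (n := ∞) e)).contMDiffAt (hG x)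
  have hopen : ∀ᶠ y in nhds x, (G y).IsInvertible := by
    have := (ContinuousLinearEquiv.isOpen (𝕜 := ℝ) (E := E) (F := E →L[ℝ] ℝ)).mem_nhds ⟨e, he⟩
    exact (hG.continuous.continuousAt (x := x)).eventually this
  refine (hinv.clm_apply (hψ x)).congr_of_eventuallyEq ?_
  filter_upwards [hopen, t.open_baseSet.mem_nhds hx, Filter.eventually_all.2 hZe] with y hy hyt hyZ
  have hW' : t.symm y (t ⟨y, W y⟩).2 = W y := t.symm_apply_apply_mk hyt _
  have : G y (t ⟨y, W y⟩).2 = ψ y := by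
    rw [hGapp, hexp y hyZ hyt, hW']
  obtain ⟨e', he'⟩ := hy
  rw [← this, ← he', ContinuousLinearMap.inverse_equiv]
  simp

/-- An endomorphism field is smooth if it maps smooth vector fields to smooth vector fields. -/
theorem smoothEndomorphism_of_apply {A : Π x : M, TangentSpace I x →L[ℝ] TangentSpace I x}
    (hA : ∀ X : Π x : M, TangentSpace I x, SmoothField X → SmoothField fun y ↦ A y (X y)) :
    SmoothEndomorphism A := by
  intro x
  rw [contMDiffAt_hom_bundle]
  refine ⟨contMDiffAt_id, ?_⟩
  let b := Module.finBasis ℝ E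
  set t := trivializationAt E (TangentSpace I : M → Type _) x with ht
  have hx : x ∈ t.baseSet := FiberBundle.mem_baseSet_trivializationAt' x
  obtain ⟨Z, hZ, hZe⟩ := exists_smooth_frame (I := I) x b
  let c : Fin (Module.finrank ℝ E) → E →L[ℝ] ℝ := fun a ↦ LinearMap.toContinuousLinearMap (b.coord a)
  let F : M → E →L[ℝ] E := fun y ↦ ∑ a, (c a).smulRight (t ⟨y, A y (Z a y)⟩).2
  have hF : CMDiffAt ∞ F x := by
    refine contMDiffAt_finsetSum fun a _ ↦ ?_
    have h1 := hA _ (hZ a) x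
    rw [SmoothFieldAt, contMDiffAt_section] at h1
    have h2 : ContMDiffAt I 𝓘(ℝ, E →L[ℝ] E) ∞
        (fun y ↦ ContinuousLinearMap.smulRightL ℝ E E (c a) (t ⟨y, A y (Z a y)⟩).2) x :=
      ContMDiffAt.clm_apply contMDiffAt_const h1
    exact h2
  refine hF.congr_of_eventuallyEq ?_
  filter_upwards [t.open_baseSet.mem_nhds hx, Filter.eventually_all.2 hZe] with y hyt hyZ
  refine ContinuousLinearMap.coe_injective (b.ext fun a ↦ ?_)
  have : ∀ v : TangentSpace I y, (t ⟨y, v⟩).2 = t.continuousLinearMapAt ℝ y v := fun v ↦ by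
    rw [Trivialization.continuousLinearMapAt_apply, Trivialization.coe_linearMapAt_of_mem _ hyt]
  have e1 : t.symmL ℝ y (b a) = Z a y := (t.symmL_apply hyt _).trans (hyZ a).symm
  have e2 : ∀ a', c a' (b a) = if a' = a then 1 else 0 := fun a' ↦ by
    simp [c, Finsupp.single_apply, eq_comm]
  change t.continuousLinearMapAt ℝ y (A y (t.symmL ℝ y (b a))) = F y (b a)
  simp [F, e1, e2, ← this]

end MetricSmooth

/-! ### The Koszul formula and smoothness of the Levi-Civita connection. -/

section LeviCivita

variable {E : Type*} [NormedAddCommGroup E] [NormedSpace ℝ E]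
  {HM : Type*} [TopologicalSpace HM] {I : ModelWithCorners ℝ E HM}
  {M : Type*} [TopologicalSpace M] [ChartedSpace HM M] [IsManifold I ∞ M]
  (g : ContMDiffRiemannianMetric I ∞ E (fun x : M ↦ TangentSpace I x))
  [FiniteDimensional ℝ E]

theorem isLeviCivita_leviCivita : IsLeviCivita g (leviCivita g) :=
  (exists_isLeviCivita g).choose_spec

theorem IsLeviCivita.sub_eq_mlieBracket {D : CovariantDerivative I E (fun x : M ↦ TangentSpace I x)}
    (hD : IsLeviCivita g D) {X Y : Π x : M, TangentSpace I x} {x : M}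
    (hX : MDiffAt (T% X) x) (hY : MDiffAt (T% Y) x) :
    D Y x (X x) - D X x (Y x) = mlieBracket I X Y x :=
  (CovariantDerivative.torsion_eq_zero_iff D).1 hD.2 hX hY

/-- The Koszul formula. -/
theorem IsLeviCivita.two_mul_inner {D : CovariantDerivative I E (fun x : M ↦ TangentSpace I x)}
    (hD : IsLeviCivita g D) {X Y Z : Π x : M, TangentSpace I x} {x : M}
    (hX : MDiffAt (T% X) x) (hY : MDiffAt (T% Y) x) (hZ : MDiffAt (T% Z) x) :
    2 * g.inner x (D Y x (X x)) (Z x) = koszul g Y X Z x := by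
  rw [koszul, hD.1 x Y Z hY hZ, hD.1 x X Z hX hZ, hD.1 x X Y hX hY,
    ← hD.sub_eq_mlieBracket g hX hY, ← hD.sub_eq_mlieBracket g hX hZ,
    ← hD.sub_eq_mlieBracket g hY hZ]
  simp only [map_sub, sub_apply]
  rw [g.symm x (X x) (D Z x (Y x)), g.symm x (X x) (D Y x (Z x)), g.symm x (Y x) (D Z x (X x))]
  ring

/-- The connection was obtained pointwise by choice, so its smoothness has to be recovered: the
Koszul formula makes all inner products with smooth fields smooth, and `smoothField_of_inner`
applies. -/
theorem smoothField_leviCivita [T2Space M] {X Y : Π x : M, TangentSpace I x}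
    (hX : SmoothField X) (hY : SmoothField Y) :
    SmoothField fun y ↦ leviCivita g Y y (X y) := by
  refine smoothField_of_inner g fun Z hZ ↦ ?_
  have e : (fun y ↦ g.inner y (leviCivita g Y y (X y)) (Z y)) =
      fun y ↦ (1 / 2 : ℝ) * koszul g Y X Z y := by
    funext y
    rw [← (isLeviCivita_leviCivita g).two_mul_inner g (hX.diffAt y) (hY.diffAt y) (hZ.diffAt y)]
    ring
  rw [e]
  refine contMDiff_const.mul ?_
  unfold koszul
  exact ((((contMDiff_mvfderiv_apply (contMDiff_metric g hY hZ) hX).add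
    (contMDiff_mvfderiv_apply (contMDiff_metric g hX hZ) hY)).sub
    (contMDiff_mvfderiv_apply (contMDiff_metric g hX hY) hZ)).add
    (contMDiff_metric g (hX.mlieBracket hY) hZ)).sub
    (contMDiff_metric g (hX.mlieBracket hZ) hY) |>.sub
    (contMDiff_metric g (hY.mlieBracket hZ) hX)

end LeviCivita

end SasakiGeom
end

noncomputable section
namespace SasakiGeom

set_option linter.unusedSectionVars false

/-! ### Metric connections with torsion: tensoriality of curvature, the Bianchi identity, and `d² =
0`. -/

section MetricConnection

variable {E : Type*} [NormedAddCommGroup E] [NormedSpace ℝ E]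
  {HM : Type*} [TopologicalSpace HM] {I : ModelWithCorners ℝ E HM}
  {M : Type*} [TopologicalSpace M] [ChartedSpace HM M] [IsManifold I ∞ M]
  [FiniteDimensional ℝ E] [T2Space M]

/-- The auxiliary nonvanishing field of `mvfderiv_mlieBracket` exists unless the tangent space is
zero, and then both sides vanish. -/
theorem mvfderiv_mlieBracket_of_smooth {X Y : Π x : M, TangentSpace I x} {f : M → ℝ}
    (hf : CMDiff ∞ f) (hX : SmoothField X) (hY : SmoothField Y) (x : M) :
    d% f x (mlieBracket I X Y x) =
      d% (fun y ↦ d% f y (Y y)) x (X x) - d% (fun y ↦ d% f y (X y)) x (Y x) := by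
  by_cases h : ∃ v : TangentSpace I x, v ≠ 0
  · obtain ⟨v, hv⟩ := h
    obtain ⟨Z, hZ, rfl⟩ := exists_smoothField_eq v
    exact mvfderiv_mlieBracket hf hX hY hZ hv
  · push Not at h
    rw [h (mlieBracket I X Y x), h (X x), h (Y x)]
    simp

/-- A smooth connection on the tangent bundle that is compatible with the metric `g`. -/
structure IsSmoothMetric (g : ContMDiffRiemannianMetric I ∞ E (fun x : M ↦ TangentSpace I x))
    (D : CovariantDerivative I E (fun x : M ↦ TangentSpace I x)) : Prop where
  smooth : ∀ {X Y : Π x : M, TangentSpace I x}, SmoothField X → SmoothField Y →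
    SmoothField fun y ↦ D Y y (X y)
  metric : ∀ {x : M} {X Y : Π x : M, TangentSpace I x}, MDiffAt (T% X) x → MDiffAt (T% Y) x →
    ∀ v : TangentSpace I x, d% (fun y ↦ g.inner y (X y) (Y y)) x v =
      g.inner x (D X x v) (Y x) + g.inner x (X x) (D Y x v)

variable {g : ContMDiffRiemannianMetric I ∞ E (fun x : M ↦ TangentSpace I x)}
  {D : CovariantDerivative I E (fun x : M ↦ TangentSpace I x)}
  {X Y Z W : Π x : M, TangentSpace I x} {x : M}

theorem isSmoothMetric_leviCivita : IsSmoothMetric g (leviCivita g) where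
  smooth hX hY := smoothField_leviCivita g hX hY
  metric hX hY v := (isLeviCivita_leviCivita g).1 _ _ _ hX hY v

theorem cov_add (D : CovariantDerivative I E (fun x : M ↦ TangentSpace I x))
    (hX : MDiffAt (T% X) x) (hY : MDiffAt (T% Y) x) :
    D (fun y ↦ X y + Y y) x = D X x + D Y x :=
  D.isCovariantDerivativeOnUniv.add hX hY

theorem cov_const_smul (D : CovariantDerivative I E (fun x : M ↦ TangentSpace I x)) (c : ℝ)
    (hX : MDiffAt (T% X) x) : D (fun y ↦ c • X y) x = c • D X x :=
  D.isCovariantDerivativeOnUniv.smul_const c hX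

theorem cov_neg (D : CovariantDerivative I E (fun x : M ↦ TangentSpace I x))
    (hX : MDiffAt (T% X) x) : D (fun y ↦ -X y) x = -D X x := by
  simpa using cov_const_smul D (-1) hX

theorem cov_sub (D : CovariantDerivative I E (fun x : M ↦ TangentSpace I x))
    (hX : MDiffAt (T% X) x) (hY : MDiffAt (T% Y) x) :
    D (fun y ↦ X y - Y y) x = D X x - D Y x := by
  have hY' : MDiffAt (T% (fun y ↦ -Y y)) x := mdifferentiableAt_neg_section hY
  simp only [sub_eq_add_neg]
  rw [cov_add D hX hY', cov_neg D hY]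

theorem cov_smul (D : CovariantDerivative I E (fun x : M ↦ TangentSpace I x)) {f : M → ℝ}
    (hf : MDiffAt f x) (hX : MDiffAt (T% X) x) (v : TangentSpace I x) :
    D (fun y ↦ f y • X y) x v = f x • D X x v + d% f x v • X x := by
  have := D.isCovariantDerivativeOnUniv.leibniz hX hf
  exact congrArg (fun A : TangentSpace I x →L[ℝ] TangentSpace I x ↦ A v) this

theorem cov_congr (D : CovariantDerivative I E (fun x : M ↦ TangentSpace I x))
    (hX : MDiffAt (T% X) x) (h : ∀ᶠ y in nhds x, Y y = X y) : D Y x = D X x := by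
  have hY : MDiffAt (T% Y) x := hX.congr_of_eventuallyEq (h.mono fun y hy ↦ by simp [hy])
  exact D.isCovariantDerivativeOnUniv.congr_of_eventuallyEq hY hX Filter.univ_mem h

/-- `curvature` uses extensions that are smooth only near `x`; since curvature depends on germs
alone, they can be traded for global smooth fields. -/
theorem curvatureField_congr (hD : IsSmoothMetric g D) (hX : SmoothField X) (hY : SmoothField Y)
    (hZ : SmoothField Z) {X' Y' Z' : Π x : M, TangentSpace I x}
    (hX' : ∀ᶠ y in nhds x, X' y = X y) (hY' : ∀ᶠ y in nhds x, Y' y = Y y)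
    (hZ' : ∀ᶠ y in nhds x, Z' y = Z y) :
    curvatureField D X' Y' Z' x = curvatureField D X Y Z x := by
  have h1 : ∀ᶠ y in nhds x, D Z' y = D Z y :=
    (eventually_eventually_nhds.2 hZ').mono fun y hy ↦ cov_congr D (hZ.diffAt y) hy
  have h2 : D (fun y ↦ D Z' y (Y' y)) x = D (fun y ↦ D Z y (Y y)) x :=
    cov_congr D ((hD.smooth hY hZ).diffAt x)
      ((h1.and hY').mono fun y hy ↦ by rw [hy.1, hy.2])
  have h3 : D (fun y ↦ D Z' y (X' y)) x = D (fun y ↦ D Z y (X y)) x :=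
    cov_congr D ((hD.smooth hX hZ).diffAt x)
      ((h1.and hX').mono fun y hy ↦ by rw [hy.1, hy.2])
  have h4 : mlieBracket I X' Y' x = mlieBracket I X Y x :=
    Filter.EventuallyEq.mlieBracket_vectorField_eq hX' hY'
  rw [curvatureField, curvatureField, h2, h3, h4, hX'.self_of_nhds, hY'.self_of_nhds,
    h1.self_of_nhds]

theorem curvatureField_swap (D : CovariantDerivative I E (fun x : M ↦ TangentSpace I x))
    (X Y Z : Π x : M, TangentSpace I x) (x : M) :
    curvatureField D X Y Z x = -curvatureField D Y X Z x := by
  rw [curvatureField, curvatureField, mlieBracket_swap_apply, map_neg]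
  abel

theorem IsSmoothMetric.smoothEndomorphism (hD : IsSmoothMetric g D) (hZ : SmoothField Z) :
    SmoothEndomorphism fun y ↦ D Z y :=
  smoothEndomorphism_of_apply fun _ hX ↦ hD.smooth hX hZ

theorem mdifferentiableAt_endomorphism_apply
    {A : Π x : M, TangentSpace I x →L[ℝ] TangentSpace I x} (hA : SmoothEndomorphism A)
    (hX : MDiffAt (T% X) x) : MDiffAt (T% (fun y ↦ A y (X y))) x :=
  MDifferentiableAt.clm_bundle_apply (F₁ := E) (F₂ := E) ((hA x).mdifferentiableAt (by simp)) hX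

theorem smoothField_endomorphism_apply
    {A : Π x : M, TangentSpace I x →L[ℝ] TangentSpace I x} (hA : SmoothEndomorphism A)
    (hX : SmoothField X) : SmoothField (fun y ↦ A y (X y)) := fun x ↦
  ContMDiffAt.clm_bundle_apply (F₁ := E) (F₂ := E) (hA x) (hX x)

theorem curvatureField_tensorial_left (hD : IsSmoothMetric g D)
    (hZ : SmoothField Z) : TensorialAt I E (fun X ↦ curvatureField D X Y Z x) x where
  smul {f X} hf hX := by
    have h := cov_smul D hf (mdifferentiableAt_endomorphism_apply (hD.smoothEndomorphism hZ) hX)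
      (Y x)
    simp only [curvatureField, Pi.smul_apply', map_smul, h, mlieBracket_smul_left hf hX, map_add,
      neg_smul, map_neg]
    module
  add {X X'} hX hX' := by
    have h := cov_add D (mdifferentiableAt_endomorphism_apply (hD.smoothEndomorphism hZ) hX)
      (mdifferentiableAt_endomorphism_apply (hD.smoothEndomorphism hZ) hX')
    simp only [curvatureField, Pi.add_apply, map_add, h, mlieBracket_add_left hX hX',
      add_apply]
    abel

theorem curvatureField_tensorial_right (hD : IsSmoothMetric g D)
    (hZ : SmoothField Z) : TensorialAt I E (fun Y ↦ curvatureField D X Y Z x) x where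
  smul {f Y} hf hY := by
    have := (curvatureField_tensorial_left (Y := X) hD hZ).smul hf hY
    simp only [curvatureField_swap D _ X Z x] at this
    simpa using this
  add {Y Y'} hY hY' := by
    have := (curvatureField_tensorial_left (Y := X) hD hZ).add hY hY'
    simp only [curvatureField_swap D _ X Z x] at this
    rw [← neg_add] at this
    exact neg_injective this

/-- The curvature of a metric connection is skew. -/
theorem curvatureField_skew (hD : IsSmoothMetric g D) (hX : SmoothField X) (hY : SmoothField Y)
    (hZ : SmoothField Z) (hW : SmoothField W) (x : M) :
    g.inner x (curvatureField D X Y Z x) (W x) = -g.inner x (Z x) (curvatureField D X Y W x) := by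
  have h := mvfderiv_mlieBracket_of_smooth (contMDiff_metric g hZ hW) hX hY x
  have e : ∀ {V : Π x : M, TangentSpace I x}, SmoothField V →
      (fun y ↦ d% (fun y ↦ g.inner y (Z y) (W y)) y (V y)) =
        (fun y ↦ g.inner y (D Z y (V y)) (W y) + g.inner y (Z y) (D W y (V y))) := fun hV ↦
    funext fun y ↦ hD.metric (hZ.diffAt y) (hW.diffAt y) _
  have e2 : ∀ {U V : Π x : M, TangentSpace I x}, SmoothField U → SmoothField V →
      d% (fun y ↦ g.inner y (D Z y (V y)) (W y) + g.inner y (Z y) (D W y (V y))) x (U x) =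
      g.inner x (D (fun y ↦ D Z y (V y)) x (U x)) (W x) + g.inner x (D Z x (V x)) (D W x (U x)) +
      (g.inner x (D Z x (U x)) (D W x (V x)) + g.inner x (Z x) (D (fun y ↦ D W y (V y)) x (U x))) := by
    intro U V hU hV
    have hZV := hD.smooth hV hZ
    have hWV := hD.smooth hV hW
    rw [mvfderiv_fun_add (mdifferentiableAt_of_contMDiff (contMDiff_metric g hZV hW) x)
      (mdifferentiableAt_of_contMDiff (contMDiff_metric g hZ hWV) x), add_apply,
      hD.metric (hZV.diffAt x) (hW.diffAt x), hD.metric (hZ.diffAt x) (hWV.diffAt x)]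
  rw [e hX, e hY, e2 hX hY, e2 hY hX, hD.metric (hZ.diffAt x) (hW.diffAt x)] at h
  simp only [curvatureField, map_sub, sub_apply]
  linarith

/-- The curvature tensor may be computed with any smooth extensions. -/
theorem curvature_apply (hD : IsSmoothMetric g D) (hX : SmoothField X) (hY : SmoothField Y)
    (hZ : SmoothField Z) (x : M) :
    curvature D x (X x) (Y x) (Z x) = curvatureField D X Y Z x := by
  obtain ⟨X', hX', hXx, hXe⟩ := exists_smoothField_extend (X x)
  obtain ⟨Y', hY', hYx, hYe⟩ := exists_smoothField_extend (Y x)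
  obtain ⟨Z', hZ', hZx, hZe⟩ := exists_smoothField_extend (Z x)
  have h1 : curvature D x (X x) (Y x) (Z x) = curvatureField D X' Y' Z' x :=
    curvatureField_congr hD hX' hY' hZ' (hXe.mono fun _ h ↦ h.symm) (hYe.mono fun _ h ↦ h.symm)
      (hZe.mono fun _ h ↦ h.symm)
  rw [h1, (curvatureField_tensorial_left hD hZ').pointwise (hX'.diffAt x)
    (hX.diffAt x) hXx,
    (curvatureField_tensorial_right hD hZ').pointwise (hY'.diffAt x)
    (hY.diffAt x) hYx]
  -- Dependence on `Z` only through `Z x` needs no further computation: skewness moves `Z` out of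
  -- the differentiated slot.
  refine metric_ext g fun w ↦ ?_
  obtain ⟨W, hW, rfl⟩ := exists_smoothField_eq w
  rw [curvatureField_skew hD hX hY hZ' hW, curvatureField_skew hD hX hY hZ hW, hZx]

variable (u v w z : TangentSpace I x)

theorem curvature_swap (D : CovariantDerivative I E (fun x : M ↦ TangentSpace I x)) :
    curvature D x u v w = -curvature D x v u w := curvatureField_swap _ _ _ _ _

theorem curvature_skew (hD : IsSmoothMetric g D) :
    g.inner x (curvature D x u v w) z = -g.inner x w (curvature D x u v z) := by
  obtain ⟨X, hX, rfl⟩ := exists_smoothField_eq u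
  obtain ⟨Y, hY, rfl⟩ := exists_smoothField_eq v
  obtain ⟨Z, hZ, rfl⟩ := exists_smoothField_eq w
  obtain ⟨W, hW, rfl⟩ := exists_smoothField_eq z
  rw [curvature_apply hD hX hY hZ, curvature_apply hD hX hY hW, curvatureField_skew hD hX hY hZ hW]

theorem curvature_add_left (hD : IsSmoothMetric g D) :
    curvature D x (u + v) w z = curvature D x u w z + curvature D x v w z := by
  obtain ⟨X, hX, rfl⟩ := exists_smoothField_eq u
  obtain ⟨Y, hY, rfl⟩ := exists_smoothField_eq v
  obtain ⟨Z, hZ, rfl⟩ := exists_smoothField_eq w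
  obtain ⟨W, hW, rfl⟩ := exists_smoothField_eq z
  rw [curvature_apply hD hX hZ hW, curvature_apply hD hY hZ hW, ← Pi.add_apply,
    curvature_apply hD (hX.add hY) hZ hW]
  exact (curvatureField_tensorial_left hD hW).add (hX.diffAt x) (hY.diffAt x)

theorem curvature_smul_left (hD : IsSmoothMetric g D) (c : ℝ) :
    curvature D x (c • u) v w = c • curvature D x u v w := by
  obtain ⟨X, hX, rfl⟩ := exists_smoothField_eq u
  obtain ⟨Y, hY, rfl⟩ := exists_smoothField_eq v
  obtain ⟨Z, hZ, rfl⟩ := exists_smoothField_eq w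
  rw [curvature_apply hD hX hY hZ, ← Pi.smul_apply, curvature_apply hD (hX.const_smul c) hY hZ]
  exact (curvatureField_tensorial_left hD hZ).smul (f := fun _ ↦ c)
    mdifferentiableAt_const (hX.diffAt x)

theorem curvature_add_mid (hD : IsSmoothMetric g D) :
    curvature D x w (u + v) z = curvature D x w u z + curvature D x w v z := by
  rw [curvature_swap, curvature_add_left _ _ _ _ hD, curvature_swap u w, curvature_swap v w]
  abel

theorem curvature_smul_mid (hD : IsSmoothMetric g D) (c : ℝ) :
    curvature D x u (c • v) w = c • curvature D x u v w := by
  rw [curvature_swap, curvature_smul_left _ _ _ hD, curvature_swap u v, smul_neg]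

theorem curvature_add_right (hD : IsSmoothMetric g D) :
    curvature D x w z (u + v) = curvature D x w z u + curvature D x w z v := by
  refine metric_ext g fun a ↦ ?_
  simp only [map_add, add_apply, curvature_skew _ _ _ _ hD]
  ring

theorem curvature_smul_right (hD : IsSmoothMetric g D) (c : ℝ) :
    curvature D x u v (c • w) = c • curvature D x u v w := by
  refine metric_ext g fun a ↦ ?_
  simp only [map_smul, smul_apply, curvature_skew _ _ _ _ hD]
  simp

/-- The curvature tensor of a metric connection as a trilinear map. -/
def curvatureMap (hD : IsSmoothMetric g D) (x : M) :
    TangentSpace I x →ₗ[ℝ] TangentSpace I x →ₗ[ℝ] Module.End ℝ (TangentSpace I x) :=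
  LinearMap.mk₂ ℝ (fun u v ↦
    { toFun := fun w ↦ curvature D x u v w
      map_add' := fun _ _ ↦ curvature_add_right _ _ _ _ hD
      map_smul' := fun _ _ ↦ curvature_smul_right _ _ _ hD _ })
    (fun _ _ _ ↦ LinearMap.ext fun _ ↦ curvature_add_left _ _ _ _ hD)
    (fun _ _ _ ↦ LinearMap.ext fun _ ↦ curvature_smul_left _ _ _ hD _)
    (fun _ _ _ ↦ LinearMap.ext fun _ ↦ curvature_add_mid _ _ _ _ hD)
    (fun _ _ _ ↦ LinearMap.ext fun _ ↦ curvature_smul_mid _ _ _ hD _)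

@[simp] theorem curvatureMap_apply (hD : IsSmoothMetric g D) :
    curvatureMap hD x u v w = curvature D x u v w := rfl

/-- The first Bianchi identity for a connection with torsion `T`. -/
theorem curvatureField_bianchi (hD : IsSmoothMetric g D) (hX : SmoothField X) (hY : SmoothField Y)
    (hZ : SmoothField Z) {T : Π x : M, TangentSpace I x → TangentSpace I x → TangentSpace I x}
    (hT : ∀ {X Y : Π x : M, TangentSpace I x}, SmoothField X → SmoothField Y → ∀ x,
      D Y x (X x) - D X x (Y x) - mlieBracket I X Y x = T x (X x) (Y x))
    (x : M) :
    curvatureField D X Y Z x + curvatureField D Y Z X x + curvatureField D Z X Y x =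
      (D (fun y ↦ T y (Y y) (Z y)) x (X x) + T x (X x) (mlieBracket I Y Z x)) +
      (D (fun y ↦ T y (Z y) (X y)) x (Y x) + T x (Y x) (mlieBracket I Z X x)) +
      (D (fun y ↦ T y (X y) (Y y)) x (Z x) + T x (Z x) (mlieBracket I X Y x)) := by
  have hM : IsManifold I (minSmoothness ℝ 3) M := by
    simp only [minSmoothness_of_isRCLikeNormedField]
    exact IsManifold.of_le (m := 3) (n := ∞) (WithTop.coe_le_coe.2 le_top)
  have h2 : ∀ {W : Π x : M, TangentSpace I x}, SmoothField W →
      CMDiffAt (minSmoothness ℝ 2) (T% W) x := by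
    intro W hW
    simp only [minSmoothness_of_isRCLikeNormedField]
    exact (hW x).of_le (WithTop.coe_le_coe.2 le_top)
  have jac := leibniz_identity_mlieBracket_apply (h2 hX) (h2 hY) (h2 hZ)
  have hTf : ∀ {X Y : Π x : M, TangentSpace I x}, SmoothField X → SmoothField Y →
      (fun y ↦ T y (X y) (Y y)) = fun y ↦ D Y y (X y) - D X y (Y y) - mlieBracket I X Y y :=
    fun hX hY ↦ funext fun y ↦ (hT hX hY y).symm
  -- The terms `∇_U [X,Y]` cancel. In the cyclic sum the second derivatives and `∇_[X,Y] U` assemble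
  -- into the three curvatures, and the double brackets vanish by Jacobi.
  have hDT : ∀ {U X Y : Π x : M, TangentSpace I x}, SmoothField U → SmoothField X →
      SmoothField Y → D (fun y ↦ T y (X y) (Y y)) x (U x) + T x (U x) (mlieBracket I X Y x) =
        D (fun y ↦ D Y y (X y)) x (U x) - D (fun y ↦ D X y (Y y)) x (U x) -
          D U x (mlieBracket I X Y x) - mlieBracket I U (mlieBracket I X Y) x := by
    intro U X Y hU hX hY
    rw [hTf hX hY, ← hT hU (hX.mlieBracket hY),
      cov_sub D (((hD.smooth hX hY).sub' (hD.smooth hY hX)).diffAt x) ((hX.mlieBracket hY).diffAt x),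
      cov_sub D ((hD.smooth hX hY).diffAt x) ((hD.smooth hY hX).diffAt x)]
    simp only [sub_apply]
    abel
  rw [hDT hX hY hZ, hDT hY hZ hX, hDT hZ hX hY]
  have e1 : mlieBracket I Y (mlieBracket I Z X) x = -mlieBracket I Y (mlieBracket I X Z) x := by
    rw [mlieBracket_swap (V := Z) (W := X)]
    have := mlieBracket_const_smul_right (I := I) (V := Y) (c := (-1 : ℝ))
      ((hX.mlieBracket hZ).diffAt x)
    simpa using this
  have e2 : mlieBracket I Z (mlieBracket I X Y) x = -mlieBracket I (mlieBracket I X Y) Z x :=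
    mlieBracket_swap_apply
  have e3 : mlieBracket I X (mlieBracket I Y Z) x + mlieBracket I Y (mlieBracket I Z X) x +
      mlieBracket I Z (mlieBracket I X Y) x = 0 := by
    rw [e1, e2, jac]; abel
  simp only [curvatureField]
  rw [← sub_eq_zero]
  refine Eq.trans ?_ e3
  abel

/-- `d (dη) = 0`. -/
theorem cyclic_mvfderiv_eq_zero {η : Π x : M, TangentSpace I x →L[ℝ] ℝ}
    (hη : ∀ {X : Π x : M, TangentSpace I x}, SmoothField X → CMDiff ∞ fun y ↦ η y (X y))
    {κ : Π x : M, TangentSpace I x → TangentSpace I x → ℝ}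
    (hκ : ∀ {X Y : Π x : M, TangentSpace I x}, SmoothField X → SmoothField Y → ∀ x,
      κ x (X x) (Y x) = d% (fun y ↦ η y (Y y)) x (X x) - d% (fun y ↦ η y (X y)) x (Y x)
        - η x (mlieBracket I X Y x))
    (hX : SmoothField X) (hY : SmoothField Y) (hZ : SmoothField Z) (x : M) :
    (d% (fun y ↦ κ y (Y y) (Z y)) x (X x) - κ x (mlieBracket I X Y x) (Z x)) +
    (d% (fun y ↦ κ y (Z y) (X y)) x (Y x) - κ x (mlieBracket I Y Z x) (X x)) +
    (d% (fun y ↦ κ y (X y) (Y y)) x (Z x) - κ x (mlieBracket I Z X x) (Y x)) = 0 := by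
  have hM : IsManifold I (minSmoothness ℝ 3) M := by
    simp only [minSmoothness_of_isRCLikeNormedField]
    exact IsManifold.of_le (m := 3) (n := ∞) (WithTop.coe_le_coe.2 le_top)
  have h2 : ∀ {W : Π x : M, TangentSpace I x}, SmoothField W →
      CMDiffAt (minSmoothness ℝ 2) (T% W) x := by
    intro W hW
    simp only [minSmoothness_of_isRCLikeNormedField]
    exact (hW x).of_le (WithTop.coe_le_coe.2 le_top)
  have jac := leibniz_identity_mlieBracket_apply (h2 hX) (h2 hY) (h2 hZ)
  -- Expanded in `η`, the second derivatives cancel cyclically because brackets act as commutators,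
  -- and the terms `η([[U,X],Y])` cancel by Jacobi.
  have h3 : ∀ {U X Y : Π x : M, TangentSpace I x}, SmoothField U → SmoothField X →
      SmoothField Y → d% (fun y ↦ κ y (X y) (Y y)) x (U x) - κ x (mlieBracket I U X x) (Y x) =
      d% (fun y ↦ d% (fun z ↦ η z (Y z)) y (X y)) x (U x)
      - d% (fun y ↦ d% (fun z ↦ η z (X z)) y (Y y)) x (U x)
      - d% (fun y ↦ η y (mlieBracket I X Y y)) x (U x)
      - d% (fun z ↦ η z (Y z)) x (mlieBracket I U X x)
      + d% (fun y ↦ η y (mlieBracket I U X y)) x (Y x)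
      + η x (mlieBracket I (mlieBracket I U X) Y x) := by
    intro U X Y hU hX hY
    rw [hκ (hU.mlieBracket hX) hY]
    simp only [hκ hX hY]
    have a1 := contMDiff_mvfderiv_apply (hη hY) hX
    have a2 := contMDiff_mvfderiv_apply (hη hX) hY
    have a3 := hη (hX.mlieBracket hY)
    rw [mvfderiv_fun_sub (mdifferentiableAt_of_contMDiff (a1.sub a2) x)
      (mdifferentiableAt_of_contMDiff a3 x),
      mvfderiv_fun_sub (mdifferentiableAt_of_contMDiff a1 x) (mdifferentiableAt_of_contMDiff a2 x)]
    simp only [sub_apply]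
    ring
  rw [h3 hX hY hZ, h3 hY hZ hX, h3 hZ hX hY,
    mvfderiv_mlieBracket_of_smooth (hη hZ) hX hY, mvfderiv_mlieBracket_of_smooth (hη hX) hY hZ,
    mvfderiv_mlieBracket_of_smooth (hη hY) hZ hX]
  have e1 : mlieBracket I (mlieBracket I Z X) Y x = mlieBracket I Y (mlieBracket I X Z) x := by
    rw [mlieBracket_swap_apply, mlieBracket_swap (V := Z) (W := X)]
    have := mlieBracket_const_smul_right (I := I) (V := Y) (c := (-1 : ℝ))
      ((hX.mlieBracket hZ).diffAt x)
    simp only [neg_smul, one_smul] at this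
    rw [this, neg_neg]
  have e2 : mlieBracket I (mlieBracket I Y Z) X x = -mlieBracket I X (mlieBracket I Y Z) x :=
    mlieBracket_swap_apply
  have e3 : η x (mlieBracket I (mlieBracket I X Y) Z x) +
      η x (mlieBracket I (mlieBracket I Y Z) X x) + η x (mlieBracket I (mlieBracket I Z X) Y x) = 0 := by
    rw [e1, e2, jac]
    simp only [map_neg, map_add]
    ring
  linarith

end MetricConnection

end SasakiGeom
end

/-! ### Linear algebra of an almost 3-contact metric space, and rigidity of its deformations. -/

noncomputable section
namespace SasakiGeom

theorem fin_three_add (i : Fin 3) :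
    i + 1 + 1 = i + 2 ∧ i + 1 + 2 = i ∧ i + 2 + 1 = i ∧ i + 2 + 2 = i + 1 := by omega

theorem sum_fin_three {A : Type*} [AddCommMonoid A] (f : Fin 3 → A) (i : Fin 3) :
    ∑ j, f j = f i + f (i + 1) + f (i + 2) := by
  rw [Fin.sum_univ_three]
  fin_cases i
  · rfl
  · change f 0 + f 1 + f 2 = f 1 + f 2 + f 0
    rw [add_assoc, add_comm]
  · change f 0 + f 1 + f 2 = f 2 + f 0 + f 1
    rw [add_comm, add_assoc]

theorem fin_three_cases (i j : Fin 3) : j = i ∨ j = i + 1 ∨ j = i + 2 := by omega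

/-- An almost 3-contact metric structure on a vector space. -/
structure ThreeContactSpace (V : Type*) [AddCommGroup V] [Module ℝ V] where
  g : V →ₗ[ℝ] V →ₗ[ℝ] ℝ
  φ : Fin 3 → V →ₗ[ℝ] V
  ξ : Fin 3 → V
  η : Fin 3 → V →ₗ[ℝ] ℝ
  symm : ∀ v w, g v w = g w v
  pos : ∀ v, v ≠ 0 → 0 < g v v
  φ_sq : ∀ i v, φ i (φ i v) = -v + η i v • ξ i
  η_ξ_self : ∀ i, η i (ξ i) = 1
  φ_eq : ∀ i v, φ (i + 2) v = φ i (φ (i + 1) v) - η (i + 1) v • ξ i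
  φ_eq' : ∀ i v, φ (i + 2) v = -φ (i + 1) (φ i v) + η i v • ξ (i + 1)
  ξ_eq : ∀ i, ξ (i + 2) = φ i (ξ (i + 1))
  ξ_eq' : ∀ i, ξ (i + 2) = -φ (i + 1) (ξ i)
  η_eq : ∀ i v, η (i + 2) v = η i (φ (i + 1) v)
  η_eq' : ∀ i v, η (i + 2) v = -η (i + 1) (φ i v)
  φ_ξ_self : ∀ i, φ i (ξ i) = 0
  η_φ_self : ∀ i v, η i (φ i v) = 0
  metric_φ : ∀ i v w, g (φ i v) (φ i w) = g v w - η i v * η i w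

namespace ThreeContactSpace

variable {V : Type*} [AddCommGroup V] [Module ℝ V] (m : ThreeContactSpace V)

theorem ext_inner {u v : V} (h : ∀ w, m.g u w = m.g v w) : u = v := by
  by_contra hne
  have h1 := m.pos (u - v) (sub_ne_zero.2 hne)
  simp [h] at h1

theorem g_ξ (i : Fin 3) (v : V) : m.g v (m.ξ i) = m.η i v := by
  have := m.metric_φ i v (m.ξ i)
  rw [m.φ_ξ_self, m.η_ξ_self, map_zero] at this
  linarith

theorem g_ξ_left (i : Fin 3) (v : V) : m.g (m.ξ i) v = m.η i v := by
  rw [m.symm, m.g_ξ]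

theorem φ_skew (i : Fin 3) (v w : V) : m.g (m.φ i v) w = -m.g v (m.φ i w) := by
  have h := m.metric_φ i (m.φ i v) w
  rw [m.φ_sq, m.η_φ_self] at h
  simp only [map_add, map_neg, map_smul, LinearMap.add_apply, LinearMap.neg_apply,
    LinearMap.smul_apply, m.g_ξ_left, m.η_φ_self, smul_eq_mul] at h
  linarith

theorem φ_ξ_add_one (i : Fin 3) : m.φ i (m.ξ (i + 1)) = m.ξ (i + 2) := (m.ξ_eq i).symm

theorem φ_ξ_add_two (i : Fin 3) : m.φ i (m.ξ (i + 2)) = -m.ξ (i + 1) := by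
  have := m.ξ_eq' (i + 2)
  simp only [(fin_three_add i).2.2.1, (fin_three_add i).2.2.2] at this
  rw [this, neg_neg]

theorem η_add_one_φ (i : Fin 3) (v : V) : m.η (i + 1) (m.φ i v) = -m.η (i + 2) v := by
  rw [m.η_eq' i, neg_neg]

theorem η_add_two_φ (i : Fin 3) (v : V) : m.η (i + 2) (m.φ i v) = m.η (i + 1) v := by
  have := m.η_eq (i + 2) v
  simp only [(fin_three_add i).2.2.1, (fin_three_add i).2.2.2] at this
  exact this.symm

theorem η_ξ_add_one (i : Fin 3) : m.η i (m.ξ (i + 1)) = 0 := by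
  have h := m.ξ_eq (i + 2)
  simp only [(fin_three_add i).2.2.1, (fin_three_add i).2.2.2] at h
  have h2 := m.φ_skew (i + 2) (m.ξ i) (m.ξ i)
  rw [← h, m.g_ξ, m.g_ξ_left] at h2
  linarith

theorem η_ξ_add_two (i : Fin 3) : m.η i (m.ξ (i + 2)) = 0 := by
  have h := m.η_ξ_add_one (i + 2)
  rw [(fin_three_add i).2.2.1, ← m.g_ξ, m.symm, m.g_ξ] at h
  exact h

theorem η_add_one_ξ (i : Fin 3) : m.η (i + 1) (m.ξ i) = 0 := by
  rw [← m.g_ξ, m.symm, m.g_ξ, m.η_ξ_add_one]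

theorem η_add_two_ξ (i : Fin 3) : m.η (i + 2) (m.ξ i) = 0 := by
  rw [← m.g_ξ, m.symm, m.g_ξ, m.η_ξ_add_two]

theorem η_add_one_ξ_add_two (i : Fin 3) : m.η (i + 1) (m.ξ (i + 2)) = 0 := by
  have := m.η_ξ_add_one (i + 1)
  rwa [(fin_three_add i).1] at this

theorem η_add_two_ξ_add_one (i : Fin 3) : m.η (i + 2) (m.ξ (i + 1)) = 0 := by
  have := m.η_add_one_ξ (i + 1)
  rwa [(fin_three_add i).1] at this

theorem η_ξ (i j : Fin 3) : m.η i (m.ξ j) = if i = j then 1 else 0 := by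
  rcases fin_three_cases i j with rfl | rfl | rfl
  · simp [m.η_ξ_self]
  · rw [m.η_ξ_add_one, if_neg (by omega)]
  · rw [m.η_ξ_add_two, if_neg (by omega)]

theorem φ_φ_add_one (i : Fin 3) (v : V) :
    m.φ i (m.φ (i + 1) v) = m.φ (i + 2) v + m.η (i + 1) v • m.ξ i := by
  rw [m.φ_eq i]; abel

theorem φ_add_one_φ (i : Fin 3) (v : V) :
    m.φ (i + 1) (m.φ i v) = -m.φ (i + 2) v + m.η i v • m.ξ (i + 1) := by
  rw [m.φ_eq' i]; abel

theorem φ_φ_add_two (i : Fin 3) (v : V) :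
    m.φ i (m.φ (i + 2) v) = -m.φ (i + 1) v + m.η (i + 2) v • m.ξ i := by
  have := m.φ_add_one_φ (i + 2) v
  simpa only [(fin_three_add i).2.2.1, (fin_three_add i).2.2.2] using this

theorem φ_add_two_φ (i : Fin 3) (v : V) :
    m.φ (i + 2) (m.φ i v) = m.φ (i + 1) v + m.η i v • m.ξ (i + 2) := by
  have := m.φ_φ_add_one (i + 2) v
  simpa only [(fin_three_add i).2.2.1, (fin_three_add i).2.2.2] using this

theorem φ_add_one_φ_add_two (i : Fin 3) (v : V) :
    m.φ (i + 1) (m.φ (i + 2) v) = m.φ i v + m.η (i + 2) v • m.ξ (i + 1) := by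
  have := m.φ_φ_add_one (i + 1) v
  simpa only [(fin_three_add i).1, (fin_three_add i).2.1] using this

theorem φ_add_two_φ_add_one (i : Fin 3) (v : V) :
    m.φ (i + 2) (m.φ (i + 1) v) = -m.φ i v + m.η (i + 1) v • m.ξ (i + 2) := by
  have := m.φ_add_one_φ (i + 1) v
  simpa only [(fin_three_add i).1, (fin_three_add i).2.1] using this

theorem φ_add_one_ξ (i : Fin 3) : m.φ (i + 1) (m.ξ i) = -m.ξ (i + 2) := by
  rw [m.ξ_eq' i, neg_neg]

theorem φ_add_two_ξ (i : Fin 3) : m.φ (i + 2) (m.ξ i) = m.ξ (i + 1) := by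
  have := m.φ_ξ_add_one (i + 2)
  simpa only [(fin_three_add i).2.2.1, (fin_three_add i).2.2.2] using this

theorem φ_add_one_ξ_add_two (i : Fin 3) : m.φ (i + 1) (m.ξ (i + 2)) = m.ξ i := by
  have := m.φ_ξ_add_one (i + 1)
  simpa only [(fin_three_add i).1, (fin_three_add i).2.1] using this

theorem φ_add_two_ξ_add_one (i : Fin 3) : m.φ (i + 2) (m.ξ (i + 1)) = -m.ξ i := by
  have := m.φ_ξ_add_two (i + 2)
  simpa only [(fin_three_add i).2.2.1, (fin_three_add i).2.2.2] using this

theorem η_φ_add_one (i : Fin 3) (v : V) : m.η i (m.φ (i + 1) v) = m.η (i + 2) v :=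
  (m.η_eq i v).symm

theorem η_φ_add_two (i : Fin 3) (v : V) : m.η i (m.φ (i + 2) v) = -m.η (i + 1) v := by
  have := m.η_add_one_φ (i + 2) v
  simpa only [(fin_three_add i).2.2.1, (fin_three_add i).2.2.2] using this

/-- The infinitesimal deformations of an almost 3-contact metric structure that preserve the metric,
as given by the first covariant derivatives `p` of `φ` and `k` of `ξ`. -/
structure Deformation (p : Fin 3 → V →ₗ[ℝ] V →ₗ[ℝ] V) (k : Fin 3 → V →ₗ[ℝ] V) : Prop where
  sq : ∀ i u v, p i u (m.φ i v) + m.φ i (p i u v) = m.g (k i u) v • m.ξ i + m.η i v • k i u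
  mul : ∀ i u v, p (i + 2) u v = p i u (m.φ (i + 1) v) + m.φ i (p (i + 1) u v)
    - m.g (k (i + 1) u) v • m.ξ i - m.η (i + 1) v • k i u
  mul' : ∀ i u v, p (i + 2) u v = -p (i + 1) u (m.φ i v) - m.φ (i + 1) (p i u v)
    + m.g (k i u) v • m.ξ (i + 1) + m.η i v • k (i + 1) u
  ξ_self : ∀ i u, p i u (m.ξ i) + m.φ i (k i u) = 0
  ξ_mul : ∀ i u, k (i + 2) u = p i u (m.ξ (i + 1)) + m.φ i (k (i + 1) u)
  ξ_mul' : ∀ i u, k (i + 2) u = -p (i + 1) u (m.ξ i) - m.φ (i + 1) (k i u)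
  skew : ∀ i u v w, m.g (p i u v) w = -m.g v (p i u w)
  orth : ∀ i j u, m.g (k i u) (m.ξ j) + m.g (k j u) (m.ξ i) = 0

namespace Deformation

variable {m} {p : Fin 3 → V →ₗ[ℝ] V →ₗ[ℝ] V} {k : Fin 3 → V →ₗ[ℝ] V} (h : m.Deformation p k)
  (hk : ∀ i u v, m.g (k i u) v = m.g (k i v) u)
  (hp : ∀ i u v w, m.g (p i u v) w + m.g (p i v w) u + m.g (p i w u) v = 0)

include h in
theorem apply_ξ_self (i : Fin 3) (u : V) : p i u (m.ξ i) = -m.φ i (k i u) :=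
  eq_neg_of_add_eq_zero_left (h.ξ_self i u)

include h in
theorem apply_ξ_add_one (i : Fin 3) (u : V) :
    p i u (m.ξ (i + 1)) = k (i + 2) u - m.φ i (k (i + 1) u) := by
  rw [h.ξ_mul i]; abel

include h in
theorem apply_ξ_add_two (i : Fin 3) (u : V) :
    p i u (m.ξ (i + 2)) = -k (i + 1) u - m.φ i (k (i + 2) u) := by
  have := h.ξ_mul' (i + 2) u
  simp only [(fin_three_add i).2.2.1, (fin_three_add i).2.2.2] at this
  rw [this]; abel

-- The cyclic identity with first argument `ξ_r` expresses `p_i(ξ_r)` through `p_i` applied to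
-- `ξ_r`, which `Deformation` expresses through the `k`. When `r ≠ i`, the third `k` that appears
-- drops out by its symmetry.
include h hk hp in
theorem inner_ξ_apply (i r : Fin 3) (X Y : V) :
    m.g (p i (m.ξ r) X) Y = m.g (k r X) (m.φ i Y) - m.g (k r Y) (m.φ i X) := by
  have h1 := hp i (m.ξ r) X Y
  rw [h.skew i X Y, m.symm Y] at h1
  have a1 := m.φ_skew i
  rcases fin_three_cases i r with rfl | rfl | rfl
  · rw [h.apply_ξ_self, h.apply_ξ_self] at h1
    simp only [map_neg, LinearMap.neg_apply, a1] at h1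
    linarith
  · rw [h.apply_ξ_add_one, h.apply_ξ_add_one] at h1
    simp only [map_sub, LinearMap.sub_apply, a1, hk (i + 2) Y X] at h1
    linarith
  · rw [h.apply_ξ_add_two, h.apply_ξ_add_two] at h1
    simp only [map_sub, map_neg, LinearMap.neg_apply, LinearMap.sub_apply, a1,
      hk (i + 1) Y X] at h1
    linarith

-- The vertical value at `ξ_s` vanishes by playing `orth` against the symmetry of `k`. On the image
-- of `φ_s`, the skewness of `p_s(ξ_r)` evaluated at `ξ_s` gives a second relation between `k_r` and
-- `k_s`, of sign opposite to `orth`. The two cases exhaust `V` since `φ_s² = -1 + η_s ⊗ ξ_s`.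
include h hk hp in
theorem inner_k_ξ (r s : Fin 3) (u : V) : m.g (k r u) (m.ξ s) = 0 := by
  have hvert : m.g (k r (m.ξ s)) (m.ξ s) = 0 := by
    linarith [h.orth r s (m.ξ s), hk s (m.ξ s) (m.ξ r), h.orth s r (m.ξ s), h.orth s s (m.ξ r)]
  have hφ : ∀ X, m.g (k r (m.φ s X)) (m.ξ s) = 0 := by
    intro X
    have h1 := h.skew s (m.ξ r) X (m.ξ s)
    rw [h.inner_ξ_apply hk hp, h.apply_ξ_self, m.φ_ξ_self, map_zero, map_neg, m.symm X,
      m.φ_skew] at h1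
    linarith [hk r (m.ξ s) (m.φ s X), hk s (m.ξ r) (m.φ s X), h.orth r s (m.φ s X)]
  have := hφ (m.φ s u)
  rw [m.φ_sq] at this
  simp only [map_add, map_neg, map_smul, LinearMap.add_apply, LinearMap.neg_apply,
    LinearMap.smul_apply, hvert, smul_zero] at this
  linarith

-- Now `p_i(ξ_r) = -(φ_i k_r + k_r φ_i)`. Inserting this in the product rule for `φ_2 = φ_0 φ_1`
-- leaves `2 φ_0 k_r φ_1 = 0`; since `k_r` has horizontal values and kills the `ξ_i`, both `φ` can
-- be cancelled.
include h hk hp in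
theorem k_eq_zero (r : Fin 3) (X : V) : k r X = 0 := by
  have hη : ∀ i s u, m.η i (k s u) = 0 := fun i s u ↦ by
    rw [← m.g_ξ, h.inner_k_ξ hk hp]
  have hξ : ∀ i s, k s (m.ξ i) = 0 := fun i s ↦ m.ext_inner fun w ↦ by
    rw [hk, h.inner_k_ξ hk hp]; simp
  have hpξ : ∀ i X, p i (m.ξ r) X = -m.φ i (k r X) - k r (m.φ i X) := by
    intro i X
    refine m.ext_inner fun Y ↦ ?_
    rw [h.inner_ξ_apply hk hp]
    simp only [map_sub, map_neg, LinearMap.neg_apply, LinearMap.sub_apply, m.φ_skew,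
      hk r (m.φ i X) Y]
    ring
  have h1 : ∀ X, m.φ 0 (k r (m.φ (0 + 1) X)) = 0 := by
    intro X
    have h2 := h.mul 0 (m.ξ r) X
    rw [hpξ, hpξ, hpξ, hξ, hξ, m.φ_φ_add_one, map_sub, map_neg, m.φ_φ_add_one, hη, map_add,
      map_smul, hξ] at h2
    simp only [map_zero, LinearMap.zero_apply, zero_smul, smul_zero, sub_zero, add_zero] at h2
    have h3 : (2 : ℝ) • m.φ 0 (k r (m.φ (0 + 1) X)) = 0 := by
      linear_combination (norm := module) (1 : ℝ) • h2
    exact (smul_eq_zero.1 h3).resolve_left two_ne_zero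
  have h2 : ∀ X, k r (m.φ (0 + 1) X) = 0 := by
    intro X
    have h3 := congrArg (m.φ 0) (h1 X)
    rw [m.φ_sq, hη] at h3
    simpa using h3
  have h3 := h2 (m.φ (0 + 1) X)
  rw [m.φ_sq, map_add, map_smul, hξ] at h3
  simpa using h3

-- With `k = 0` every `p_i u` is horizontal and anticommutes with `φ_i`. The cyclic identity shows
-- it also anticommutes with the other two `φ`. As `φ_{i+2}` is essentially `φ_i φ_{i+1}`, it also
-- commutes with `p_i u`, which forces `p_i u = 0`.
include h hk hp in
theorem p_eq_zero (i : Fin 3) (u v : V) : p i u v = 0 := by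
  have hk0 := h.k_eq_zero hk hp
  have hright : ∀ i r u, p i u (m.ξ r) = 0 := by
    intro i r u
    rcases fin_three_cases i r with rfl | rfl | rfl
    · rw [h.apply_ξ_self, hk0]; simp
    · rw [h.apply_ξ_add_one, hk0, hk0]; simp
    · rw [h.apply_ξ_add_two, hk0, hk0]; simp
  have hleft : ∀ i r v, p i (m.ξ r) v = 0 := fun i r v ↦ m.ext_inner fun w ↦ by
    rw [h.inner_ξ_apply hk hp, hk0, hk0]; simp
  have hη : ∀ i r u v, m.η r (p i u v) = 0 := fun i r u v ↦ by
    rw [← m.g_ξ, h.skew, hright]; simp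
  have hsq : ∀ i u v, p i u (m.φ i v) = -m.φ i (p i u v) := fun i u v ↦ by
    have := h.sq i u v
    rw [hk0] at this
    simp only [map_zero, LinearMap.zero_apply, zero_smul, smul_zero, add_zero] at this
    exact eq_neg_of_add_eq_zero_left this
  have hanti : ∀ i u v, p i u (m.φ (i + 1) v) + m.φ (i + 1) (p i u v) =
      -(p (i + 1) u (m.φ i v) + m.φ i (p (i + 1) u v)) := fun i u v ↦ by
    have h1 := h.mul i u v
    have h2 := h.mul' i u v
    rw [hk0, hk0] at h1 h2
    simp only [map_zero, LinearMap.zero_apply, zero_smul, smul_zero, add_zero, sub_zero] at h1 h2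
    linear_combination (norm := module) (-1 : ℝ) • h1 + (1 : ℝ) • h2
  have hJ : ∀ i u v, p i (m.φ i u) v = p i u (m.φ i v) := by
    intro i u v
    have e1 : ∀ u v w, m.g (p i u v) (m.φ i w) = m.g (p i u (m.φ i v)) w := fun u v w ↦ by
      rw [hsq, map_neg, LinearMap.neg_apply, m.φ_skew, neg_neg]
    have e2 : ∀ u v w, m.g (p i u (m.φ i v)) (m.φ i w) = -m.g (p i u v) w := fun u v w ↦ by
      rw [e1, m.φ_sq, map_add, map_neg, map_smul, hright]; simp
    have e3 : ∀ u v w, m.g (p i u v) w = -m.g (p i u w) v := fun u v w ↦ by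
      rw [h.skew, m.symm]
    -- The almost-Kähler argument: four instances of the cyclic identity, with `φ_i` inserted in an
    -- even number of slots, combine to this.
    have key : ∀ u v, p i (m.φ i u) (m.φ i v) = -p i u v := by
      intro u v
      refine m.ext_inner fun w ↦ ?_
      rw [map_neg, LinearMap.neg_apply]
      have a1 := hp i u v w
      have a2 := hp i u (m.φ i v) (m.φ i w)
      have a3 := hp i (m.φ i u) (m.φ i v) w
      have a4 := hp i (m.φ i u) v (m.φ i w)
      linarith [e2 u v w, e2 v w u, e2 w u v, e1 (m.φ i u) v w, e1 (m.φ i v) w u,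
        e1 (m.φ i w) u v]
    have := key u (m.φ i v)
    rw [m.φ_sq, map_add, map_neg, map_smul, hright, smul_zero, add_zero] at this
    exact neg_injective this
  have hJ1 : ∀ i u v, p i (m.φ i u) (m.φ (i + 1) v) + m.φ (i + 1) (p i (m.φ i u) v) =
      p i u (m.φ (i + 2) v) + m.φ (i + 2) (p i u v) := by
    intro i u v
    rw [hJ, hJ, m.φ_φ_add_one, map_add, map_smul, hright, hsq, map_neg, m.φ_add_one_φ, hη]
    module
  have hJ2 : ∀ i u v, p i (m.φ i u) (m.φ (i + 2) v) + m.φ (i + 2) (p i (m.φ i u) v) =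
      -(p i u (m.φ (i + 1) v) + m.φ (i + 1) (p i u v)) := by
    intro i u v
    rw [hJ, hJ, m.φ_φ_add_two, map_add, map_smul, hright, hsq, map_neg, map_neg, m.φ_add_two_φ, hη]
    module
  have hanti' : ∀ i u v, p (i + 2) u (m.φ i v) + m.φ i (p (i + 2) u v) =
      -(p i u (m.φ (i + 2) v) + m.φ (i + 2) (p i u v)) := fun i u v ↦ by
    have := hanti (i + 2) u v
    simpa only [(fin_three_add i).2.2.1, (fin_three_add i).2.2.2] using this
  -- The anticommutator of `p_i u` with `φ_{i+1}`. By `hanti'`, the one with `φ_{i+2}` is `-a (i +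
  -- 2)`, so three families suffice. Precomposing `u` with the `φ` permutes them up to sign (`ha1`,
  -- `ha2`), and `φ_{i+1} φ_i = -φ_{i+2}` modulo vertical vectors then gives `a = -a`.
  let a : Fin 3 → V → V → V := fun i u v ↦ p i u (m.φ (i + 1) v) + m.φ (i + 1) (p i u v)
  have hc : ∀ i u v, p i u (m.φ (i + 2) v) + m.φ (i + 2) (p i u v) = -a (i + 2) u v := by
    intro i u v
    simp only [a, (fin_three_add i).2.2.1]
    rw [hanti' i u v, neg_neg]
  have ha1 : ∀ i u v, a i (m.φ i u) v = -a (i + 2) u v := fun i u v ↦ by rw [← hc]; exact hJ1 i u v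
  have ha2 : ∀ i u v, a (i + 2) (m.φ i u) v = a i u v := fun i u v ↦ by
    have := hJ2 i u v
    rw [hc] at this
    exact neg_injective this
  have ha0 : ∀ i u v, a i u v = 0 := by
    have : ∀ i u v, a (i + 2) u v = 0 := by
      intro i u v
      have b1 := ha2 (i + 2) u v
      have b2 := ha1 (i + 1) (m.φ i u) v
      rw [(fin_three_add i).2.1, ha1 i, neg_neg, m.φ_add_one_φ] at b2
      rw [(fin_three_add i).2.2.2] at b1
      have b3 : a (i + 1) (-m.φ (i + 2) u + m.η i u • m.ξ (i + 1)) v =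
          -a (i + 1) (m.φ (i + 2) u) v := by
        simp only [a, map_add, map_neg, map_smul, LinearMap.add_apply, LinearMap.neg_apply,
          LinearMap.smul_apply, hleft, smul_zero, add_zero]
        module
      rw [b3, b1] at b2
      have b4 : (2 : ℝ) • a (i + 2) u v = 0 := by
        linear_combination (norm := module) (-1 : ℝ) • b2
      exact (smul_eq_zero.1 b4).resolve_left two_ne_zero
    intro i u v
    have := this (i + 1) u v
    rwa [(fin_three_add i).2.1] at this
  have h1 : ∀ v, p i u (m.φ (i + 1) v) = -m.φ (i + 1) (p i u v) := fun v ↦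
    eq_neg_of_add_eq_zero_left (ha0 i u v)
  have h2 : p i u (m.φ (i + 2) v) = -m.φ (i + 2) (p i u v) :=
    eq_neg_of_add_eq_zero_left (by rw [hc, ha0, neg_zero])
  -- Passing `p_i u` through `φ_i φ_{i+1}` produces two signs, through `φ_{i+2}` only one.
  have h3 := hsq i u (m.φ (i + 1) v)
  rw [h1, m.φ_φ_add_one, map_add, map_smul, hright, h2, map_neg, m.φ_φ_add_one, hη] at h3
  have h4 : (2 : ℝ) • m.φ (i + 2) (p i u v) = 0 := by
    linear_combination (norm := module) (-1 : ℝ) • h3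
  have h5 := congrArg (m.φ (i + 2)) ((smul_eq_zero.1 h4).resolve_left two_ne_zero)
  rw [m.φ_sq, hη] at h5
  simpa using h5

end Deformation
end ThreeContactSpace
end SasakiGeom
end

/-! ### Torsion, contorsion and infinitesimal rotations on a single tangent space. -/

noncomputable section
namespace SasakiGeom
namespace ThreeContactSpace

variable {V : Type*} [AddCommGroup V] [Module ℝ V] (m : ThreeContactSpace V)

theorem η_add_one_φ_add_two (i : Fin 3) (v : V) : m.η (i + 1) (m.φ (i + 2) v) = m.η i v := by
  have := m.η_φ_add_one (i + 1) v
  simpa only [(fin_three_add i).1, (fin_three_add i).2.1] using this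

theorem η_add_two_φ_add_one (i : Fin 3) (v : V) : m.η (i + 2) (m.φ (i + 1) v) = -m.η i v := by
  have := m.η_add_one_φ (i + 1) v
  simpa only [(fin_three_add i).1, (fin_three_add i).2.1] using this

theorem η_ξ_simps (i : Fin 3) :
    m.η i (m.ξ i) = 1 ∧ m.η i (m.ξ (i + 1)) = 0 ∧ m.η i (m.ξ (i + 2)) = 0 ∧
    m.η (i + 1) (m.ξ i) = 0 ∧ m.η (i + 1) (m.ξ (i + 1)) = 1 ∧ m.η (i + 1) (m.ξ (i + 2)) = 0 ∧
    m.η (i + 2) (m.ξ i) = 0 ∧ m.η (i + 2) (m.ξ (i + 1)) = 0 ∧ m.η (i + 2) (m.ξ (i + 2)) = 1 :=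
  ⟨m.η_ξ_self i, m.η_ξ_add_one i, m.η_ξ_add_two i, m.η_add_one_ξ i, m.η_ξ_self _,
    m.η_add_one_ξ_add_two i, m.η_add_two_ξ i, m.η_add_two_ξ_add_one i, m.η_ξ_self _⟩

theorem η_φ_simps (i : Fin 3) (v : V) :
    m.η i (m.φ i v) = 0 ∧ m.η i (m.φ (i + 1) v) = m.η (i + 2) v ∧
    m.η i (m.φ (i + 2) v) = -m.η (i + 1) v ∧
    m.η (i + 1) (m.φ i v) = -m.η (i + 2) v ∧ m.η (i + 1) (m.φ (i + 1) v) = 0 ∧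
    m.η (i + 1) (m.φ (i + 2) v) = m.η i v ∧
    m.η (i + 2) (m.φ i v) = m.η (i + 1) v ∧ m.η (i + 2) (m.φ (i + 1) v) = -m.η i v ∧
    m.η (i + 2) (m.φ (i + 2) v) = 0 :=
  ⟨m.η_φ_self i v, m.η_φ_add_one i v, m.η_φ_add_two i v, m.η_add_one_φ i v, m.η_φ_self _ v,
    m.η_add_one_φ_add_two i v, m.η_add_two_φ i v, m.η_add_two_φ_add_one i v, m.η_φ_self _ v⟩

theorem φ_ξ_simps (i : Fin 3) :
    m.φ i (m.ξ i) = 0 ∧ m.φ i (m.ξ (i + 1)) = m.ξ (i + 2) ∧ m.φ i (m.ξ (i + 2)) = -m.ξ (i + 1) ∧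
    m.φ (i + 1) (m.ξ i) = -m.ξ (i + 2) ∧ m.φ (i + 1) (m.ξ (i + 1)) = 0 ∧
    m.φ (i + 1) (m.ξ (i + 2)) = m.ξ i ∧
    m.φ (i + 2) (m.ξ i) = m.ξ (i + 1) ∧ m.φ (i + 2) (m.ξ (i + 1)) = -m.ξ i ∧
    m.φ (i + 2) (m.ξ (i + 2)) = 0 :=
  ⟨m.φ_ξ_self i, m.φ_ξ_add_one i, m.φ_ξ_add_two i, m.φ_add_one_ξ i, m.φ_ξ_self _,
    m.φ_add_one_ξ_add_two i, m.φ_add_two_ξ i, m.φ_add_two_ξ_add_one i, m.φ_ξ_self _⟩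

/-- The vertical endomorphisms `η_j ⊗ ξ_k - η_k ⊗ ξ_j`. -/
def N (i : Fin 3) : V →ₗ[ℝ] V :=
  (m.η (i + 1)).smulRight (m.ξ (i + 2)) - (m.η (i + 2)).smulRight (m.ξ (i + 1))

theorem N_apply (i : Fin 3) (v : V) :
    m.N i v = m.η (i + 1) v • m.ξ (i + 2) - m.η (i + 2) v • m.ξ (i + 1) := rfl

theorem N_add_one_apply (i : Fin 3) (v : V) :
    m.N (i + 1) v = m.η (i + 2) v • m.ξ i - m.η i v • m.ξ (i + 2) := by
  rw [N_apply, (fin_three_add i).1, (fin_three_add i).2.1]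

theorem N_add_two_apply (i : Fin 3) (v : V) :
    m.N (i + 2) v = m.η i v • m.ξ (i + 1) - m.η (i + 1) v • m.ξ i := by
  rw [N_apply, (fin_three_add i).2.2.1, (fin_three_add i).2.2.2]

theorem N_skew (i : Fin 3) (v w : V) : m.g (m.N i v) w = -m.g v (m.N i w) := by
  simp only [N_apply, map_sub, map_smul, LinearMap.sub_apply, LinearMap.smul_apply, g_ξ, g_ξ_left,
    smul_eq_mul]
  ring

/-- The horizontal parts of the `φ_i`. -/
def φH (i : Fin 3) : V →ₗ[ℝ] V := m.φ i - m.N i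

theorem φH_apply (i : Fin 3) (v : V) : m.φH i v = m.φ i v - m.N i v := rfl

theorem φH_skew (i : Fin 3) (v w : V) : m.g (m.φH i v) w = -m.g v (m.φH i w) := by
  simp only [φH_apply, map_sub, LinearMap.sub_apply, φ_skew, N_skew]
  ring

theorem φH_ξ (i j : Fin 3) : m.φH i (m.ξ j) = 0 := by
  rcases fin_three_cases i j with h | h | h <;> rw [h] <;>
  simp only [φH_apply, N_apply, m.φ_ξ_simps i, m.η_ξ_simps i] <;> module

theorem η_φH (i j : Fin 3) (v : V) : m.η j (m.φH i v) = 0 := by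
  rw [← g_ξ, φH_skew, φH_ξ, map_zero, neg_zero]

theorem N_ξ_add_one (i : Fin 3) : m.N i (m.ξ (i + 1)) = m.ξ (i + 2) := by
  simp only [N_apply, m.η_ξ_simps i]; module

theorem N_ξ_add_two (i : Fin 3) : m.N i (m.ξ (i + 2)) = -m.ξ (i + 1) := by
  simp only [N_apply, m.η_ξ_simps i]; module

theorem N_ξ_self (i : Fin 3) : m.N i (m.ξ i) = 0 := by
  simp only [N_apply, m.η_ξ_simps i]; module

/-- The endomorphism associated with the 2-form `dη_i` of a 3-(α,δ)-Sasaki structure. -/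
def Ω (α δ : ℝ) (i : Fin 3) : V →ₗ[ℝ] V := (2 * α) • m.φH i + (2 * δ) • m.N i

/-- The endomorphism associated with the `ξ_i`-component of the torsion of the Biquard connection of
a 3-(α,δ)-Sasaki structure. -/
def θ (α δ : ℝ) (i : Fin 3) : V →ₗ[ℝ] V := (-(2 * α)) • m.φH i + (2 * δ) • m.N i

variable (α δ : ℝ)

theorem Ω_apply (i : Fin 3) (v : V) :
    m.Ω α δ i v = (2 * α) • m.φH i v + (2 * δ) • m.N i v := rfl

theorem θ_apply (i : Fin 3) (v : V) :
    m.θ α δ i v = (-(2 * α)) • m.φH i v + (2 * δ) • m.N i v := rfl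

theorem θ_skew (i : Fin 3) (v w : V) : m.g (m.θ α δ i v) w = -m.g v (m.θ α δ i w) := by
  simp only [θ_apply, map_add, map_smul, LinearMap.add_apply, LinearMap.smul_apply, φH_skew, N_skew,
    smul_eq_mul]
  ring

theorem Ω_skew (i : Fin 3) (v w : V) : m.g (m.Ω α δ i v) w = -m.g v (m.Ω α δ i w) := by
  simp only [Ω_apply, map_add, map_smul, LinearMap.add_apply, LinearMap.smul_apply, φH_skew, N_skew,
    smul_eq_mul]
  ring

/-- The difference of the Biquard connection and the Levi-Civita connection. -/
def contorsion : V →ₗ[ℝ] V →ₗ[ℝ] V :=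
  LinearMap.mk₂ ℝ (fun u v ↦ (1 / 2 : ℝ) • ∑ l, (m.g (m.θ α δ l u) v • m.ξ l
      - m.η l u • m.θ α δ l v - m.η l v • m.θ α δ l u))
    (fun u u' v ↦ by
      rw [← smul_add, ← Finset.sum_add_distrib]
      congr 1
      refine Finset.sum_congr rfl fun l _ ↦ ?_
      simp only [map_add, LinearMap.add_apply]
      module)
    (fun c u v ↦ by
      rw [smul_comm c (1 / 2 : ℝ), Finset.smul_sum (r := c)]
      congr 1
      refine Finset.sum_congr rfl fun l _ ↦ ?_
      simp only [map_smul, LinearMap.smul_apply, smul_eq_mul]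
      module)
    (fun u v v' ↦ by
      rw [← smul_add, ← Finset.sum_add_distrib]
      congr 1
      refine Finset.sum_congr rfl fun l _ ↦ ?_
      simp only [map_add]
      module)
    (fun c u v ↦ by
      rw [smul_comm c (1 / 2 : ℝ), Finset.smul_sum (r := c)]
      congr 1
      refine Finset.sum_congr rfl fun l _ ↦ ?_
      simp only [map_smul, smul_eq_mul]
      module)

theorem contorsion_apply (u v : V) :
    m.contorsion α δ u v = (1 / 2 : ℝ) • ∑ l, (m.g (m.θ α δ l u) v • m.ξ l
      - m.η l u • m.θ α δ l v - m.η l v • m.θ α δ l u) := rfl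

theorem contorsion_skew (u v w : V) :
    m.g (m.contorsion α δ u v) w = -m.g v (m.contorsion α δ u w) := by
  simp only [contorsion_apply, map_smul, map_sum, map_sub, LinearMap.smul_apply, LinearMap.sub_apply,
    LinearMap.sum_apply, smul_eq_mul, g_ξ, g_ξ_left]
  rw [← mul_neg, ← Finset.sum_neg_distrib]
  congr 1
  refine Finset.sum_congr rfl fun l _ ↦ ?_
  rw [m.θ_skew α δ l v w, m.symm v (m.θ α δ l u)]
  ring

/-- The torsion of the Biquard connection of a 3-(α,δ)-Sasaki structure. -/
def T (u v : V) : V := ∑ l, m.g (m.θ α δ l u) v • m.ξ l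

/-- The two mixed `η ⊗ θ` terms are symmetric in `u, v` and drop out, while skewness of `θ_l`
doubles the first one. Adding the contorsion to a torsion-free connection therefore gives torsion
`T`. -/
theorem contorsion_sub (u v : V) :
    m.contorsion α δ u v - m.contorsion α δ v u = m.T α δ u v := by
  rw [contorsion_apply, contorsion_apply, ← smul_sub, ← Finset.sum_sub_distrib, T, Finset.smul_sum]
  refine Finset.sum_congr rfl fun l _ ↦ ?_
  rw [m.θ_skew α δ l v u, m.symm v (m.θ α δ l u)]
  module

theorem η_T (i : Fin 3) (u v : V) : m.η i (m.T α δ u v) = m.g (m.θ α δ i u) v := by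
  rw [T, map_sum, Finset.sum_eq_single i]
  · simp [m.η_ξ]
  · intro j _ hj
    simp [m.η_ξ, hj.symm]
  · simp

/-! ### Infinitesimal rotations -/

variable (s : Fin 3 → V →ₗ[ℝ] ℝ)

/-- The derivative of `ξ_i` in the direction of an infinitesimal rotation. -/
def rotξ (i : Fin 3) : V →ₗ[ℝ] V :=
  (s (i + 2)).smulRight (m.ξ (i + 1)) - (s (i + 1)).smulRight (m.ξ (i + 2))

/-- The derivative of `φ_i` in the direction of an infinitesimal rotation. -/
def rotφ (i : Fin 3) : V →ₗ[ℝ] V →ₗ[ℝ] V :=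
  (s (i + 2)).smulRight (m.φ (i + 1)) - (s (i + 1)).smulRight (m.φ (i + 2))

theorem rotξ_apply (i : Fin 3) (u : V) :
    m.rotξ s i u = s (i + 2) u • m.ξ (i + 1) - s (i + 1) u • m.ξ (i + 2) := rfl

theorem rotφ_apply (i : Fin 3) (u v : V) :
    m.rotφ s i u v = s (i + 2) u • m.φ (i + 1) v - s (i + 1) u • m.φ (i + 2) v := rfl

theorem rotξ_add_one_apply (i : Fin 3) (u : V) :
    m.rotξ s (i + 1) u = s i u • m.ξ (i + 2) - s (i + 2) u • m.ξ i := by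
  rw [rotξ_apply, (fin_three_add i).1, (fin_three_add i).2.1]

theorem rotξ_add_two_apply (i : Fin 3) (u : V) :
    m.rotξ s (i + 2) u = s (i + 1) u • m.ξ i - s i u • m.ξ (i + 1) := by
  rw [rotξ_apply, (fin_three_add i).2.2.1, (fin_three_add i).2.2.2]

theorem rotφ_add_one_apply (i : Fin 3) (u v : V) :
    m.rotφ s (i + 1) u v = s i u • m.φ (i + 2) v - s (i + 2) u • m.φ i v := by
  rw [rotφ_apply, (fin_three_add i).1, (fin_three_add i).2.1]

theorem rotφ_add_two_apply (i : Fin 3) (u v : V) :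
    m.rotφ s (i + 2) u v = s (i + 1) u • m.φ i v - s i u • m.φ (i + 1) v := by
  rw [rotφ_apply, (fin_three_add i).2.2.1, (fin_three_add i).2.2.2]

theorem φ_φ_simps (i : Fin 3) (v : V) :
    m.φ i (m.φ i v) = -v + m.η i v • m.ξ i ∧
    m.φ i (m.φ (i + 1) v) = m.φ (i + 2) v + m.η (i + 1) v • m.ξ i ∧
    m.φ i (m.φ (i + 2) v) = -m.φ (i + 1) v + m.η (i + 2) v • m.ξ i ∧
    m.φ (i + 1) (m.φ i v) = -m.φ (i + 2) v + m.η i v • m.ξ (i + 1) ∧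
    m.φ (i + 1) (m.φ (i + 1) v) = -v + m.η (i + 1) v • m.ξ (i + 1) ∧
    m.φ (i + 1) (m.φ (i + 2) v) = m.φ i v + m.η (i + 2) v • m.ξ (i + 1) ∧
    m.φ (i + 2) (m.φ i v) = m.φ (i + 1) v + m.η i v • m.ξ (i + 2) ∧
    m.φ (i + 2) (m.φ (i + 1) v) = -m.φ i v + m.η (i + 1) v • m.ξ (i + 2) ∧
    m.φ (i + 2) (m.φ (i + 2) v) = -v + m.η (i + 2) v • m.ξ (i + 2) :=
  ⟨m.φ_sq i v, m.φ_φ_add_one i v, m.φ_φ_add_two i v, m.φ_add_one_φ i v, m.φ_sq _ v,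
    m.φ_add_one_φ_add_two i v, m.φ_add_two_φ i v, m.φ_add_two_φ_add_one i v, m.φ_sq _ v⟩

/-- Rotating the triple by `SO(3)` preserves all the structure identities; these are their
linearisations. -/
theorem deformation_rot : m.Deformation (m.rotφ s) (m.rotξ s) where
  sq i u v := by
    simp only [rotφ_apply, rotξ_apply, map_sub, map_smul, LinearMap.sub_apply,
      LinearMap.smul_apply, g_ξ_left, smul_eq_mul, m.φ_φ_simps i]
    module
  mul i u v := by
    simp only [rotφ_add_two_apply, rotφ_add_one_apply, rotξ_add_one_apply, rotφ_apply m s i,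
      rotξ_apply m s i, map_sub, map_smul, LinearMap.sub_apply,
      LinearMap.smul_apply, g_ξ_left, smul_eq_mul, m.φ_φ_simps i]
    module
  mul' i u v := by
    simp only [rotφ_add_two_apply, rotφ_add_one_apply, rotξ_add_one_apply, rotφ_apply m s i,
      rotξ_apply m s i, map_sub, map_smul, LinearMap.sub_apply,
      LinearMap.smul_apply, g_ξ_left, smul_eq_mul, m.φ_φ_simps i]
    module
  ξ_self i u := by
    simp only [rotφ_apply, rotξ_apply, map_sub, map_smul, m.φ_ξ_simps i]
    module
  ξ_mul i u := by
    simp only [rotφ_apply m s i, rotξ_add_one_apply, rotξ_add_two_apply, map_sub, map_smul,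
      m.φ_ξ_simps i]
    module
  ξ_mul' i u := by
    simp only [rotφ_add_one_apply, rotξ_apply m s i, rotξ_add_two_apply, map_sub, map_smul,
      m.φ_ξ_simps i]
    module
  skew i u v w := by
    simp only [rotφ_apply, map_sub, map_smul, LinearMap.sub_apply, LinearMap.smul_apply, φ_skew,
      smul_eq_mul]
    ring
  orth i j u := by
    rcases fin_three_cases i j with h | h | h <;> rw [h] <;>
    simp only [rotξ_add_one_apply, rotξ_add_two_apply, rotξ_apply m s i, map_sub, map_smul,
      LinearMap.sub_apply, LinearMap.smul_apply, smul_eq_mul, g_ξ, m.η_ξ_simps i] <;> ring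

variable {m} in
theorem Deformation.sub {p p' : Fin 3 → V →ₗ[ℝ] V →ₗ[ℝ] V} {k k' : Fin 3 → V →ₗ[ℝ] V}
    (h : m.Deformation p k) (h' : m.Deformation p' k') : m.Deformation (p - p') (k - k') where
  sq i u v := by
    simp only [Pi.sub_apply, LinearMap.sub_apply, map_sub]
    linear_combination (norm := module) (1 : ℝ) • h.sq i u v - (1 : ℝ) • h'.sq i u v
  mul i u v := by
    simp only [Pi.sub_apply, LinearMap.sub_apply, map_sub]
    linear_combination (norm := module) (1 : ℝ) • h.mul i u v - (1 : ℝ) • h'.mul i u v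
  mul' i u v := by
    simp only [Pi.sub_apply, LinearMap.sub_apply, map_sub]
    linear_combination (norm := module) (1 : ℝ) • h.mul' i u v - (1 : ℝ) • h'.mul' i u v
  ξ_self i u := by
    simp only [Pi.sub_apply, LinearMap.sub_apply, map_sub]
    linear_combination (norm := module) (1 : ℝ) • h.ξ_self i u - (1 : ℝ) • h'.ξ_self i u
  ξ_mul i u := by
    simp only [Pi.sub_apply, LinearMap.sub_apply, map_sub]
    linear_combination (norm := module) (1 : ℝ) • h.ξ_mul i u - (1 : ℝ) • h'.ξ_mul i u
  ξ_mul' i u := by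
    simp only [Pi.sub_apply, LinearMap.sub_apply, map_sub]
    linear_combination (norm := module) (1 : ℝ) • h.ξ_mul' i u - (1 : ℝ) • h'.ξ_mul' i u
  skew i u v w := by
    simp only [Pi.sub_apply, LinearMap.sub_apply, map_sub]
    linear_combination h.skew i u v w - h'.skew i u v w
  orth i j u := by
    simp only [Pi.sub_apply, LinearMap.sub_apply, map_sub]
    linear_combination h.orth i j u - h'.orth i j u

/-- The derivative of `N_i` determined by derivatives `k` of the `ξ_i`. -/
def derivN (k : Fin 3 → V →ₗ[ℝ] V) (i : Fin 3) (u v : V) : V :=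
  m.g (k (i + 1) u) v • m.ξ (i + 2) + m.η (i + 1) v • k (i + 2) u
    - m.g (k (i + 2) u) v • m.ξ (i + 1) - m.η (i + 2) v • k (i + 1) u

/-- A deformation with the torsion and exterior derivatives of a 3-(α,δ)-Sasaki structure is the
infinitesimal rotation with coefficients `2δη`. -/
theorem Deformation.eq_rot {m : ThreeContactSpace V} {α δ : ℝ} (hα : α ≠ 0)
    {p : Fin 3 → V →ₗ[ℝ] V →ₗ[ℝ] V} {k : Fin 3 → V →ₗ[ℝ] V} (h : m.Deformation p k)
    (h1 : ∀ i u v, m.g (k i u) v - m.g (k i v) u + m.g (m.θ α δ i u) v = m.g u (m.Ω α δ i v))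
    (h2 : ∀ i u v w,
      m.g v ((2 * α) • p i u w - (2 * (α - δ)) • m.derivN k i u w) + m.g (m.T α δ u v) (m.Ω α δ i w) +
      (m.g w ((2 * α) • p i v u - (2 * (α - δ)) • m.derivN k i v u)
        + m.g (m.T α δ v w) (m.Ω α δ i u)) +
      (m.g u ((2 * α) • p i w v - (2 * (α - δ)) • m.derivN k i w v)
        + m.g (m.T α δ w u) (m.Ω α δ i v)) = 0) :
    p = m.rotφ (fun i ↦ (2 * δ) • m.η i) ∧ k = m.rotξ (fun i ↦ (2 * δ) • m.η i) := by
  set s : Fin 3 → V →ₗ[ℝ] ℝ := fun i ↦ (2 * δ) • m.η i with hs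
  have hd := h.sub (m.deformation_rot s)
  -- Since `Ω + θ = 4δ N`, `h1` prescribes the skew part of `k`, and it is exactly that of the
  -- rotation with coefficients `2δη`. This fixes the coefficients of `s`.
  have hk : ∀ i u v, m.g ((k - m.rotξ s) i u) v = m.g ((k - m.rotξ s) i v) u := by
    intro i u v
    have := h1 i u v
    rw [← neg_eq_iff_eq_neg.2 (m.Ω_skew α δ i u v)] at this
    simp only [θ_apply, Ω_apply, N_apply, map_add, map_sub, map_smul, LinearMap.add_apply,
      LinearMap.sub_apply, LinearMap.smul_apply, g_ξ_left, smul_eq_mul] at this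
    simp only [hs, Pi.sub_apply, rotξ_apply, map_sub, map_smul, LinearMap.sub_apply,
      LinearMap.smul_apply, g_ξ_left, smul_eq_mul]
    linarith
  have hp : ∀ i u v w, m.g ((p - m.rotφ s) i u v) w + m.g ((p - m.rotφ s) i v w) u +
      m.g ((p - m.rotφ s) i w u) v = 0 := by
    intro i u v w
    set q := p - m.rotφ s with hq
    set l := k - m.rotξ s with hl
    have ep : p = q + m.rotφ s := by rw [hq]; abel
    have ek : k = l + m.rotξ s := by rw [hl]; abel
    have hT : ∀ u v w, m.g (m.T α δ u v) (m.Ω α δ i w) =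
        2 * δ * (m.g (m.θ α δ (i + 2) u) v * m.η (i + 1) w
          - m.g (m.θ α δ (i + 1) u) v * m.η (i + 2) w) := by
      intro u v w
      rw [← neg_eq_iff_eq_neg.2 (m.Ω_skew α δ i _ w), T, sum_fin_three _ i]
      simp only [map_add, map_smul, Ω_apply, φH_ξ, N_ξ_self, N_ξ_add_one, N_ξ_add_two,
        LinearMap.add_apply, LinearMap.smul_apply, g_ξ_left, smul_eq_mul, map_neg,
        LinearMap.neg_apply, map_zero, LinearMap.zero_apply]
      ring
    have hdN : ∀ u v w, m.g v (m.derivN k i u w) = m.g v (m.derivN l i u w) +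
        2 * δ * (m.η (i + 2) u * m.g v (m.N (i + 1) w) - m.η (i + 1) u * m.g v (m.N (i + 2) w)) := by
      intro u v w
      rw [ek]
      simp only [derivN, Pi.add_apply, LinearMap.add_apply, map_add, map_sub, map_smul,
        N_add_one_apply, N_add_two_apply, rotξ_add_one_apply, rotξ_add_two_apply, hs,
        LinearMap.sub_apply, LinearMap.smul_apply, smul_eq_mul, g_ξ, g_ξ_left]
      ring
    have hpq : ∀ u v w, m.g v (p i u w) = m.g v (q i u w) +
        2 * δ * (m.η (i + 2) u * m.g v (m.φ (i + 1) w) - m.η (i + 1) u * m.g v (m.φ (i + 2) w)) := by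
      intro u v w
      rw [ep]
      simp only [Pi.add_apply, LinearMap.add_apply, map_add, rotφ_apply, map_sub, map_smul, hs,
        LinearMap.smul_apply, smul_eq_mul]
      ring
    -- Symmetry of `l` makes the cyclic sum of its contribution to the derivative of `N` vanish, so
    -- only `q` survives below.
    have hlN : m.g v (m.derivN l i u w) + m.g w (m.derivN l i v u) + m.g u (m.derivN l i w v) = 0 := by
      have c1 : ∀ r a b, m.g a (l r b) = m.g (l r b) a := fun r a b ↦ m.symm _ _
      simp only [derivN, map_add, map_sub, map_smul, smul_eq_mul, g_ξ, c1]
      rw [hk (i + 1) v u, hk (i + 1) w v, hk (i + 1) w u, hk (i + 2) v u, hk (i + 2) w v,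
        hk (i + 2) w u]
      ring
    have key := h2 i u v w
    simp only [map_sub, map_smul, hT, hdN, hpq, smul_eq_mul] at key
    have hθ : ∀ j a b, m.g (m.θ α δ j a) b =
        2 * α * m.g a (m.φ j b) - 2 * (α + δ) * m.g a (m.N j b) := by
      intro j a b
      simp only [θ_apply, φH_apply, map_add, map_sub, map_smul, LinearMap.add_apply,
        LinearMap.sub_apply, LinearMap.smul_apply, smul_eq_mul, φ_skew, N_skew]
      ring
    simp only [hθ] at key
    have e1 : ∀ a b c, m.g (q i a b) c = -m.g b (q i a c) := hd.skew i
    rw [e1, e1, e1]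
    -- In `d(dη_i) = 0` the rotation terms cancel against those with `T`. What remains is `2α` times
    -- the cyclic sum of `q`; this is where `α ≠ 0` is needed.
    have e2 : 2 * α * (m.g v (q i u w) + m.g w (q i v u) + m.g u (q i w v)) = 0 := by
      have n1 : ∀ a b, m.g a (m.N (i + 1) b) = m.η (i + 2) b * m.η i a - m.η i b * m.η (i + 2) a := by
        intro a b; simp [N_add_one_apply, g_ξ]
      have n2 : ∀ a b, m.g a (m.N (i + 2) b) = m.η i b * m.η (i + 1) a - m.η (i + 1) b * m.η i a := by
        intro a b; simp [N_add_two_apply, g_ξ]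
      have f1 : ∀ j a b, m.g a (m.φ j b) = -m.g b (m.φ j a) := fun j a b ↦ by
        rw [← m.φ_skew, m.symm]
      simp only [n1, n2] at key
      rw [f1 (i + 1) u v, f1 (i + 2) u v, f1 (i + 1) v w, f1 (i + 2) v w, f1 (i + 1) w u,
        f1 (i + 2) w u] at key
      linear_combination key + 2 * (α - δ) * hlN
    have := (mul_eq_zero.1 e2).resolve_left (mul_ne_zero two_ne_zero hα)
    linarith
  refine ⟨?_, ?_⟩
  · funext i
    ext u v
    have := hd.p_eq_zero hk hp i u v
    simp only [Pi.sub_apply, LinearMap.sub_apply] at this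
    exact sub_eq_zero.1 this
  · funext i
    ext u
    have := hd.k_eq_zero hk hp i u
    simp only [Pi.sub_apply, LinearMap.sub_apply] at this
    exact sub_eq_zero.1 this

end ThreeContactSpace
end SasakiGeom
end

/-! ### The connection `∇ = ∇^g + A` on the manifold. -/

noncomputable section
namespace SasakiGeom

set_option linter.unusedSectionVars false

section CovariantEndomorphism

variable {E : Type*} [NormedAddCommGroup E] [NormedSpace ℝ E]
  {HM : Type*} [TopologicalSpace HM] {I : ModelWithCorners ℝ E HM}
  {M : Type*} [TopologicalSpace M] [ChartedSpace HM M] [IsManifold I ∞ M]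
  [FiniteDimensional ℝ E] [T2Space M]
  (D : CovariantDerivative I E (fun x : M ↦ TangentSpace I x))
  {A : Π x : M, TangentSpace I x →L[ℝ] TangentSpace I x}

/-- The derivative of the coefficient `f` enters both terms as `df(u) A Y` and cancels. -/
theorem covariantDerivative_endomorphism_tensorial (hA : SmoothEndomorphism A) (x : M)
    (u : TangentSpace I x) :
    TensorialAt I E (fun Y : Π x : M, TangentSpace I x ↦
      D (fun y ↦ A y (Y y)) x u - A x (D Y x u)) x where
  smul {f Y} hf hY := by
    have h := cov_smul D hf (mdifferentiableAt_endomorphism_apply hA hY) u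
    have h' := cov_smul D hf hY u
    simp only [Pi.smul_apply', map_smul] at h h' ⊢
    rw [h]
    change _ - A x (D (fun y ↦ f y • Y y) x u) = _
    rw [h', map_add, map_smul, map_smul]
    module
  add {Y Y'} hY hY' := by
    have h := cov_add D (mdifferentiableAt_endomorphism_apply hA hY)
      (mdifferentiableAt_endomorphism_apply hA hY')
    have h' := cov_add D hY hY'
    simp only [Pi.add_apply, map_add] at h h' ⊢
    rw [h]
    change _ - A x (D (fun y ↦ Y y + Y' y) x u) = _
    rw [h', add_apply, add_apply, map_add]
    abel

/-- The covariant derivative of an endomorphism field. -/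
def covEnd (hA : SmoothEndomorphism A) (x : M) :
    TangentSpace I x →ₗ[ℝ] TangentSpace I x →ₗ[ℝ] TangentSpace I x :=
  LinearMap.mk₂ ℝ
    (fun u v ↦ TensorialAt.mkHom _ x (covariantDerivative_endomorphism_tensorial D hA x u) v)
    (fun u u' v ↦ by
      simp only [TensorialAt.mkHom_apply_eq_extend, map_add]
      abel)
    (fun c u v ↦ by
      simp only [TensorialAt.mkHom_apply_eq_extend, map_smul, smul_sub])
    (fun u v v' ↦ map_add _ _ _)
    (fun c u v ↦ map_smul _ _ _)

theorem covariantDerivative_endomorphism_apply (hA : SmoothEndomorphism A) {x : M}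
    {Y : Π x : M, TangentSpace I x} (hY : MDiffAt (T% Y) x) (u : TangentSpace I x) :
    D (fun y ↦ A y (Y y)) x u = covEnd D hA x u (Y x) + A x (D Y x u) := by
  have := TensorialAt.mkHom_apply (covariantDerivative_endomorphism_tensorial D hA x u) hY
  change covEnd D hA x u (Y x) = _ at this
  rw [this]
  abel

end CovariantEndomorphism

variable {n : ℕ} {M : Type*} [TopologicalSpace M]
  [ChartedSpace (EuclideanSpace ℝ (Fin (4 * n + 3))) M] [IsManifold (𝓡 (4 * n + 3)) ∞ M] [T2Space M]

namespace AlmostThreeContactMetric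

variable (𝒮 : AlmostThreeContactMetric n M)

/-- The structure on a tangent space. -/
def model (x : M) : ThreeContactSpace (Tan n x) where
  g := LinearMap.mk₂ ℝ (fun v w ↦ 𝒮.g.inner x v w) (by intros; simp) (by intros; simp)
    (by intros; simp) (by intros; simp)
  φ i := 𝒮.φ i x
  ξ i := 𝒮.ξ i x
  η i := 𝒮.η i x
  symm := 𝒮.g.symm x
  pos := 𝒮.g.pos x
  φ_sq i := 𝒮.φ_sq i x
  η_ξ_self i := 𝒮.η_ξ i x
  φ_eq i := 𝒮.φ_eq i x
  φ_eq' i := 𝒮.φ_eq' i x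
  ξ_eq i := 𝒮.ξ_eq i x
  ξ_eq' i := 𝒮.ξ_eq' i x
  η_eq i := 𝒮.η_eq i x
  η_eq' i := 𝒮.η_eq' i x
  φ_ξ_self i := 𝒮.φ_ξ i x
  η_φ_self i := 𝒮.η_φ i x
  metric_φ i := 𝒮.metric_φ i x

variable {x : M}

theorem model_g (v w : Tan n x) : (𝒮.model x).g v w = 𝒮.g.inner x v w := rfl
theorem model_φ (i : Fin 3) (v : Tan n x) : (𝒮.model x).φ i v = 𝒮.φ i x v := rfl
theorem model_ξ (i : Fin 3) : (𝒮.model x).ξ i = 𝒮.ξ i x := rfl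
theorem model_η (i : Fin 3) (v : Tan n x) : (𝒮.model x).η i v = 𝒮.η i x v := rfl

theorem inner_ξ (i : Fin 3) (v : Tan n x) : 𝒮.g.inner x v (𝒮.ξ i x) = 𝒮.η i x v :=
  (𝒮.model x).g_ξ i v

section Smooth

variable {X Y : Π x : M, Tan n x}

theorem smoothField_ξ (i : Fin 3) : SmoothField (𝒮.ξ i) := 𝒮.smooth_ξ i

theorem contMDiff_η (i : Fin 3) (hX : SmoothField X) :
    ContMDiff (𝓡 (4 * n + 3)) 𝓘(ℝ, ℝ) ∞ (fun y ↦ 𝒮.η i y (X y)) := by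
  simp only [← inner_ξ]
  exact contMDiff_metric 𝒮.g hX (𝒮.smoothField_ξ i)

theorem smoothField_φ (i : Fin 3) (hX : SmoothField X) : SmoothField fun y ↦ 𝒮.φ i y (X y) :=
  smoothField_endomorphism_apply (𝒮.smooth_φ i) hX

theorem smoothField_N (i : Fin 3) (hX : SmoothField X) :
    SmoothField fun y ↦ (𝒮.model y).N i (X y) :=
  ((𝒮.smoothField_ξ (i + 2)).smul' (𝒮.contMDiff_η (i + 1) hX)).sub'
    ((𝒮.smoothField_ξ (i + 1)).smul' (𝒮.contMDiff_η (i + 2) hX))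

theorem smoothField_φH (i : Fin 3) (hX : SmoothField X) :
    SmoothField fun y ↦ (𝒮.model y).φH i (X y) :=
  (𝒮.smoothField_φ i hX).sub' (𝒮.smoothField_N i hX)

variable (α δ : ℝ)

theorem smoothField_θ (i : Fin 3) (hX : SmoothField X) :
    SmoothField fun y ↦ (𝒮.model y).θ α δ i (X y) :=
  ((𝒮.smoothField_φH i hX).const_smul' _).add' ((𝒮.smoothField_N i hX).const_smul' _)

theorem smoothField_Ω (i : Fin 3) (hX : SmoothField X) :
    SmoothField fun y ↦ (𝒮.model y).Ω α δ i (X y) :=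
  ((𝒮.smoothField_φH i hX).const_smul' _).add' ((𝒮.smoothField_N i hX).const_smul' _)

theorem smoothField_contorsion (hX : SmoothField X) (hY : SmoothField Y) :
    SmoothField fun y ↦ (𝒮.model y).contorsion α δ (X y) (Y y) := by
  simp only [ThreeContactSpace.contorsion_apply]
  refine (SmoothField.sum fun l ↦ ?_).const_smul' _
  exact (((𝒮.smoothField_ξ l).smul' (contMDiff_metric 𝒮.g (𝒮.smoothField_θ α δ l hX) hY)).sub'
    ((𝒮.smoothField_θ α δ l hY).smul' (𝒮.contMDiff_η l hX))).sub'
    ((𝒮.smoothField_θ α δ l hX).smul' (𝒮.contMDiff_η l hY))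

end Smooth

variable (α δ : ℝ)

/-- The Biquard connection of a 3-(α,δ)-Sasaki manifold. -/
def biquard : CovariantDerivative (𝓡 (4 * n + 3)) (EuclideanSpace ℝ (Fin (4 * n + 3)))
    (fun x : M ↦ TangentSpace (𝓡 (4 * n + 3)) x) :=
  (leviCivita 𝒮.g).addOneForm fun x ↦
    have : T2Space (Tan n x) := inferInstanceAs (T2Space (EuclideanSpace ℝ (Fin (4 * n + 3))))
    have : FiniteDimensional ℝ (Tan n x) :=
      inferInstanceAs (FiniteDimensional ℝ (EuclideanSpace ℝ (Fin (4 * n + 3))))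
    (((𝒮.model x).contorsion α δ).flip).toContinuousBilinearMap

theorem biquard_apply (Y : Π x : M, Tan n x) (u : Tan n x) :
    𝒮.biquard α δ Y x u = leviCivita 𝒮.g Y x u + (𝒮.model x).contorsion α δ u (Y x) := rfl

theorem isSmoothMetric_biquard : IsSmoothMetric 𝒮.g (𝒮.biquard α δ) where
  smooth {X Y} hX hY := by
    simp only [biquard_apply]
    exact (smoothField_leviCivita 𝒮.g hX hY).add' (𝒮.smoothField_contorsion α δ hX hY)
  metric {x X Y} hX hY v := by
    have h := (𝒮.model x).contorsion_skew α δ v (X x) (Y x)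
    simp only [model_g] at h
    rw [(isLeviCivita_leviCivita 𝒮.g).1 _ _ _ hX hY v]
    simp only [biquard_apply, map_add, add_apply, h]
    ring

theorem biquard_torsion {X Y : Π x : M, Tan n x} (hX : DiffFieldAt X x) (hY : DiffFieldAt Y x) :
    𝒮.biquard α δ Y x (X x) - 𝒮.biquard α δ X x (Y x) - mlieBracket (𝓡 (4 * n + 3)) X Y x =
      (𝒮.model x).T α δ (X x) (Y x) := by
  have h := (𝒮.model x).contorsion_sub α δ (X x) (Y x)
  rw [← h, ← (isLeviCivita_leviCivita 𝒮.g).sub_eq_mlieBracket 𝒮.g hX hY, biquard_apply,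
    biquard_apply]
  abel

end AlmostThreeContactMetric

end SasakiGeom
end

/-! ### The derivatives of `φ_i` and `ξ_i` are infinitesimal rotations. -/

noncomputable section
namespace SasakiGeom

set_option linter.unusedSectionVars false

variable {n : ℕ} {M : Type*} [TopologicalSpace M]
  [ChartedSpace (EuclideanSpace ℝ (Fin (4 * n + 3))) M] [IsManifold (𝓡 (4 * n + 3)) ∞ M] [T2Space M]

theorem cov_zero (D : CovariantDerivative (𝓡 (4 * n + 3)) (EuclideanSpace ℝ (Fin (4 * n + 3)))
    (fun x : M ↦ TangentSpace (𝓡 (4 * n + 3)) x)) {x : M} (u : Tan n x) :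
    D (0 : Π y : M, Tan n y) x u = 0 := by
  obtain ⟨X, hX, -⟩ := exists_smoothField_eq u
  have := cov_const_smul D 0 (hX.diffAt x)
  simp only [zero_smul] at this
  exact congrArg (fun A : Tan n x →L[ℝ] Tan n x ↦ A u) this

namespace AlmostThreeContactMetric

variable (𝒮 : AlmostThreeContactMetric n M) {x : M}
  {D : CovariantDerivative (𝓡 (4 * n + 3)) (EuclideanSpace ℝ (Fin (4 * n + 3)))
      (fun x : M ↦ TangentSpace (𝓡 (4 * n + 3)) x)}

/-- The covariant derivatives of the `ξ_i`. -/
def covξ (D : CovariantDerivative (𝓡 (4 * n + 3)) (EuclideanSpace ℝ (Fin (4 * n + 3)))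
    (fun x : M ↦ TangentSpace (𝓡 (4 * n + 3)) x)) (x : M) (i : Fin 3) : Tan n x →ₗ[ℝ] Tan n x :=
  D (𝒮.ξ i) x

/-- The covariant derivatives of the `φ_i`. -/
def covφ (D : CovariantDerivative (𝓡 (4 * n + 3)) (EuclideanSpace ℝ (Fin (4 * n + 3)))
    (fun x : M ↦ TangentSpace (𝓡 (4 * n + 3)) x)) (x : M) (i : Fin 3) :
    Tan n x →ₗ[ℝ] Tan n x →ₗ[ℝ] Tan n x :=
  covEnd D (𝒮.smooth_φ i) x

theorem mdifferentiableAt_η (i : Fin 3) {Y : Π x : M, Tan n x} (hY : DiffFieldAt Y x) :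
    MDifferentiableAt (𝓡 (4 * n + 3)) 𝓘(ℝ) (fun y ↦ 𝒮.η i y (Y y)) x :=
  mdifferentiableAt_oneForm_apply (𝒮.smooth_η i) Filter.univ_mem hY

theorem mdifferentiableAt_φ (i : Fin 3) {Y : Π x : M, Tan n x} (hY : DiffFieldAt Y x) :
    DiffFieldAt (fun y ↦ 𝒮.φ i y (Y y)) x :=
  mdifferentiableAt_endomorphism_apply (𝒮.smooth_φ i) hY

theorem mdifferentiableAt_ξ (i : Fin 3) : DiffFieldAt (𝒮.ξ i) x := (𝒮.smoothField_ξ i).diffAt x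

theorem mdifferentiableAt_η_smul (i j : Fin 3) {Y : Π x : M, Tan n x} (hY : DiffFieldAt Y x) :
    DiffFieldAt (fun y ↦ 𝒮.η i y (Y y) • 𝒮.ξ j y) x :=
  (𝒮.mdifferentiableAt_η i hY).smul_section (𝒮.mdifferentiableAt_ξ j)

theorem cov_φ_apply (i : Fin 3) {Y : Π x : M, Tan n x} (hY : DiffFieldAt Y x) (u : Tan n x) :
    D (fun y ↦ 𝒮.φ i y (Y y)) x u =
      𝒮.covφ D x i u (Y x) + (𝒮.model x).φ i (D Y x u) :=
  covariantDerivative_endomorphism_apply D (𝒮.smooth_φ i) hY u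

theorem mvfderiv_η_apply (hD : IsSmoothMetric 𝒮.g D) (i : Fin 3) {Y : Π x : M, Tan n x}
    (hY : DiffFieldAt Y x) (u : Tan n x) :
    mvfderiv (𝓡 (4 * n + 3)) (fun y ↦ 𝒮.η i y (Y y)) x u =
      (𝒮.model x).η i (D Y x u) + (𝒮.model x).g (𝒮.covξ D x i u) (Y x) := by
  have : (fun y ↦ 𝒮.η i y (Y y)) = fun y ↦ 𝒮.g.inner y (Y y) (𝒮.ξ i y) :=
    funext fun y ↦ (𝒮.inner_ξ i _).symm
  rw [this, hD.metric hY (𝒮.mdifferentiableAt_ξ i), inner_ξ, 𝒮.g.symm x (Y x)]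
  rfl

theorem cov_η_smul_ξ (hD : IsSmoothMetric 𝒮.g D) (i j : Fin 3) {Y : Π x : M, Tan n x}
    (hY : DiffFieldAt Y x) (u : Tan n x) :
    D (fun y ↦ 𝒮.η i y (Y y) • 𝒮.ξ j y) x u =
      (𝒮.model x).η i (Y x) • 𝒮.covξ D x j u + ((𝒮.model x).η i (D Y x u) +
        (𝒮.model x).g (𝒮.covξ D x i u) (Y x)) • (𝒮.model x).ξ j := by
  rw [cov_smul D (𝒮.mdifferentiableAt_η i hY) (𝒮.mdifferentiableAt_ξ j),
    𝒮.mvfderiv_η_apply hD i hY]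
  rfl

theorem cov_N_apply (hD : IsSmoothMetric 𝒮.g D) (i : Fin 3) {Y : Π x : M, Tan n x}
    (hY : DiffFieldAt Y x) (u : Tan n x) :
    D (fun y ↦ (𝒮.model y).N i (Y y)) x u =
      (𝒮.model x).derivN (𝒮.covξ D x) i u (Y x) + (𝒮.model x).N i (D Y x u) := by
  change D (fun y ↦ 𝒮.η (i + 1) y (Y y) • 𝒮.ξ (i + 2) y
    - 𝒮.η (i + 2) y (Y y) • 𝒮.ξ (i + 1) y) x u = _
  rw [cov_sub D (𝒮.mdifferentiableAt_η_smul _ _ hY) (𝒮.mdifferentiableAt_η_smul _ _ hY), sub_apply,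
    𝒮.cov_η_smul_ξ hD _ _ hY, 𝒮.cov_η_smul_ξ hD _ _ hY, ThreeContactSpace.derivN,
    ThreeContactSpace.N_apply]
  module

theorem mdifferentiableAt_N (i : Fin 3) {Y : Π x : M, Tan n x} (hY : DiffFieldAt Y x) :
    DiffFieldAt (fun y ↦ (𝒮.model y).N i (Y y)) x :=
  mdifferentiableAt_sub_section (𝒮.mdifferentiableAt_η_smul _ _ hY)
    (𝒮.mdifferentiableAt_η_smul _ _ hY)

/-- Each field is the covariant derivative of one identity of the almost 3-contact metric structure.
-/
theorem deformation (hD : IsSmoothMetric 𝒮.g D) :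
    (𝒮.model x).Deformation (𝒮.covφ D x) (𝒮.covξ D x) where
  sq i u v := by
    obtain ⟨Y, hY, rfl⟩ := exists_smoothField_eq v
    have hY := hY.diffAt x
    have h : D (fun y ↦ 𝒮.φ i y (𝒮.φ i y (Y y))) x u =
        D (fun y ↦ 𝒮.η i y (Y y) • 𝒮.ξ i y - Y y) x u := by
      congr 2
      funext y
      rw [𝒮.φ_sq]
      abel
    rw [𝒮.cov_φ_apply i (𝒮.mdifferentiableAt_φ i hY), 𝒮.cov_φ_apply i hY,
      cov_sub D (𝒮.mdifferentiableAt_η_smul _ _ hY) hY, sub_apply, 𝒮.cov_η_smul_ξ hD _ _ hY,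
      map_add, (𝒮.model x).φ_sq] at h
    change 𝒮.covφ D x i u ((𝒮.model x).φ i (Y x)) + _ = _ at h
    linear_combination (norm := module) (1 : ℝ) • h
  mul i u v := by
    obtain ⟨Y, hY, rfl⟩ := exists_smoothField_eq v
    have hY := hY.diffAt x
    have h : D (fun y ↦ 𝒮.φ (i + 2) y (Y y)) x u =
        D (fun y ↦ 𝒮.φ i y (𝒮.φ (i + 1) y (Y y)) - 𝒮.η (i + 1) y (Y y) • 𝒮.ξ i y) x u := by
      congr 2
      funext y
      exact 𝒮.φ_eq i y (Y y)
    rw [𝒮.cov_φ_apply (i + 2) hY,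
      cov_sub D (𝒮.mdifferentiableAt_φ i (𝒮.mdifferentiableAt_φ _ hY))
        (𝒮.mdifferentiableAt_η_smul _ _ hY), sub_apply, 𝒮.cov_η_smul_ξ hD _ _ hY,
      𝒮.cov_φ_apply i (𝒮.mdifferentiableAt_φ _ hY), 𝒮.cov_φ_apply _ hY,
      map_add, (𝒮.model x).φ_eq i] at h
    change _ = 𝒮.covφ D x i u ((𝒮.model x).φ (i + 1) (Y x)) + _ - _ at h
    linear_combination (norm := module) (1 : ℝ) • h
  mul' i u v := by
    obtain ⟨Y, hY, rfl⟩ := exists_smoothField_eq v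
    have hY := hY.diffAt x
    have h : D (fun y ↦ 𝒮.φ (i + 2) y (Y y)) x u =
        D (fun y ↦ 𝒮.η i y (Y y) • 𝒮.ξ (i + 1) y - 𝒮.φ (i + 1) y (𝒮.φ i y (Y y))) x u := by
      congr 2
      funext y
      rw [𝒮.φ_eq' i y (Y y)]
      abel
    rw [𝒮.cov_φ_apply (i + 2) hY,
      cov_sub D (𝒮.mdifferentiableAt_η_smul _ _ hY)
        (𝒮.mdifferentiableAt_φ _ (𝒮.mdifferentiableAt_φ _ hY)), sub_apply,
      𝒮.cov_η_smul_ξ hD _ _ hY,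
      𝒮.cov_φ_apply _ (𝒮.mdifferentiableAt_φ _ hY), 𝒮.cov_φ_apply _ hY,
      map_add, (𝒮.model x).φ_eq' i] at h
    change _ = _ - (𝒮.covφ D x (i + 1) u ((𝒮.model x).φ i (Y x)) + _) at h
    linear_combination (norm := module) (1 : ℝ) • h
  ξ_self i u := by
    have h : D (fun y ↦ 𝒮.φ i y (𝒮.ξ i y)) x u = D (0 : Π y : M, Tan n y) x u := by
      congr 2
      funext y
      exact 𝒮.φ_ξ i y
    rw [𝒮.cov_φ_apply _ (𝒮.mdifferentiableAt_ξ i)] at h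
    exact h.trans (cov_zero D u)
  ξ_mul i u := by
    have h : D (𝒮.ξ (i + 2)) x u = D (fun y ↦ 𝒮.φ i y (𝒮.ξ (i + 1) y)) x u := by
      congr 2
      funext y
      exact 𝒮.ξ_eq i y
    rw [𝒮.cov_φ_apply _ (𝒮.mdifferentiableAt_ξ _)] at h
    exact h
  ξ_mul' i u := by
    have h : D (𝒮.ξ (i + 2)) x u = D (fun y ↦ -𝒮.φ (i + 1) y (𝒮.ξ i y)) x u := by
      congr 2
      funext y
      exact 𝒮.ξ_eq' i y
    rw [cov_neg D (𝒮.mdifferentiableAt_φ _ (𝒮.mdifferentiableAt_ξ _)), neg_apply,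
      𝒮.cov_φ_apply _ (𝒮.mdifferentiableAt_ξ _), neg_add, ← sub_eq_add_neg] at h
    exact h
  skew i u v w := by
    obtain ⟨Y, hY, rfl⟩ := exists_smoothField_eq v
    obtain ⟨Z, hZ, rfl⟩ := exists_smoothField_eq w
    have hY := hY.diffAt x
    have hZ := hZ.diffAt x
    have h1 := hD.metric (𝒮.mdifferentiableAt_φ i hY) hZ u
    have h2 := hD.metric hY (𝒮.mdifferentiableAt_φ i hZ) u
    have e : (fun y ↦ 𝒮.g.inner y (𝒮.φ i y (Y y)) (Z y)) =
        fun y ↦ -𝒮.g.inner y (Y y) (𝒮.φ i y (Z y)) :=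
      funext fun y ↦ (𝒮.model y).φ_skew i (Y y) (Z y)
    have hm := mdifferentiableAt_metric 𝒮.g hY (𝒮.mdifferentiableAt_φ i hZ)
    have e2 : mvfderiv (𝓡 (4 * n + 3)) (fun y ↦ -𝒮.g.inner y (Y y) (𝒮.φ i y (Z y))) x u =
        -mvfderiv (𝓡 (4 * n + 3)) (fun y ↦ 𝒮.g.inner y (Y y) (𝒮.φ i y (Z y))) x u := by
      have := mvfderiv_fun_mul (mdifferentiableAt_const (c := (-1 : ℝ))) hm
      simpa [mvfderiv_const] using congrArg (fun A : Tan n x →L[ℝ] ℝ ↦ A u) this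
    rw [e, e2, h2, 𝒮.cov_φ_apply _ hY, 𝒮.cov_φ_apply _ hZ] at h1
    simp only [map_add, add_apply] at h1
    have s1 := (𝒮.model x).φ_skew i (Y x) (D Z x u)
    have s2 := (𝒮.model x).φ_skew i (D Y x u) (Z x)
    simp only [model_g, model_φ] at s1 s2 h1 ⊢
    linarith
  orth i j u := by
    have h := hD.metric (𝒮.mdifferentiableAt_ξ i) (𝒮.mdifferentiableAt_ξ (x := x) j) u
    have e : (fun y ↦ 𝒮.g.inner y (𝒮.ξ i y) (𝒮.ξ j y)) = fun _ ↦ if j = i then (1 : ℝ) else 0 :=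
      funext fun y ↦ by
        rw [𝒮.inner_ξ]
        exact (𝒮.model y).η_ξ j i
    rw [e, 𝒮.g.symm x (𝒮.ξ i x)] at h
    simp only [mvfderiv_const, zero_apply] at h
    exact h.symm

/-- In the formula for `dη`, the bracket is replaced by `∇_X Y - ∇_Y X - T(X, Y)`; only the
derivative of `ξ_i`, dual to `η_i`, and the torsion remain. -/
theorem extDerivOneForm_η (hD : IsSmoothMetric 𝒮.g D)
    {T : Π x : M, Tan n x → Tan n x → Tan n x}
    (hT : ∀ {X Y : Π x : M, Tan n x}, SmoothField X → SmoothField Y → ∀ x,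
      D Y x (X x) - D X x (Y x) - mlieBracket (𝓡 (4 * n + 3)) X Y x = T x (X x) (Y x))
    (i : Fin 3) (v w : Tan n x) :
    extDerivOneForm (𝒮.η i) x v w = (𝒮.model x).g (𝒮.covξ D x i v) w
      - (𝒮.model x).g (𝒮.covξ D x i w) v + (𝒮.model x).η i (T x v w) := by
  obtain ⟨X, hX, rfl⟩ := exists_smoothField_eq v
  obtain ⟨Y, hY, rfl⟩ := exists_smoothField_eq w
  rw [extDerivOneForm_apply (𝒮.smooth_η i) Filter.univ_mem (hX.diffAt x) (hY.diffAt x),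
    𝒮.mvfderiv_η_apply hD i (hY.diffAt x), 𝒮.mvfderiv_η_apply hD i (hX.diffAt x),
    ← hT hX hY x, map_sub, map_sub]
  simp only [model_η]
  ring

variable {α δ : ℝ}

/-- `2α φ_i - 2(α - δ) N_i = 2α φH_i + 2δ N_i`: the parameter `δ` governs exactly the vertical part.
-/
theorem IsThreeSasaki.extDerivOneForm_eq {𝒮 : AlmostThreeContactMetric n M}
    (h : 𝒮.IsThreeSasaki α δ) (i : Fin 3) (v w : Tan n x) :
    extDerivOneForm (𝒮.η i) x v w = (𝒮.model x).g v ((𝒮.model x).Ω α δ i w) := by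
  rw [h.2, ThreeContactSpace.Ω_apply, ThreeContactSpace.φH_apply, ThreeContactSpace.N_apply]
  simp only [map_add, map_sub, map_smul, smul_eq_mul, ThreeContactSpace.g_ξ, Φ, model_g, model_φ,
    model_η]
  ring

theorem cov_Ω_apply (hD : IsSmoothMetric 𝒮.g D) (i : Fin 3) {Y : Π x : M, Tan n x}
    (hY : DiffFieldAt Y x) (u : Tan n x) :
    D (fun y ↦ (𝒮.model y).Ω α δ i (Y y)) x u =
      (2 * α) • 𝒮.covφ D x i u (Y x)
        - (2 * (α - δ)) • (𝒮.model x).derivN (𝒮.covξ D x) i u (Y x)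
        + (𝒮.model x).Ω α δ i (D Y x u) := by
  have e : (fun y ↦ (𝒮.model y).Ω α δ i (Y y)) = fun y ↦ (2 * α) • 𝒮.φ i y (Y y) -
      (2 * (α - δ)) • (𝒮.model y).N i (Y y) := funext fun y ↦ by
    rw [ThreeContactSpace.Ω_apply, ThreeContactSpace.φH_apply, model_φ]
    module
  have h1 := 𝒮.mdifferentiableAt_φ i hY
  have h2 := 𝒮.mdifferentiableAt_N i hY
  have h3 : DiffFieldAt (fun y ↦ (2 * α) • 𝒮.φ i y (Y y)) x := mdifferentiableAt_const.smul_section h1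
  have h4 : DiffFieldAt (fun y ↦ (2 * (α - δ)) • (𝒮.model y).N i (Y y)) x :=
    mdifferentiableAt_const.smul_section h2
  rw [e, cov_sub D h3 h4, sub_apply, cov_const_smul D _ h1,
    cov_const_smul D _ h2, smul_apply, smul_apply, 𝒮.cov_φ_apply i hY, 𝒮.cov_N_apply hD i hY,
    ThreeContactSpace.Ω_apply, ThreeContactSpace.φH_apply]
  module

/-- The characteristic vector fields and endomorphisms of a 3-(α,δ)-Sasaki manifold are rotated
by its Biquard connection. -/
theorem IsThreeSasaki.cov_eq_rot {𝒮 : AlmostThreeContactMetric n M} (h : 𝒮.IsThreeSasaki α δ)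
    (x : M) : 𝒮.covφ (𝒮.biquard α δ) x = (𝒮.model x).rotφ (fun i ↦ (2 * δ) • (𝒮.model x).η i) ∧
      𝒮.covξ (𝒮.biquard α δ) x = (𝒮.model x).rotξ (fun i ↦ (2 * δ) • (𝒮.model x).η i) := by
  have hD := 𝒮.isSmoothMetric_biquard α δ
  have hT : ∀ {X Y : Π x : M, Tan n x}, SmoothField X → SmoothField Y → ∀ x,
      𝒮.biquard α δ Y x (X x) - 𝒮.biquard α δ X x (Y x) - mlieBracket (𝓡 (4 * n + 3)) X Y x =
        (𝒮.model x).T α δ (X x) (Y x) :=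
    fun hX hY x ↦ 𝒮.biquard_torsion α δ (hX.diffAt x) (hY.diffAt x)
  refine ThreeContactSpace.Deformation.eq_rot h.1 (𝒮.deformation hD) ?_ ?_
  · intro i u v
    rw [← h.extDerivOneForm_eq, 𝒮.extDerivOneForm_η hD hT, ThreeContactSpace.η_T]
  · intro i u v w
    obtain ⟨X, hX, rfl⟩ := exists_smoothField_eq u
    obtain ⟨Y, hY, rfl⟩ := exists_smoothField_eq v
    obtain ⟨Z, hZ, rfl⟩ := exists_smoothField_eq w
    have key := cyclic_mvfderiv_eq_zero (η := 𝒮.η i) (fun hX ↦ 𝒮.contMDiff_η i hX)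
      (κ := fun x v w ↦ (𝒮.model x).g v ((𝒮.model x).Ω α δ i w))
      (fun {X Y} hX hY x ↦ by
        rw [← h.extDerivOneForm_eq,
          extDerivOneForm_apply (𝒮.smooth_η i) Filter.univ_mem (hX.diffAt x) (hY.diffAt x)])
      hX hY hZ x
    -- One cyclic term of `d(dη_i)` in terms of `∇`. The two trailing terms, which involve
    -- derivatives of the vector fields, telescope in the cyclic sum.
    have e : ∀ {X Y Z : Π x : M, Tan n x}, SmoothField X → SmoothField Y → SmoothField Z →
        mvfderiv (𝓡 (4 * n + 3)) (fun y ↦ (𝒮.model y).g (Y y) ((𝒮.model y).Ω α δ i (Z y))) x (X x)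
        - (𝒮.model x).g (mlieBracket (𝓡 (4 * n + 3)) X Y x) ((𝒮.model x).Ω α δ i (Z x)) =
        (𝒮.model x).g (Y x) ((2 * α) • 𝒮.covφ (𝒮.biquard α δ) x i (X x) (Z x)
          - (2 * (α - δ)) • (𝒮.model x).derivN (𝒮.covξ (𝒮.biquard α δ) x) i (X x) (Z x))
        + (𝒮.model x).g ((𝒮.model x).T α δ (X x) (Y x)) ((𝒮.model x).Ω α δ i (Z x))
        + (𝒮.model x).g (𝒮.biquard α δ X x (Y x)) ((𝒮.model x).Ω α δ i (Z x))
        - (𝒮.model x).g (𝒮.biquard α δ Z x (X x)) ((𝒮.model x).Ω α δ i (Y x)) := by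
      intro X Y Z hX hY hZ
      have h1 := hD.metric (hY.diffAt x) ((𝒮.smoothField_Ω α δ i hZ).diffAt x) (X x)
      rw [𝒮.cov_Ω_apply hD i (hZ.diffAt x)] at h1
      rw [← hT hX hY x]
      refine (congrArg (· - _) h1).trans ?_
      have s := (𝒮.model x).Ω_skew α δ i (Y x) (𝒮.biquard α δ Z x (X x))
      rw [(𝒮.model x).symm] at s
      simp only [← model_g, map_add, map_sub, LinearMap.sub_apply] at s ⊢
      linarith
    rw [e hX hY hZ, e hY hZ hX, e hZ hX hY] at key
    linarith

end AlmostThreeContactMetric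

end SasakiGeom
end

/-! ### Torsion and contorsion are parallel. -/

noncomputable section
namespace SasakiGeom

set_option linter.unusedSectionVars false

variable {n : ℕ} {M : Type*} [TopologicalSpace M]
  [ChartedSpace (EuclideanSpace ℝ (Fin (4 * n + 3))) M] [IsManifold (𝓡 (4 * n + 3)) ∞ M] [T2Space M]

namespace AlmostThreeContactMetric
namespace IsThreeSasaki

variable {𝒮 : AlmostThreeContactMetric n M} {α δ : ℝ} {x : M}
  {X Y Z : Π x : M, Tan n x}

theorem cov_ξ (h : 𝒮.IsThreeSasaki α δ) (i : Fin 3) (u : Tan n x) :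
    𝒮.biquard α δ (𝒮.ξ i) x u =
      (2 * δ * (𝒮.model x).η (i + 2) u) • (𝒮.model x).ξ (i + 1)
        - (2 * δ * (𝒮.model x).η (i + 1) u) • (𝒮.model x).ξ (i + 2) := by
  have := congrArg (fun k ↦ k i u) (h.cov_eq_rot x).2
  exact this

theorem cov_φ (h : 𝒮.IsThreeSasaki α δ) (i : Fin 3) (hY : DiffFieldAt Y x) (u : Tan n x) :
    𝒮.biquard α δ (fun y ↦ 𝒮.φ i y (Y y)) x u =
      (2 * δ * (𝒮.model x).η (i + 2) u) • (𝒮.model x).φ (i + 1) (Y x)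
        - (2 * δ * (𝒮.model x).η (i + 1) u) • (𝒮.model x).φ (i + 2) (Y x)
        + (𝒮.model x).φ i (𝒮.biquard α δ Y x u) := by
  rw [𝒮.cov_φ_apply i hY, (h.cov_eq_rot x).1]
  rfl

theorem mvfderiv_η (h : 𝒮.IsThreeSasaki α δ) (i : Fin 3) (hY : DiffFieldAt Y x) (u : Tan n x) :
    mvfderiv (𝓡 (4 * n + 3)) (fun y ↦ 𝒮.η i y (Y y)) x u =
      (𝒮.model x).η i (𝒮.biquard α δ Y x u) +
        (2 * δ * (𝒮.model x).η (i + 2) u * (𝒮.model x).η (i + 1) (Y x)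
          - 2 * δ * (𝒮.model x).η (i + 1) u * (𝒮.model x).η (i + 2) (Y x)) := by
  rw [𝒮.mvfderiv_η_apply (𝒮.isSmoothMetric_biquard α δ) i hY, (h.cov_eq_rot x).2,
    ThreeContactSpace.rotξ_apply]
  simp only [map_sub, map_smul, LinearMap.sub_apply, LinearMap.smul_apply,
    ThreeContactSpace.g_ξ_left, smul_eq_mul]

theorem cov_N (h : 𝒮.IsThreeSasaki α δ) (i : Fin 3) (hY : DiffFieldAt Y x) (u : Tan n x) :
    𝒮.biquard α δ (fun y ↦ (𝒮.model y).N i (Y y)) x u =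
      (2 * δ * (𝒮.model x).η (i + 2) u) • (𝒮.model x).N (i + 1) (Y x)
        - (2 * δ * (𝒮.model x).η (i + 1) u) • (𝒮.model x).N (i + 2) (Y x)
        + (𝒮.model x).N i (𝒮.biquard α δ Y x u) := by
  rw [𝒮.cov_N_apply (𝒮.isSmoothMetric_biquard α δ) i hY, (h.cov_eq_rot x).2]
  congr 1
  simp only [ThreeContactSpace.derivN, ThreeContactSpace.rotξ_add_one_apply,
    ThreeContactSpace.rotξ_add_two_apply, map_sub, map_smul, LinearMap.sub_apply,
    LinearMap.smul_apply, ThreeContactSpace.g_ξ_left, smul_eq_mul,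
    ThreeContactSpace.N_add_one_apply, ThreeContactSpace.N_add_two_apply]
  module

theorem cov_θ (h : 𝒮.IsThreeSasaki α δ) (i : Fin 3) (hY : DiffFieldAt Y x) (u : Tan n x) :
    𝒮.biquard α δ (fun y ↦ (𝒮.model y).θ α δ i (Y y)) x u =
      (2 * δ * (𝒮.model x).η (i + 2) u) • (𝒮.model x).θ α δ (i + 1) (Y x)
        - (2 * δ * (𝒮.model x).η (i + 1) u) • (𝒮.model x).θ α δ (i + 2) (Y x)
        + (𝒮.model x).θ α δ i (𝒮.biquard α δ Y x u) := by
  have e : (fun y ↦ (𝒮.model y).θ α δ i (Y y)) = fun y ↦ (2 * (α + δ)) • (𝒮.model y).N i (Y y) -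
      (2 * α) • 𝒮.φ i y (Y y) := funext fun y ↦ by
    rw [ThreeContactSpace.θ_apply, ThreeContactSpace.φH_apply, model_φ]
    module
  have h1 := 𝒮.mdifferentiableAt_φ i hY
  have h2 := 𝒮.mdifferentiableAt_N i hY
  have h3 : DiffFieldAt (fun y ↦ (2 * α) • 𝒮.φ i y (Y y)) x := mdifferentiableAt_const.smul_section h1
  have h4 : DiffFieldAt (fun y ↦ (2 * (α + δ)) • (𝒮.model y).N i (Y y)) x :=
    mdifferentiableAt_const.smul_section h2
  rw [e, cov_sub _ h4 h3, sub_apply, cov_const_smul _ _ h1,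
    cov_const_smul _ _ h2, smul_apply, smul_apply, h.cov_φ i hY, h.cov_N i hY]
  simp only [ThreeContactSpace.θ_apply, ThreeContactSpace.φH_apply]
  module

theorem cov_inner_smul_ξ (h : 𝒮.IsThreeSasaki α δ) (i : Fin 3) (hY : SmoothField Y)
    (hZ : SmoothField Z) (u : Tan n x) :
    𝒮.biquard α δ (fun y ↦ (𝒮.model y).g ((𝒮.model y).θ α δ i (Y y)) (Z y) • (𝒮.model y).ξ i) x u =
      (𝒮.model x).g ((𝒮.model x).θ α δ i (Y x)) (Z x) •
        ((2 * δ * (𝒮.model x).η (i + 2) u) • (𝒮.model x).ξ (i + 1)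
          - (2 * δ * (𝒮.model x).η (i + 1) u) • (𝒮.model x).ξ (i + 2)) +
      ((𝒮.model x).g ((2 * δ * (𝒮.model x).η (i + 2) u) • (𝒮.model x).θ α δ (i + 1) (Y x)
          - (2 * δ * (𝒮.model x).η (i + 1) u) • (𝒮.model x).θ α δ (i + 2) (Y x)
          + (𝒮.model x).θ α δ i (𝒮.biquard α δ Y x u)) (Z x) +
        (𝒮.model x).g ((𝒮.model x).θ α δ i (Y x)) (𝒮.biquard α δ Z x u)) • (𝒮.model x).ξ i := by
  have hθ := 𝒮.smoothField_θ α δ i hY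
  have h1 := cov_smul (𝒮.biquard α δ) (mdifferentiableAt_of_contMDiff (contMDiff_metric 𝒮.g hθ hZ) x)
    (𝒮.mdifferentiableAt_ξ i) u
  rw [(𝒮.isSmoothMetric_biquard α δ).metric (hθ.diffAt x) (hZ.diffAt x), h.cov_ξ,
    h.cov_θ i (hY.diffAt x)] at h1
  exact h1

theorem cov_η_smul_θ (h : 𝒮.IsThreeSasaki α δ) (i : Fin 3) (hY : SmoothField Y)
    (hZ : SmoothField Z) (u : Tan n x) :
    𝒮.biquard α δ (fun y ↦ (𝒮.model y).η i (Y y) • (𝒮.model y).θ α δ i (Z y)) x u =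
      (𝒮.model x).η i (Y x) •
        ((2 * δ * (𝒮.model x).η (i + 2) u) • (𝒮.model x).θ α δ (i + 1) (Z x)
        - (2 * δ * (𝒮.model x).η (i + 1) u) • (𝒮.model x).θ α δ (i + 2) (Z x)
        + (𝒮.model x).θ α δ i (𝒮.biquard α δ Z x u)) +
      ((𝒮.model x).η i (𝒮.biquard α δ Y x u) +
        (2 * δ * (𝒮.model x).η (i + 2) u * (𝒮.model x).η (i + 1) (Y x)
          - 2 * δ * (𝒮.model x).η (i + 1) u * (𝒮.model x).η (i + 2) (Y x))) •
        (𝒮.model x).θ α δ i (Z x) := by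
  have hθ := 𝒮.smoothField_θ α δ i hZ
  have h1 := cov_smul (𝒮.biquard α δ) (𝒮.mdifferentiableAt_η i (hY.diffAt x)) (hθ.diffAt x) u
  rw [h.mvfderiv_η i (hY.diffAt x), h.cov_θ i (hZ.diffAt x)] at h1
  exact h1

/-- The torsion of the Biquard connection is parallel. -/
theorem cov_T (h : 𝒮.IsThreeSasaki α δ) (hY : SmoothField Y) (hZ : SmoothField Z) (u : Tan n x) :
    𝒮.biquard α δ (fun y ↦ (𝒮.model y).T α δ (Y y) (Z y)) x u =
      (𝒮.model x).T α δ (𝒮.biquard α δ Y x u) (Z x) +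
        (𝒮.model x).T α δ (Y x) (𝒮.biquard α δ Z x u) := by
  have hs : ∀ i, SmoothField fun y ↦
      (𝒮.model y).g ((𝒮.model y).θ α δ i (Y y)) (Z y) • (𝒮.model y).ξ i := fun i ↦
    (𝒮.smoothField_ξ i).smul' (contMDiff_metric 𝒮.g (𝒮.smoothField_θ α δ i hY) hZ)
  simp only [ThreeContactSpace.T, sum_fin_three _ 0]
  rw [cov_add _ (((hs 0).add' (hs (0 + 1))).diffAt x) ((hs (0 + 2)).diffAt x),
    cov_add _ ((hs 0).diffAt x) ((hs (0 + 1)).diffAt x), add_apply, add_apply,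
    h.cov_inner_smul_ξ _ hY hZ, h.cov_inner_smul_ξ _ hY hZ, h.cov_inner_smul_ξ _ hY hZ]
  -- The rotation terms cancel in the sum over the three indices, since `θ_l` and `ξ_l` are rotated
  -- by the same skew matrix.
  simp only [fin_three_add 0, map_add, map_sub, map_smul, LinearMap.add_apply, LinearMap.sub_apply,
    LinearMap.smul_apply, smul_eq_mul]
  module

/-- The contorsion of the Biquard connection is parallel. -/
theorem cov_contorsion (h : 𝒮.IsThreeSasaki α δ) (hY : SmoothField Y) (hZ : SmoothField Z)
    (u : Tan n x) :
    𝒮.biquard α δ (fun y ↦ (𝒮.model y).contorsion α δ (Y y) (Z y)) x u =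
      (𝒮.model x).contorsion α δ (𝒮.biquard α δ Y x u) (Z x) +
        (𝒮.model x).contorsion α δ (Y x) (𝒮.biquard α δ Z x u) := by
  have hs1 : ∀ i, SmoothField fun y ↦
      (𝒮.model y).g ((𝒮.model y).θ α δ i (Y y)) (Z y) • (𝒮.model y).ξ i := fun i ↦
    (𝒮.smoothField_ξ i).smul' (contMDiff_metric 𝒮.g (𝒮.smoothField_θ α δ i hY) hZ)
  have hs2 : ∀ {Y Z : Π x : M, Tan n x}, SmoothField Y → SmoothField Z → ∀ i, SmoothField fun y ↦
      (𝒮.model y).η i (Y y) • (𝒮.model y).θ α δ i (Z y) := fun hY hZ i ↦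
    (𝒮.smoothField_θ α δ i hZ).smul' (𝒮.contMDiff_η i hY)
  have hs : ∀ i, SmoothField fun y ↦
      (𝒮.model y).g ((𝒮.model y).θ α δ i (Y y)) (Z y) • (𝒮.model y).ξ i
      - (𝒮.model y).η i (Y y) • (𝒮.model y).θ α δ i (Z y)
      - (𝒮.model y).η i (Z y) • (𝒮.model y).θ α δ i (Y y) := fun i ↦
    ((hs1 i).sub' (hs2 hY hZ i)).sub' (hs2 hZ hY i)
  have e : ∀ i, 𝒮.biquard α δ (fun y ↦
      (𝒮.model y).g ((𝒮.model y).θ α δ i (Y y)) (Z y) • (𝒮.model y).ξ i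
      - (𝒮.model y).η i (Y y) • (𝒮.model y).θ α δ i (Z y)
      - (𝒮.model y).η i (Z y) • (𝒮.model y).θ α δ i (Y y)) x u = _ := fun i ↦ by
    rw [cov_sub _ (((hs1 i).sub' (hs2 hY hZ i)).diffAt x) ((hs2 hZ hY i).diffAt x),
      cov_sub _ ((hs1 i).diffAt x) ((hs2 hY hZ i).diffAt x), sub_apply, sub_apply,
      h.cov_inner_smul_ξ _ hY hZ, h.cov_η_smul_θ _ hY hZ, h.cov_η_smul_θ _ hZ hY]
  simp only [ThreeContactSpace.contorsion_apply, sum_fin_three _ 0]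
  rw [cov_const_smul _ _ ((((hs 0).add' (hs (0 + 1))).add' (hs (0 + 2))).diffAt x),
    cov_add _ (((hs 0).add' (hs (0 + 1))).diffAt x) ((hs (0 + 2)).diffAt x),
    cov_add _ ((hs 0).diffAt x) ((hs (0 + 1)).diffAt x), smul_apply, add_apply, add_apply, e, e, e]
  simp only [fin_three_add 0, map_add, map_sub, map_smul, LinearMap.add_apply, LinearMap.sub_apply,
    LinearMap.smul_apply, smul_eq_mul]
  module

end IsThreeSasaki
end AlmostThreeContactMetric

end SasakiGeom
end

/-! ### Curvature of `∇` and its relation to the Levi-Civita curvature. -/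

noncomputable section
namespace SasakiGeom

set_option linter.unusedSectionVars false

variable {n : ℕ} {M : Type*} [TopologicalSpace M]
  [ChartedSpace (EuclideanSpace ℝ (Fin (4 * n + 3))) M] [IsManifold (𝓡 (4 * n + 3)) ∞ M] [T2Space M]

namespace AlmostThreeContactMetric

variable (𝒮 : AlmostThreeContactMetric n M) (α δ : ℝ) {x : M} {X Y Z : Π x : M, Tan n x}

theorem biquard_bracket (hX : SmoothField X) (hY : SmoothField Y) :
    mlieBracket (𝓡 (4 * n + 3)) X Y x = 𝒮.biquard α δ Y x (X x) - 𝒮.biquard α δ X x (Y x)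
      - (𝒮.model x).T α δ (X x) (Y x) := by
  rw [← 𝒮.biquard_torsion α δ (hX.diffAt x) (hY.diffAt x)]
  abel

variable {𝒮 α δ}

namespace IsThreeSasaki

theorem cov_η_smul_φ (h : 𝒮.IsThreeSasaki α δ) (i j : Fin 3) (hY : SmoothField Y)
    (hZ : SmoothField Z) (u : Tan n x) :
    𝒮.biquard α δ (fun y ↦ (2 * δ * (𝒮.model y).η i (Y y)) • (𝒮.model y).φ j (Z y)) x u =
      (2 * δ * (𝒮.model x).η i (Y x)) •
        ((2 * δ * (𝒮.model x).η (j + 2) u) • (𝒮.model x).φ (j + 1) (Z x)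
        - (2 * δ * (𝒮.model x).η (j + 1) u) • (𝒮.model x).φ (j + 2) (Z x)
        + (𝒮.model x).φ j (𝒮.biquard α δ Z x u)) +
      (2 * δ * ((𝒮.model x).η i (𝒮.biquard α δ Y x u) +
        (2 * δ * (𝒮.model x).η (i + 2) u * (𝒮.model x).η (i + 1) (Y x)
          - 2 * δ * (𝒮.model x).η (i + 1) u * (𝒮.model x).η (i + 2) (Y x)))) •
        (𝒮.model x).φ j (Z x) := by
  have hφ := (𝒮.smoothField_φ j hZ).const_smul' (2 * δ)
  have h1 := cov_smul (𝒮.biquard α δ) (𝒮.mdifferentiableAt_η i (hY.diffAt x)) (hφ.diffAt x) u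
  rw [h.mvfderiv_η i (hY.diffAt x), cov_const_smul _ _ ((𝒮.smoothField_φ j hZ).diffAt x), smul_apply,
    h.cov_φ j (hZ.diffAt x)] at h1
  have e : (fun y ↦ (2 * δ * (𝒮.model y).η i (Y y)) • (𝒮.model y).φ j (Z y)) =
      fun y ↦ 𝒮.η i y (Y y) • (2 * δ) • 𝒮.φ j y (Z y) := funext fun y ↦ by
    rw [model_η, model_φ]
    module
  rw [e, h1, ← model_η, ← model_φ]
  module

/-- The commutator is the curvature of the rotation form with coefficients `2δη_l`. All terms
quadratic in the `η` cancel, including those from the vertical part of `T`; the horizontal part of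
`η_l(T)` leaves `2δ · 2α = 4αδ`. -/
theorem curvature_φ (h : 𝒮.IsThreeSasaki α δ) (i : Fin 3) (u v w : Tan n x) :
    curvature (𝒮.biquard α δ) x u v ((𝒮.model x).φ i w) =
      (𝒮.model x).φ i (curvature (𝒮.biquard α δ) x u v w)
      + (4 * α * δ * (𝒮.model x).g u ((𝒮.model x).φH (i + 2) v)) • (𝒮.model x).φ (i + 1) w
      - (4 * α * δ * (𝒮.model x).g u ((𝒮.model x).φH (i + 1) v)) • (𝒮.model x).φ (i + 2) w := by
  have hD := 𝒮.isSmoothMetric_biquard α δ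
  obtain ⟨X, hX, rfl⟩ := exists_smoothField_eq u
  obtain ⟨Y, hY, rfl⟩ := exists_smoothField_eq v
  obtain ⟨Z, hZ, rfl⟩ := exists_smoothField_eq w
  rw [curvature_apply hD hX hY hZ]
  refine (curvature_apply hD hX hY (𝒮.smoothField_φ i hZ) x).trans ?_
  have e : ∀ {X Y : Π x : M, Tan n x}, SmoothField X → SmoothField Y →
      𝒮.biquard α δ (fun y ↦ 𝒮.biquard α δ (fun z ↦ 𝒮.φ i z (Z z)) y (Y y)) x (X x) =
      ((2 * δ * (𝒮.model x).η (i + 2) (Y x)) •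
          ((2 * δ * (𝒮.model x).η (i + 1 + 2) (X x)) • (𝒮.model x).φ (i + 1 + 1) (Z x)
          - (2 * δ * (𝒮.model x).η (i + 1 + 1) (X x)) • (𝒮.model x).φ (i + 1 + 2) (Z x)
          + (𝒮.model x).φ (i + 1) (𝒮.biquard α δ Z x (X x))) +
        (2 * δ * ((𝒮.model x).η (i + 2) (𝒮.biquard α δ Y x (X x)) +
          (2 * δ * (𝒮.model x).η (i + 2 + 2) (X x) * (𝒮.model x).η (i + 2 + 1) (Y x)
          - 2 * δ * (𝒮.model x).η (i + 2 + 1) (X x) * (𝒮.model x).η (i + 2 + 2) (Y x)))) •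
        (𝒮.model x).φ (i + 1) (Z x))
      - ((2 * δ * (𝒮.model x).η (i + 1) (Y x)) •
          ((2 * δ * (𝒮.model x).η (i + 2 + 2) (X x)) • (𝒮.model x).φ (i + 2 + 1) (Z x)
          - (2 * δ * (𝒮.model x).η (i + 2 + 1) (X x)) • (𝒮.model x).φ (i + 2 + 2) (Z x)
          + (𝒮.model x).φ (i + 2) (𝒮.biquard α δ Z x (X x))) +
        (2 * δ * ((𝒮.model x).η (i + 1) (𝒮.biquard α δ Y x (X x)) +
          (2 * δ * (𝒮.model x).η (i + 1 + 2) (X x) * (𝒮.model x).η (i + 1 + 1) (Y x)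
          - 2 * δ * (𝒮.model x).η (i + 1 + 1) (X x) * (𝒮.model x).η (i + 1 + 2) (Y x)))) •
        (𝒮.model x).φ (i + 2) (Z x))
      + ((2 * δ * (𝒮.model x).η (i + 2) (X x)) • (𝒮.model x).φ (i + 1) (𝒮.biquard α δ Z x (Y x))
        - (2 * δ * (𝒮.model x).η (i + 1) (X x)) • (𝒮.model x).φ (i + 2) (𝒮.biquard α δ Z x (Y x))
        + (𝒮.model x).φ i (𝒮.biquard α δ (fun y ↦ 𝒮.biquard α δ Z y (Y y)) x (X x))) := by
    intro X Y hX hY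
    have e1 : (fun y ↦ 𝒮.biquard α δ (fun z ↦ 𝒮.φ i z (Z z)) y (Y y)) = fun y ↦
      (2 * δ * (𝒮.model y).η (i + 2) (Y y)) • (𝒮.model y).φ (i + 1) (Z y)
        - (2 * δ * (𝒮.model y).η (i + 1) (Y y)) • (𝒮.model y).φ (i + 2) (Z y)
        + 𝒮.φ i y (𝒮.biquard α δ Z y (Y y)) := funext fun y ↦ h.cov_φ i (hZ.diffAt y) (Y y)
    have s : ∀ i j, SmoothField
        fun y ↦ (2 * δ * (𝒮.model y).η i (Y y)) • (𝒮.model y).φ j (Z y) := fun i j ↦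
      (𝒮.smoothField_φ j hZ).smul' (contMDiff_const.mul (𝒮.contMDiff_η i hY))
    rw [e1, cov_add _ (((s (i + 2) (i + 1)).sub' (s (i + 1) (i + 2))).diffAt x)
      ((𝒮.smoothField_φ i (hD.smooth hY hZ)).diffAt x),
      cov_sub _ ((s (i + 2) (i + 1)).diffAt x) ((s (i + 1) (i + 2)).diffAt x), add_apply, sub_apply,
      h.cov_η_smul_φ _ _ hY hZ, h.cov_η_smul_φ _ _ hY hZ, h.cov_φ i ((hD.smooth hY hZ).diffAt x)]
  have eT : ∀ l, (𝒮.model x).η l ((𝒮.model x).T α δ (X x) (Y x)) =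
      2 * α * (𝒮.model x).g (X x) ((𝒮.model x).φH l (Y x))
      - 2 * δ * ((𝒮.model x).η (l + 1) (Y x) * (𝒮.model x).η (l + 2) (X x)
        - (𝒮.model x).η (l + 2) (Y x) * (𝒮.model x).η (l + 1) (X x)) := fun l ↦ by
    rw [ThreeContactSpace.η_T, ThreeContactSpace.θ_skew, ThreeContactSpace.θ_apply,
      ThreeContactSpace.N_apply]
    simp only [map_add, map_sub, map_smul, smul_eq_mul, ThreeContactSpace.g_ξ]
    ring
  rw [curvatureField, e hX hY, e hY hX, h.cov_φ i (hZ.diffAt x), curvatureField,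
    𝒮.biquard_bracket α δ hX hY]
  simp only [map_sub, eT, fin_three_add i]
  module

/-- The curvature of the Biquard connection satisfies the Bianchi identity for parallel torsion. -/
theorem curvature_bianchi (h : 𝒮.IsThreeSasaki α δ) (u v w : Tan n x) :
    curvature (𝒮.biquard α δ) x u v w + curvature (𝒮.biquard α δ) x v w u
      + curvature (𝒮.biquard α δ) x w u v =
      (𝒮.model x).T α δ ((𝒮.model x).T α δ u v) w + (𝒮.model x).T α δ ((𝒮.model x).T α δ v w) u
        + (𝒮.model x).T α δ ((𝒮.model x).T α δ w u) v := by
  have hD := 𝒮.isSmoothMetric_biquard α δ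
  obtain ⟨X, hX, rfl⟩ := exists_smoothField_eq u
  obtain ⟨Y, hY, rfl⟩ := exists_smoothField_eq v
  obtain ⟨Z, hZ, rfl⟩ := exists_smoothField_eq w
  rw [curvature_apply hD hX hY hZ, curvature_apply hD hY hZ hX, curvature_apply hD hZ hX hY,
    curvatureField_bianchi hD hX hY hZ (T := fun x u v ↦ (𝒮.model x).T α δ u v)
      (fun hX hY x ↦ 𝒮.biquard_torsion α δ (hX.diffAt x) (hY.diffAt x)),
    h.cov_T hY hZ, h.cov_T hZ hX, h.cov_T hX hY, 𝒮.biquard_bracket α δ hX hY,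
    𝒮.biquard_bracket α δ hY hZ, 𝒮.biquard_bracket α δ hZ hX]
  -- Written as the antisymmetrised contorsion, `T` is visibly bilinear. All derivatives cancel, and
  -- only the torsion part of each bracket survives.
  simp only [← ThreeContactSpace.contorsion_sub, map_sub, LinearMap.sub_apply]
  abel

/-- The curvatures of the Levi-Civita connection and the Biquard connection. -/
theorem curvature_leviCivita (h : 𝒮.IsThreeSasaki α δ) (u v w : Tan n x) :
    curvature (leviCivita 𝒮.g) x u v w = curvature (𝒮.biquard α δ) x u v w
      + (𝒮.model x).contorsion α δ u ((𝒮.model x).contorsion α δ v w)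
      - (𝒮.model x).contorsion α δ v ((𝒮.model x).contorsion α δ u w)
      - (𝒮.model x).contorsion α δ ((𝒮.model x).T α δ u v) w := by
  have hD := 𝒮.isSmoothMetric_biquard α δ
  obtain ⟨X, hX, rfl⟩ := exists_smoothField_eq u
  obtain ⟨Y, hY, rfl⟩ := exists_smoothField_eq v
  obtain ⟨Z, hZ, rfl⟩ := exists_smoothField_eq w
  rw [curvature_apply hD hX hY hZ, curvature_apply (isSmoothMetric_leviCivita (g := 𝒮.g)) hX hY hZ]
  -- Substitute `∇^g = ∇ - A` twice. As `A` is parallel, the first-order terms combine to `A`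
  -- applied to `∇_X Y - ∇_Y X - [X,Y] = T(X, Y)`.
  have e0 : ∀ {Y Z : Π x : M, Tan n x} {x : M}, leviCivita 𝒮.g Z x (Y x) =
      𝒮.biquard α δ Z x (Y x) - (𝒮.model x).contorsion α δ (Y x) (Z x) := fun {Y Z x} ↦ by
    rw [biquard_apply]; abel
  have e : ∀ {X Y : Π x : M, Tan n x}, SmoothField X → SmoothField Y →
      leviCivita 𝒮.g (fun y ↦ leviCivita 𝒮.g Z y (Y y)) x (X x) =
      𝒮.biquard α δ (fun y ↦ 𝒮.biquard α δ Z y (Y y)) x (X x)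
      - ((𝒮.model x).contorsion α δ (𝒮.biquard α δ Y x (X x)) (Z x)
        + (𝒮.model x).contorsion α δ (Y x) (𝒮.biquard α δ Z x (X x)))
      - (𝒮.model x).contorsion α δ (X x)
        (𝒮.biquard α δ Z x (Y x) - (𝒮.model x).contorsion α δ (Y x) (Z x)) := by
    intro X Y hX hY
    rw [e0 (Z := fun y ↦ leviCivita 𝒮.g Z y (Y y))]
    simp only [e0 (Y := Y)]
    rw [cov_sub _ ((hD.smooth hY hZ).diffAt x) ((𝒮.smoothField_contorsion α δ hY hZ).diffAt x),
      sub_apply, h.cov_contorsion hY hZ]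
  rw [curvatureField, curvatureField, e hX hY, e hY hX, e0 (Y := mlieBracket _ X Y),
    𝒮.biquard_bracket α δ hX hY]
  simp only [map_sub, LinearMap.sub_apply]
  abel

end IsThreeSasaki
end AlmostThreeContactMetric

end SasakiGeom
end

/-! ### Algebra of the horizontal curvature: the horizontal Ricci tensor. -/

noncomputable section
namespace SasakiGeom
namespace ThreeContactSpace

variable {V : Type*} [AddCommGroup V] [Module ℝ V] (m : ThreeContactSpace V)

/-- Horizontal vectors. -/
def IsHorizontal (v : V) : Prop := ∀ i, m.η i v = 0

/-- Orthonormal bases of the horizontal subspace. -/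
structure HorizontalFrame {ι : Type*} [Fintype ι] [DecidableEq ι] (e : ι → V) : Prop where
  horizontal : ∀ a, m.IsHorizontal (e a)
  orthonormal : ∀ a b, m.g (e a) (e b) = if a = b then 1 else 0
  sum_smul : ∀ v, m.IsHorizontal v → ∑ a, m.g v (e a) • e a = v

variable {m}

theorem IsHorizontal.φ {v : V} (hv : m.IsHorizontal v) (i : Fin 3) : m.IsHorizontal (m.φ i v) := by
  intro j
  rcases fin_three_cases i j with h | h | h <;> rw [h] <;> simp [m.η_φ_simps i, hv _]

theorem IsHorizontal.N_eq_zero {v : V} (hv : m.IsHorizontal v) (i : Fin 3) : m.N i v = 0 := by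
  simp [N_apply, hv _]

theorem IsHorizontal.φH_eq {v : V} (hv : m.IsHorizontal v) (i : Fin 3) : m.φH i v = m.φ i v := by
  rw [φH_apply, hv.N_eq_zero, sub_zero]

theorem IsHorizontal.φ_φ {v : V} (hv : m.IsHorizontal v) (i : Fin 3) :
    m.φ i (m.φ i v) = -v ∧ m.φ i (m.φ (i + 1) v) = m.φ (i + 2) v ∧
    m.φ i (m.φ (i + 2) v) = -m.φ (i + 1) v ∧ m.φ (i + 1) (m.φ i v) = -m.φ (i + 2) v ∧
    m.φ (i + 1) (m.φ (i + 1) v) = -v ∧ m.φ (i + 1) (m.φ (i + 2) v) = m.φ i v ∧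
    m.φ (i + 2) (m.φ i v) = m.φ (i + 1) v ∧ m.φ (i + 2) (m.φ (i + 1) v) = -m.φ i v ∧
    m.φ (i + 2) (m.φ (i + 2) v) = -v := by
  simp [m.φ_φ_simps i, hv _]

theorem IsHorizontal.g_φ_φ {v w : V} (hv : m.IsHorizontal v) (i : Fin 3) :
    m.g (m.φ i v) (m.φ i w) = m.g v w := by
  rw [m.metric_φ, hv, zero_mul, sub_zero]

variable (m) in
/-- The horizontal part of a vector. -/
def hor (v : V) : V := v - ∑ i, m.η i v • m.ξ i

theorem isHorizontal_hor (v : V) : m.IsHorizontal (m.hor v) := by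
  intro j
  simp only [hor, sum_fin_three _ j, map_sub, map_add, map_smul, m.η_ξ_simps j, smul_eq_mul]
  ring

theorem hor_add_sum (v : V) : m.hor v + ∑ i, m.η i v • m.ξ i = v := by
  rw [hor]; abel

theorem isHorizontal_φH (i : Fin 3) (v : V) : m.IsHorizontal (m.φH i v) := fun j ↦ m.η_φH i j v

theorem φH_hor (i : Fin 3) (v : V) : m.φH i (m.hor v) = m.φH i v := by
  simp [hor, φH_ξ]

theorem g_hor (v w : V) : m.g (m.hor v) (m.hor w) = m.g v w - ∑ i, m.η i v * m.η i w := by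
  have h := isHorizontal_hor (m := m) v
  have e : m.g (m.hor v) (m.hor w) = m.g (m.hor v) w := by
    rw [hor.eq_def m w]
    simp [g_ξ, h _]
  rw [e]
  simp only [hor, map_sub, map_sum, map_smul, LinearMap.sub_apply, LinearMap.sum_apply,
    LinearMap.smul_apply, g_ξ_left, smul_eq_mul]

theorem g_φH_φH (i : Fin 3) (v w : V) :
    m.g (m.φH i v) (m.φH i w) = m.g (m.hor v) (m.hor w) := by
  rw [← φH_hor i v, ← φH_hor i w, (isHorizontal_hor v).φH_eq, (isHorizontal_hor w).φH_eq,
    (isHorizontal_hor v).g_φ_φ]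

section Frame

variable {ι : Type*} [Fintype ι] [DecidableEq ι] {e : ι → V}

theorem HorizontalFrame.sum_mul (he : m.HorizontalFrame e) {v : V} (hv : m.IsHorizontal v) (w : V) :
    ∑ a, m.g v (e a) * m.g (e a) w = m.g v w := by
  conv_rhs => rw [← he.sum_smul v hv]
  simp

theorem HorizontalFrame.norm (he : m.HorizontalFrame e) (a : ι) : m.g (e a) (e a) = 1 := by
  simp [he.orthonormal]

/-- The trace on the horizontal subspace is cyclic. -/
theorem HorizontalFrame.trace_comm (he : m.HorizontalFrame e) (L : V →ₗ[ℝ] V)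
    (hL : ∀ v, m.IsHorizontal v → m.IsHorizontal (L v)) (i : Fin 3) :
    ∑ a, m.g (m.φ i (L (e a))) (e a) = ∑ a, m.g (L (m.φ i (e a))) (e a) := by
  have h1 : ∀ a, m.g (m.φ i (L (e a))) (e a) =
      ∑ b, m.g (L (e a)) (e b) * -m.g (e b) (m.φ i (e a)) := fun a ↦ by
    rw [m.φ_skew, ← he.sum_mul (hL _ (he.horizontal a)), ← Finset.sum_neg_distrib]
    exact Finset.sum_congr rfl fun b _ ↦ by ring
  have h2 : ∀ a, m.g (L (m.φ i (e a))) (e a) =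
      ∑ b, m.g (m.φ i (e a)) (e b) * m.g (L (e b)) (e a) := fun a ↦ by
    conv_lhs => rw [← he.sum_smul _ ((he.horizontal a).φ i)]
    simp
  simp only [h1, h2]
  rw [Finset.sum_comm]
  refine Finset.sum_congr rfl fun b _ ↦ Finset.sum_congr rfl fun a _ ↦ ?_
  rw [← m.φ_skew, mul_comm]

/-- The horizontal curvature properties of the Biquard connection of a 3-(α,δ)-Sasaki
structure, with `c = 4αδ`. -/
structure BiquardCurvature (m : ThreeContactSpace V) (c : ℝ)
    (R : V →ₗ[ℝ] V →ₗ[ℝ] Module.End ℝ V) : Prop where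
  swap : ∀ u v w, R u v w = -R v u w
  skew : ∀ u v w z, m.g (R u v w) z = -m.g w (R u v z)
  comm : ∀ i u v w, R u v (m.φ i w) = m.φ i (R u v w)
    + (c * m.g u (m.φH (i + 2) v)) • m.φ (i + 1) w - (c * m.g u (m.φH (i + 1) v)) • m.φ (i + 2) w
  bianchi : ∀ u v w, m.IsHorizontal v → m.IsHorizontal w →
    ∀ z, m.IsHorizontal z → m.g (R u v w) z + m.g (R v w u) z + m.g (R w u v) z = 0

namespace BiquardCurvature

variable {c : ℝ} {R : V →ₗ[ℝ] V →ₗ[ℝ] Module.End ℝ V}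

/-- At `ξ_i` the commutator relation determines `φ_i (R u v ξ_i)`, because `φ_i ξ_i = 0`. A second
`φ_i` recovers `R u v ξ_i`, whose `ξ_i`-component vanishes by skewness. -/
theorem apply_ξ (hR : m.BiquardCurvature c R) (i : Fin 3) (u v : V) :
    R u v (m.ξ i) = (c * m.g u (m.φH (i + 2) v)) • m.ξ (i + 1)
      - (c * m.g u (m.φH (i + 1) v)) • m.ξ (i + 2) := by
  have h1 := congrArg (m.φ i) (hR.comm i u v (m.ξ i))
  have h2 := hR.skew u v (m.ξ i) (m.ξ i)
  rw [g_ξ, g_ξ_left] at h2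
  have h3 : m.η i (R u v (m.ξ i)) = 0 := by linarith
  simp only [m.φ_ξ_simps i, map_zero, map_add, map_sub, map_smul, map_neg, m.φ_sq, h3] at h1
  linear_combination (norm := module) (1 : ℝ) • h1

theorem horizontal (hR : m.BiquardCurvature c R) (u v : V) {w : V} (hw : m.IsHorizontal w) :
    m.IsHorizontal (R u v w) := by
  intro i
  rw [← m.g_ξ, hR.skew, hR.apply_ξ]
  simp [g_ξ, hw _]

/-- The trilinear form is symmetric in `u, v`, by Bianchi and verticality of `R u v ξ_r`, and skew
in `v, w`; such a form is zero. -/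
theorem mixed (hR : m.BiquardCurvature c R) (r : Fin 3) {u v w : V} (hu : m.IsHorizontal u)
    (hv : m.IsHorizontal v) (hw : m.IsHorizontal w) : m.g (R (m.ξ r) u v) w = 0 := by
  have sym : ∀ u v w, m.IsHorizontal u → m.IsHorizontal v → m.IsHorizontal w →
      m.g (R (m.ξ r) u v) w = m.g (R (m.ξ r) v u) w := by
    intro u v w hu hv hw
    have h1 := hR.bianchi (m.ξ r) u v hu hv w hw
    rw [hR.apply_ξ, hR.swap v] at h1
    simp only [map_sub, map_smul, map_neg, LinearMap.sub_apply, LinearMap.smul_apply,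
      LinearMap.neg_apply, g_ξ_left, hw _, smul_zero] at h1
    linarith
  have sk : ∀ u v w, m.g (R (m.ξ r) u v) w = -m.g (R (m.ξ r) u w) v := fun u v w ↦ by
    rw [hR.skew, m.symm]
  linarith [sym u v w hu hv hw, sk v u w, sym v w u hv hw hu, sk w v u, sym w u v hw hu hv, sk u w v]

variable (R e) in
/-- The horizontal trace of the curvature. -/
def ricciH (v w : V) : ℝ := ∑ a, m.g (R (e a) v w) (e a)

/-- Bianchi for `e_a, v, w` paired with `e_a`; the term `g(R(v,w)e_a, e_a)` is zero by skewness. -/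
theorem ricciH_symm (hR : m.BiquardCurvature c R) (he : m.HorizontalFrame e) {v w : V}
    (hv : m.IsHorizontal v) (hw : m.IsHorizontal w) :
    ricciH (m := m) e R v w = ricciH (m := m) e R w v := by
  refine Finset.sum_congr rfl fun a _ ↦ ?_
  have hz := he.horizontal a
  have s1 : ∀ u v w z, m.g (R u v w) z = -m.g (R u v z) w := fun u v w z ↦ by
    rw [hR.skew, m.symm]
  have s2 : ∀ u v w z, m.g (R u v w) z = -m.g (R v u w) z := fun u v w z ↦ by
    rw [hR.swap]; simp
  have b1 := hR.bianchi (e a) v w hv hw (e a) hz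
  linarith [s2 w (e a) v (e a), s1 v w (e a) (e a)]

/-- Write `φ_i = φ_{i+1} φ_{i+2}` on horizontal vectors and move `φ_{i+2}` round the trace.
Commuting it past `R` returns minus the same trace plus a multiple of the identity, hence the
dimension factor, halved. -/
theorem trace_mul_φ (hR : m.BiquardCurvature c R) (he : m.HorizontalFrame e) (i : Fin 3) {u v : V}
    (hv : m.IsHorizontal v) :
    ∑ a, m.g (R u v (e a)) (m.φ i (e a)) =
      Fintype.card ι / 2 * c * m.g u (m.φ i v) := by
  have hL : ∀ w, m.IsHorizontal w → m.IsHorizontal (R u v w) := fun w hw ↦ hR.horizontal u v hw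
  have t1 := he.trace_comm (R u v ∘ₗ m.φ (i + 1)) (fun w hw ↦ hL _ (hw.φ _)) (i + 2)
  have t2 := he.trace_comm (R u v) hL i
  simp only [LinearMap.comp_apply] at t1
  have e1 : ∀ a, m.φ (i + 2) (R u v (m.φ (i + 1) (e a))) = -m.φ i (R u v (e a))
      + (c * m.g u (m.φ i v)) • -e a - (c * m.g u (m.φ (i + 2) v)) • m.φ (i + 1) (e a) := fun a ↦ by
    rw [hR.comm]
    simp only [map_add, map_sub, map_smul, fin_three_add i, (hL _ (he.horizontal a)).φ_φ i,
      (he.horizontal a).φ_φ i, hv.φH_eq]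
  have e2 : ∀ a, m.φ (i + 1) (m.φ (i + 2) (e a)) = m.φ i (e a) := fun a ↦
    ((he.horizontal a).φ_φ i).2.2.2.2.2.1
  have e3 : ∀ a, m.g (m.φ (i + 1) (e a)) (e a) = 0 := fun a ↦ by
    have := m.φ_skew (i + 1) (e a) (e a)
    rw [m.symm (e a)] at this
    linarith
  simp only [e1, e2, map_add, map_sub, map_neg, map_smul, LinearMap.add_apply, LinearMap.sub_apply,
    LinearMap.neg_apply, LinearMap.smul_apply, smul_eq_mul, he.norm, e3, mul_zero, sub_zero,
    Finset.sum_add_distrib, Finset.sum_neg_distrib, Finset.sum_const, Finset.card_univ,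
    nsmul_eq_mul] at t1
  have e4 : ∀ a, m.g (R u v (e a)) (m.φ i (e a)) = -m.g (m.φ i (R u v (e a))) (e a) := fun a ↦ by
    rw [m.φ_skew, neg_neg]
  simp only [e4, Finset.sum_neg_distrib]
  linarith

/-- Skewness moves `φ_i` from `e_a` onto the curvature, and commuting it past `R` gives the Ricci
term. The two correction terms contract over the frame to `-c g(w, φ_i v)` each. -/
theorem sum_g_φ (hR : m.BiquardCurvature c R) (he : m.HorizontalFrame e) (i : Fin 3) {v w : V}
    (hv : m.IsHorizontal v) (hw : m.IsHorizontal w) :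
    ∑ a, m.g (R (e a) v w) (m.φ i (e a)) =
      -ricciH (m := m) e R v (m.φ i w) - 2 * c * m.g w (m.φ i v) := by
  have e1 : ∀ a, m.g (R (e a) v w) (m.φ i (e a)) = -m.g (R (e a) v (m.φ i w)) (e a)
      + c * (m.g (m.φ (i + 2) v) (e a) * m.g (e a) (m.φ (i + 1) w))
      - c * (m.g (m.φ (i + 1) v) (e a) * m.g (e a) (m.φ (i + 2) w)) := fun a ↦ by
    rw [hR.comm, m.symm _ (m.φ i (e a)), m.φ_skew, hv.φH_eq, hv.φH_eq, m.symm (e a)]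
    simp only [map_add, map_sub, map_smul, LinearMap.add_apply, LinearMap.sub_apply,
      LinearMap.smul_apply, smul_eq_mul]
    rw [m.symm (e a) (m.φ (i + 1) w), m.symm (e a) (m.φ (i + 2) w), m.symm (e a) (m.φ (i + 2) v),
      m.symm (e a) (m.φ (i + 1) v)]
    ring
  simp only [e1, Finset.sum_add_distrib, Finset.sum_sub_distrib, Finset.sum_neg_distrib,
    ← Finset.mul_sum, he.sum_mul (hv.φ _)]
  rw [m.φ_skew, m.φ_skew, (hw.φ_φ i).2.2.2.2.2.2.2.1, (hw.φ_φ i).2.2.2.2.2.1, ricciH,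
    m.symm w, m.φ_skew i v]
  simp only [map_neg]
  ring

/-- The horizontal Ricci tensor. -/
theorem ricciH_eq (hR : m.BiquardCurvature c R) (he : m.HorizontalFrame e) {v w : V}
    (hv : m.IsHorizontal v) (hw : m.IsHorizontal w) :
    ricciH (m := m) e R v w = (Fintype.card ι / 4 + 2) * c * m.g v w := by
  -- Bianchi rewrites the trace of `trace_mul_φ` at `(v, φ_i w)` as a difference of two sums of the
  -- kind in `sum_g_φ`. The constant is half of `dim/2 + 4`.
  have key : ∀ (i : Fin 3) {v w : V}, m.IsHorizontal v → m.IsHorizontal w →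
      ricciH (m := m) e R v w + ricciH (m := m) e R (m.φ i w) (m.φ i v) =
        2 * ((Fintype.card ι / 4 + 2) * c * m.g v w) := by
    intro i v w hv hw
    have hw' := hw.φ i
    have h1 := hR.trace_mul_φ he i (u := v) hw'
    have h2 : ∀ a, m.g (R v (m.φ i w) (e a)) (m.φ i (e a)) =
        m.g (R (e a) (m.φ i w) v) (m.φ i (e a)) - m.g (R (e a) v (m.φ i w)) (m.φ i (e a)) := by
      intro a
      have b := hR.bianchi v (m.φ i w) (e a) hw' (he.horizontal a) _ ((he.horizontal a).φ i)
      rw [hR.swap (m.φ i w) (e a)] at b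
      simp only [map_neg, LinearMap.neg_apply] at b
      linarith
    simp only [h2, Finset.sum_sub_distrib] at h1
    rw [hR.sum_g_φ he i hw' hv, hR.sum_g_φ he i hv hw', (hw.φ_φ i).1, hw.g_φ_φ, m.symm w v] at h1
    have e1 : ricciH (m := m) e R v (-w) = -ricciH (m := m) e R v w := by simp [ricciH]
    simp only [e1, map_neg] at h1
    linarith
  -- The three relations involve the Ricci values at `(v, w)` and at its images under `φ_0` and
  -- `φ_2`, since `φ_1 φ_0 = -φ_2`. The combination `k0 - k1 + k2` isolates `(v, w)`.
  have k0 := key 0 hv hw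
  have k1 := key 1 (hw.φ 0) (hv.φ 0)
  have k2 := key 2 hv hw
  have s := hR.ricciH_symm he hv hw
  have e1 : ∀ v, m.IsHorizontal v → m.φ 1 (m.φ 0 v) = -m.φ 2 v := fun v hv ↦ (hv.φ_φ 0).2.2.2.1
  rw [e1 v hv, e1 w hw, hw.g_φ_φ, m.symm w v] at k1
  have e2 : ricciH (m := m) e R (-m.φ 2 v) (-m.φ 2 w) = ricciH (m := m) e R (m.φ 2 v) (m.φ 2 w) := by
    simp [ricciH]
  have s2 := hR.ricciH_symm he (hv.φ 2) (hw.φ 2)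
  rw [e2] at k1
  linarith

end BiquardCurvature
end Frame
end ThreeContactSpace
end SasakiGeom
end

/-! ### The contribution of the contorsion to the Ricci tensor. -/

noncomputable section
namespace SasakiGeom
namespace ThreeContactSpace

variable {V : Type*} [AddCommGroup V] [Module ℝ V] (m : ThreeContactSpace V) (α δ : ℝ)

theorem N_add_one_ξ (i : Fin 3) : m.N (i + 1) (m.ξ i) = -m.ξ (i + 2) := by
  simp only [N_add_one_apply, m.η_ξ_simps i]; module

theorem N_add_two_ξ (i : Fin 3) : m.N (i + 2) (m.ξ i) = m.ξ (i + 1) := by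
  simp only [N_add_two_apply, m.η_ξ_simps i]; module

theorem contorsion_ξ_left (i : Fin 3) (v : V) :
    m.contorsion α δ (m.ξ i) v = α • m.φH i v + δ • m.N i v := by
  rw [contorsion_apply, sum_fin_three _ i]
  simp only [θ_apply, φH_ξ, N_ξ_self, N_add_one_ξ, N_add_two_ξ, m.η_ξ_simps i, smul_zero, smul_neg,
    map_add, map_neg, map_smul, map_zero, LinearMap.add_apply, LinearMap.neg_apply,
    LinearMap.smul_apply, LinearMap.zero_apply, g_ξ_left, smul_eq_mul, N_apply m i v]
  module

theorem T_ξ_left (i : Fin 3) (v : V) : m.T α δ (m.ξ i) v = (2 * δ) • m.N i v := by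
  rw [T, sum_fin_three _ i]
  simp only [θ_apply, φH_ξ, N_ξ_self, N_add_one_ξ, N_add_two_ξ, smul_zero, smul_neg,
    map_add, map_neg, map_smul, map_zero, LinearMap.add_apply, LinearMap.neg_apply,
    LinearMap.smul_apply, LinearMap.zero_apply, g_ξ_left, smul_eq_mul, N_apply m i v]
  module

theorem contorsion_ξ_right (i : Fin 3) (v : V) :
    m.contorsion α δ v (m.ξ i) = α • m.φH i v - δ • m.N i v := by
  have h := m.contorsion_sub α δ (m.ξ i) v
  rw [contorsion_ξ_left, T_ξ_left] at h
  linear_combination (norm := module) (-1 : ℝ) • h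

variable {m}

theorem IsHorizontal.θ_eq {v : V} (hv : m.IsHorizontal v) (i : Fin 3) :
    m.θ α δ i v = (-(2 * α)) • m.φ i v := by
  rw [θ_apply, hv.φH_eq, hv.N_eq_zero, smul_zero, add_zero]

theorem IsHorizontal.T_eq {v : V} (hv : m.IsHorizontal v) (w : V) :
    m.T α δ v w = (-(2 * α)) • ∑ l, m.g (m.φ l v) w • m.ξ l := by
  simp only [T, hv.θ_eq, map_smul, LinearMap.smul_apply, smul_eq_mul, Finset.smul_sum, smul_smul]

theorem IsHorizontal.contorsion_left {v : V} (hv : m.IsHorizontal v) (w : V) :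
    m.contorsion α δ v w = (-α) • ∑ l, (m.g (m.φ l v) w • m.ξ l - m.η l w • m.φ l v) := by
  rw [contorsion_apply, Finset.smul_sum, Finset.smul_sum]
  refine Finset.sum_congr rfl fun l _ ↦ ?_
  rw [hv.θ_eq, hv]
  simp only [map_smul, LinearMap.smul_apply, smul_eq_mul]
  module

theorem IsHorizontal.contorsion_right {w : V} (hw : m.IsHorizontal w) (v : V) :
    m.contorsion α δ v w = (-α) • ∑ l, (m.g (m.φH l v) w • m.ξ l - m.η l v • m.φ l w) := by
  rw [contorsion_apply, Finset.smul_sum, Finset.smul_sum]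
  refine Finset.sum_congr rfl fun l _ ↦ ?_
  rw [hw.θ_eq, hw, θ_apply, map_add, LinearMap.add_apply, map_smul, map_smul, LinearMap.smul_apply,
    LinearMap.smul_apply, N_skew, hw.N_eq_zero]
  simp only [map_zero, smul_eq_mul]
  module

theorem IsHorizontal.contorsion_self {v : V} (hv : m.IsHorizontal v) :
    m.contorsion α δ v v = 0 := by
  rw [hv.contorsion_left]
  have : ∀ l, m.g (m.φ l v) v = 0 := fun l ↦ by
    have := m.φ_skew l v v
    rw [m.symm v] at this
    linarith
  simp [this, hv _]

theorem contorsion_ξ_self (i : Fin 3) : m.contorsion α δ (m.ξ i) (m.ξ i) = 0 := by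
  rw [contorsion_ξ_left, φH_ξ, N_ξ_self]; simp

theorem IsHorizontal.g_φ_φ_of_ne {v : V} (hv : m.IsHorizontal v) {i j : Fin 3} (h : i ≠ j) :
    m.g (m.φ i v) (m.φ j v) = 0 := by
  have s : ∀ l, m.g (m.φ l v) v = 0 := fun l ↦ by
    have := m.φ_skew l v v
    rw [m.symm v] at this
    linarith
  rw [← neg_eq_iff_eq_neg.2 (m.φ_skew j (m.φ i v) v)]
  rcases fin_three_cases i j with rfl | rfl | rfl
  · exact absurd rfl h
  · rw [(hv.φ_φ i).2.2.2.1, map_neg, LinearMap.neg_apply, s]; simp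
  · rw [(hv.φ_φ i).2.2.2.2.2.2.1, s]; simp

variable (m) in
/-- The contribution of the contorsion to the curvature. -/
def contorsionCurvature (u v w : V) : V :=
  m.contorsion α δ u (m.contorsion α δ v w) - m.contorsion α δ v (m.contorsion α δ u w)
    - m.contorsion α δ (m.T α δ u v) w

/-- Skewness moves the outer contorsion of each term onto `u`; one of the three terms then contains
`A(u, u)`, which vanishes for `u` horizontal or `u = ξ_i`. -/
theorem g_contorsionCurvature {u : V} (hu : m.contorsion α δ u u = 0) (v w : V) :
    m.g (m.contorsionCurvature α δ u v w) u =
      m.g (m.contorsion α δ u w) (m.contorsion α δ v u)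
        + m.g w (m.contorsion α δ (m.T α δ u v) u) := by
  simp only [contorsionCurvature, map_sub, LinearMap.sub_apply, contorsion_skew _ _ _ _ _ u, hu,
    map_zero]
  ring

theorem IsHorizontal.g_contorsionCurvature {u : V} (hu : m.IsHorizontal u) (v w : V) :
    m.g (m.contorsionCurvature α δ u v w) u =
      -α ^ 2 * ∑ l, m.g (m.φH l v) u * m.g u (m.φH l w)
        + α ^ 2 * (∑ l, m.η l v * m.η l w) * m.g u u
        - 2 * α ^ 2 * ∑ l, m.g (m.φH l v) u * m.g u (m.φH l w) := by
  have e0 : ∀ l v, m.g (m.φ l u) v = -m.g u (m.φH l v) := fun l v ↦ by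
    rw [← hu.φH_eq, φH_skew]
  have e1 : m.g (m.contorsion α δ u w) (m.contorsion α δ v u) =
      -α ^ 2 * ∑ l, m.g (m.φH l v) u * m.g u (m.φH l w)
        + α ^ 2 * (∑ l, m.η l v * m.η l w) * m.g u u := by
    -- For horizontal `u` the vectors `φ_l u` are orthogonal and as long as `u`, so only the
    -- diagonal terms `η_l(v) η_l(w)` survive.
    have p1 : ∀ l l', m.g (m.φ l u) (m.φ l' u) = if l = l' then m.g u u else 0 := fun l l' ↦ by
      split_ifs with h
      · rw [h, hu.g_φ_φ]
      · exact hu.g_φ_φ_of_ne h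
    rw [hu.contorsion_left, hu.contorsion_right]
    simp only [map_smul, map_sum, map_sub, LinearMap.smul_apply, LinearMap.sum_apply,
      LinearMap.sub_apply, g_ξ, smul_eq_mul, (hu.φ _) _, m.η_ξ, g_ξ_left, p1, e0]
    simp only [Fin.sum_univ_three]
    simp [φH_ξ]
    ring
  have e2 : m.g w (m.contorsion α δ (m.T α δ u v) u) =
      -2 * α ^ 2 * ∑ l, m.g (m.φH l v) u * m.g u (m.φH l w) := by
    rw [hu.T_eq]
    simp only [map_smul, map_sum, LinearMap.smul_apply, LinearMap.sum_apply, contorsion_ξ_left,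
      hu.N_eq_zero, hu.φH_eq, smul_zero, add_zero, smul_eq_mul, Finset.mul_sum]
    refine Finset.sum_congr rfl fun l _ ↦ ?_
    rw [e0, m.symm w, e0, m.symm u (m.φH l v)]
    ring
  rw [ThreeContactSpace.g_contorsionCurvature α δ (hu.contorsion_self α δ), e1, e2]
  ring

theorem η_contorsionCurvature_ξ (i : Fin 3) (v w : V) :
    m.η i (m.contorsionCurvature α δ (m.ξ i) v w) =
      α ^ 2 * m.g (m.hor v) (m.hor w) + δ ^ 2 * m.g (m.N i v) (m.N i w) := by
  have hN : ∀ a b, m.g (m.φH i a) (m.N i b) = 0 := fun a b ↦ by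
    simp [N_apply, g_ξ, η_φH]
  have hN2 : m.contorsion α δ (m.N i v) (m.ξ i) = -δ • m.N i (m.N i v) := by
    rw [contorsion_ξ_right]
    have : m.φH i (m.N i v) = 0 := by simp [N_apply, φH_ξ]
    rw [this]
    module
  rw [← g_ξ, g_contorsionCurvature α δ (m.contorsion_ξ_self α δ i), T_ξ_left, map_smul,
    LinearMap.smul_apply, hN2, contorsion_ξ_left, contorsion_ξ_right]
  have h1 : m.g w (m.N i (m.N i v)) = -m.g (m.N i v) (m.N i w) := by
    rw [← neg_eq_iff_eq_neg.2 (m.N_skew i w _), m.symm]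
  have h2 : m.g (m.N i w) (m.φH i v) = 0 := by rw [m.symm, hN]
  simp only [map_add, map_sub, map_smul, LinearMap.add_apply, LinearMap.smul_apply, smul_eq_mul, hN,
    h1, h2, g_φH_φH]
  rw [m.symm (m.hor w), m.symm (m.N i w)]
  ring

theorem sum_g_N_N (v w : V) :
    ∑ i, m.g (m.N i v) (m.N i w) = 2 * ∑ i, m.η i v * m.η i w := by
  simp only [sum_fin_three _ 0, N_apply, fin_three_add 0, map_sub, map_smul, LinearMap.sub_apply,
    LinearMap.smul_apply, g_ξ, m.η_ξ_simps 0, smul_eq_mul]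
  ring

section Frame

variable {ι : Type*} [Fintype ι] [DecidableEq ι] {e : ι → V}

theorem HorizontalFrame.trace_eq [Module.Finite ℝ V] (he : m.HorizontalFrame e) (L : V →ₗ[ℝ] V) :
    LinearMap.trace ℝ V L = ∑ a, m.g (L (e a)) (e a) + ∑ l, m.η l (L (m.ξ l)) := by
  -- `L` as a sum of rank-one maps along the frame `(e_a, ξ_l)`, whose traces are immediate.
  have : L = ∑ a, (m.g (e a) ∘ₗ (LinearMap.id - ∑ l, (m.η l).smulRight (m.ξ l))).smulRight (L (e a))
      + ∑ l, (m.η l).smulRight (L (m.ξ l)) := by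
    ext v
    have h1 := congrArg L (m.hor_add_sum v)
    rw [← he.sum_smul _ (m.isHorizontal_hor v)] at h1
    rw [← h1]
    simp [hor, m.symm]
  conv_lhs => rw [this]
  rw [map_add, map_sum, map_sum]
  simp only [LinearMap.trace_smulRight]
  congr 1
  refine Finset.sum_congr rfl fun a _ ↦ ?_
  change m.g (e a) (L (e a) - (∑ l, (m.η l).smulRight (m.ξ l)) (L (e a))) = _
  rw [map_sub, m.symm]
  have : m.g (e a) ((∑ l, (m.η l).smulRight (m.ξ l)) (L (e a))) = 0 := by
    simp [g_ξ, he.horizontal a _]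
  rw [this, sub_zero]

theorem HorizontalFrame.trace_contorsionCurvature (he : m.HorizontalFrame e) (v w : V) :
    ∑ a, m.g (m.contorsionCurvature α δ (e a) v w) (e a)
      + ∑ l, m.η l (m.contorsionCurvature α δ (m.ξ l) v w) =
      -6 * α ^ 2 * m.g (m.hor v) (m.hor w)
        + (Fintype.card ι * α ^ 2 + 2 * δ ^ 2) * ∑ i, m.η i v * m.η i w := by
  have h1 : ∑ a, ∑ l, m.g (m.φH l v) (e a) * m.g (e a) (m.φH l w) =
      3 * m.g (m.hor v) (m.hor w) := by
    rw [Finset.sum_comm]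
    simp [he.sum_mul (isHorizontal_φH _ v), g_φH_φH]
  -- The coefficient `-6α²` is `-9α²` from the frame, namely `-α² - 2α²` for each of three indices,
  -- plus `α²` from each of the three `ξ_l`.
  simp only [(he.horizontal _).g_contorsionCurvature, η_contorsionCurvature_ξ, Finset.sum_add_distrib,
    Finset.sum_sub_distrib, ← Finset.mul_sum, h1, he.norm, sum_g_N_N]
  simp
  ring

/-- Vertical components of `v` and `w` do not contribute: `R u v ξ_l` is vertical, and `mixed`
removes a vertical `v`. The terms with a vertical first argument vanish because `φH` kills the
`ξ_l`. -/
theorem BiquardCurvature.trace_eq {c : ℝ} {R : V →ₗ[ℝ] V →ₗ[ℝ] Module.End ℝ V}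
    (hR : m.BiquardCurvature c R) (he : m.HorizontalFrame e) (v w : V) :
    ∑ a, m.g (R (e a) v w) (e a) + ∑ l, m.η l (R (m.ξ l) v w) =
      (Fintype.card ι / 4 + 2) * c * m.g (m.hor v) (m.hor w) := by
  have h1 : ∀ l, m.η l (R (m.ξ l) v w) = 0 := fun l ↦ by
    rw [← g_ξ, hR.skew, hR.apply_ξ]
    simp [g_ξ_left, η_φH]
  have h2 : ∀ a, m.g (R (e a) v w) (e a) = m.g (R (e a) (m.hor v) (m.hor w)) (e a) := fun a ↦ by
    conv_lhs => rw [← m.hor_add_sum w]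
    have e1 : ∀ l, m.g (R (e a) v (m.ξ l)) (e a) = 0 := fun l ↦ by
      rw [hR.apply_ξ]
      simp [g_ξ_left, he.horizontal a _]
    simp only [map_add, map_sum, map_smul, LinearMap.add_apply, LinearMap.sum_apply,
      LinearMap.smul_apply, e1, smul_zero, Finset.sum_const_zero, add_zero]
    conv_lhs => rw [← m.hor_add_sum v]
    have e2 : ∀ l, m.g (R (e a) (m.ξ l) (m.hor w)) (e a) = 0 := fun l ↦ by
      rw [hR.swap, map_neg, LinearMap.neg_apply,
        hR.mixed l (he.horizontal a) (m.isHorizontal_hor w) (he.horizontal a), neg_zero]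
    simp [e2]
  simp only [h1, h2, Finset.sum_const_zero, add_zero]
  exact hR.ricciH_eq he (m.isHorizontal_hor v) (m.isHorizontal_hor w)

end Frame
end ThreeContactSpace
end SasakiGeom
end

/-! ### Horizontal frames, the Ricci tensor of `g`, and the Einstein condition. -/

noncomputable section
namespace SasakiGeom

set_option linter.unusedSectionVars false

namespace ThreeContactSpace

variable {V : Type*} [AddCommGroup V] [Module ℝ V] (m : ThreeContactSpace V)

/-- The horizontal subspace. -/
def H : Submodule ℝ V := ⨅ i, LinearMap.ker (m.η i)

theorem mem_H {v : V} : v ∈ m.H ↔ m.IsHorizontal v := by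
  simp [H, IsHorizontal]

theorem finrank_H [Module.Finite ℝ V] : Module.finrank ℝ m.H + 3 = Module.finrank ℝ V := by
  let f : V →ₗ[ℝ] (Fin 3 → ℝ) := LinearMap.pi m.η
  have hf : LinearMap.range f = ⊤ := by
    refine LinearMap.range_eq_top.2 fun c ↦ ⟨∑ i, c i • m.ξ i, ?_⟩
    ext j
    simp [f, m.η_ξ]
  have hk : LinearMap.ker f = m.H := by
    ext v
    rw [m.mem_H, LinearMap.mem_ker]
    exact funext_iff
  have := LinearMap.finrank_range_add_finrank_ker f
  rw [hf, hk, finrank_top, Module.finrank_fin_fun] at this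
  omega

variable {m}

/-- Orthonormality gives independence and the count then gives spanning; `IsOrthonormalFrame`
assumes only orthonormality of `4n` vectors. -/
theorem HorizontalFrame.of_orthonormal [Module.Finite ℝ V] {ι : Type*} [Fintype ι] [DecidableEq ι]
    {e : ι → V} (hH : ∀ a, m.IsHorizontal (e a))
    (he : ∀ a b, m.g (e a) (e b) = if a = b then 1 else 0)
    (hc : Fintype.card ι = Module.finrank ℝ m.H) : m.HorizontalFrame e where
  horizontal := hH
  orthonormal := he
  sum_smul v hv := by
    let e' : ι → m.H := fun a ↦ ⟨e a, m.mem_H.2 (hH a)⟩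
    have hg : ∀ (c : ι → ℝ) b, m.g (∑ a, c a • e a) (e b) = c b := fun c b ↦ by simp [he]
    have hli : LinearIndependent ℝ e' := by
      rw [Fintype.linearIndependent_iff]
      intro c h b
      have h1 := congrArg (fun w : m.H ↦ (w : V)) h
      simp only [Submodule.coe_sum, Submodule.coe_smul, Submodule.coe_zero, e'] at h1
      rw [← hg c b, h1]
      simp
    have hsp := hli.span_eq_top_of_card_eq_finrank' hc
    have hv' : (⟨v, m.mem_H.2 hv⟩ : m.H) ∈ Submodule.span ℝ (Set.range e') := hsp ▸ Submodule.mem_top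
    obtain ⟨c, h⟩ := (Submodule.mem_span_range_iff_exists_fun ℝ).1 hv'
    have h1 : ∑ a, c a • e a = v := by
      have h1 := congrArg (fun w : m.H ↦ (w : V)) h
      simpa only [Submodule.coe_sum, Submodule.coe_smul, e'] using h1
    rw [← h1]
    simp only [hg]

variable (m) in
theorem exists_horizontalFrame [Module.Finite ℝ V] :
    ∃ e : Fin (Module.finrank ℝ m.H) → V, m.HorizontalFrame e := by
  let B : LinearMap.BilinForm ℝ m.H := m.g.domRestrict₁₂ m.H m.H
  have hB : LinearMap.IsSymm B := ⟨fun v w ↦ m.symm v w⟩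
  have : Invertible (2 : ℝ) := invertibleOfNonzero two_ne_zero
  obtain ⟨b, hb⟩ := LinearMap.BilinForm.exists_orthogonal_basis hB
  have hpos : ∀ a, 0 < m.g (b a) (b a) := fun a ↦
    m.pos _ fun h ↦ b.ne_zero a (Subtype.ext h)
  refine ⟨fun a ↦ (Real.sqrt (m.g (b a) (b a)))⁻¹ • (b a : V), .of_orthonormal
    (fun a i ↦ ?_) (fun a a' ↦ ?_) (Fintype.card_fin _)⟩
  · rw [map_smul, m.mem_H.1 (b a).2, smul_zero]
  · simp only [map_smul, LinearMap.smul_apply, smul_eq_mul]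
    split_ifs with h
    · rw [← h]
      have h1 := Real.mul_self_sqrt (hpos a).le
      have h2 := (Real.sqrt_pos.2 (hpos a)).ne'
      field_simp
      rw [pow_two, h1]
    · have : m.g (b a) (b a') = 0 := hb h
      rw [this, mul_zero, mul_zero]

end ThreeContactSpace

variable {n : ℕ} {M : Type*} [TopologicalSpace M]
  [ChartedSpace (EuclideanSpace ℝ (Fin (4 * n + 3))) M] [IsManifold (𝓡 (4 * n + 3)) ∞ M] [T2Space M]

instance finite_tangentSpace (x : M) : Module.Finite ℝ (Tan n x) :=
  inferInstanceAs (Module.Finite ℝ (EuclideanSpace ℝ (Fin (4 * n + 3))))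

theorem finrank_tangentSpace (x : M) : Module.finrank ℝ (Tan n x) = 4 * n + 3 :=
  finrank_euclideanSpace_fin (n := 4 * n + 3)

namespace AlmostThreeContactMetric

variable {𝒮 : AlmostThreeContactMetric n M} {α δ : ℝ}

theorem finrank_model_H (x : M) : Module.finrank ℝ (𝒮.model x).H = 4 * n := by
  have := (𝒮.model x).finrank_H
  rw [finrank_tangentSpace] at this
  omega

variable (𝒮) in
theorem exists_horizontalFrame (x : M) :
    ∃ e : Fin (4 * n) → Tan n x, (𝒮.model x).HorizontalFrame e := by
  have := (𝒮.model x).exists_horizontalFrame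
  rwa [finrank_model_H] at this

theorem IsThreeSasaki.biquardCurvature (h : 𝒮.IsThreeSasaki α δ) (x : M) :
    (𝒮.model x).BiquardCurvature (4 * α * δ)
      (curvatureMap (𝒮.isSmoothMetric_biquard α δ) x) where
  swap u v w := curvature_swap u v w _
  skew u v w z := curvature_skew u v w z (𝒮.isSmoothMetric_biquard α δ)
  comm i u v w := h.curvature_φ i u v w
  bianchi u v w hv hw z hz := by
    have h1 := congrArg (fun a ↦ (𝒮.model x).g a z) (h.curvature_bianchi u v w)
    -- The torsion is vertical, so the right-hand side of the Bianchi identity is invisible to a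
    -- horizontal `z`.
    have h2 : ∀ a b, (𝒮.model x).g ((𝒮.model x).T α δ a b) z = 0 := fun a b ↦ by
      simp [ThreeContactSpace.T, ThreeContactSpace.g_ξ_left, hz _]
    simp only [map_add, LinearMap.add_apply, h2, add_zero] at h1
    exact h1

theorem ricci_eq_trace (g : ContMDiffRiemannianMetric (𝓡 (4 * n + 3)) ∞
      (EuclideanSpace ℝ (Fin (4 * n + 3))) (fun x : M ↦ TangentSpace (𝓡 (4 * n + 3)) x))
    (x : M) (v w : Tan n x) :
    ricci g x v w = LinearMap.trace ℝ (Tan n x)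
      (((curvatureMap (isSmoothMetric_leviCivita (g := g)) x).flip v).flip w) := by
  rw [LinearMap.trace_eq_matrix_trace ℝ (Module.finBasis ℝ (Tan n x)), Matrix.trace]
  simp only [Matrix.diag_apply, LinearMap.toMatrix_apply]
  rfl

/-- The Ricci tensor of a 3-(α,δ)-Sasaki manifold. -/
theorem IsThreeSasaki.ricci_eq (h : 𝒮.IsThreeSasaki α δ) (x : M) (v w : Tan n x) :
    ricci 𝒮.g x v w = 2 * α * (2 * δ * (n + 2) - 3 * α) * 𝒮.g.inner x v w +
      2 * (α - δ) * ((2 * n + 3) * α - δ) * ∑ i, 𝒮.η i x v * 𝒮.η i x w := by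
  obtain ⟨e, he⟩ := 𝒮.exists_horizontalFrame x
  rw [ricci_eq_trace, he.trace_eq]
  have h1 : ∀ u, ((curvatureMap (isSmoothMetric_leviCivita (g := 𝒮.g)) x).flip v).flip w u =
      curvatureMap (𝒮.isSmoothMetric_biquard α δ) x u v w
        + (𝒮.model x).contorsionCurvature α δ u v w := fun u ↦ by
    change curvature (leviCivita 𝒮.g) x u v w = _
    rw [h.curvature_leviCivita, ThreeContactSpace.contorsionCurvature, curvatureMap_apply]
    abel
  simp only [h1, map_add, LinearMap.add_apply, Finset.sum_add_distrib]
  have h2 := (h.biquardCurvature x).trace_eq he v w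
  have h3 := he.trace_contorsionCurvature α δ v w
  -- The horizontal eigenvalue is `4αδ(n+2) - 6α²` and the vertical one `4nα² + 2δ²`. Their
  -- difference, `2(α-δ)((2n+3)α-δ)`, is the coefficient of `Σ η_i ⊗ η_i`.
  rw [ThreeContactSpace.g_hor] at h2 h3
  simp only [Fintype.card_fin] at h2 h3
  push_cast at h2 h3
  simp only [← model_g, ← model_η]
  linear_combination h2 + h3

theorem IsThreeSasaki.isEinstein_iff [Nonempty M] (hn : 1 ≤ n) (h : 𝒮.IsThreeSasaki α δ) :
    IsEinstein 𝒮.g ↔ δ = α ∨ δ = (2 * n + 3) * α := by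
  constructor
  · rintro ⟨c, hc⟩
    obtain ⟨x⟩ := ‹Nonempty M›
    obtain ⟨e, he⟩ := 𝒮.exists_horizontalFrame x
    -- A unit horizontal vector, available because `n ≥ 1`; comparison with `ξ_0` makes the
    -- coefficient of `Σ η_i ⊗ η_i` vanish.
    have h1 := hc x (e ⟨0, by omega⟩) (e ⟨0, by omega⟩)
    have h2 := hc x (𝒮.ξ 0 x) (𝒮.ξ 0 x)
    rw [h.ricci_eq] at h1 h2
    simp only [← model_g, ← model_η, ← model_ξ, he.norm, he.horizontal _ _,
      ThreeContactSpace.g_ξ, ThreeContactSpace.η_ξ] at h1 h2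
    simp at h1 h2
    have h3 : 2 * ((α - δ) * ((2 * n + 3) * α - δ)) = 0 := by linarith
    rcases mul_eq_zero.1 ((mul_eq_zero.1 h3).resolve_left two_ne_zero) with h4 | h4
    · left; linarith
    · right; linarith
  · intro hδ
    refine ⟨2 * α * (2 * δ * (n + 2) - 3 * α), fun x v w ↦ ?_⟩
    rw [h.ricci_eq]
    have : (α - δ) * ((2 * n + 3) * α - δ) = 0 := by
      rcases hδ with rfl | rfl <;> ring
    linear_combination (2 * ∑ i, 𝒮.η i x v * 𝒮.η i x w) * this

end AlmostThreeContactMetric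
end SasakiGeom
end

/-! ### The quaternionic contact structure: contact forms, Reeb fields and the structure equation.
-/

noncomputable section
namespace SasakiGeom

set_option linter.unusedSectionVars false

variable {n : ℕ} {M : Type*} [TopologicalSpace M]
  [ChartedSpace (EuclideanSpace ℝ (Fin (4 * n + 3))) M] [IsManifold (𝓡 (4 * n + 3)) ∞ M] [T2Space M]

theorem extDerivOneForm_const_smul {η : Π x : M, Tan n x →L[ℝ] ℝ} (hη : SmoothOneFormOn η Set.univ)
    (c : ℝ) {x : M} (v w : Tan n x) :
    extDerivOneForm (fun y ↦ c • η y) x v w = c * extDerivOneForm η x v w := by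
  obtain ⟨X, hX, rfl⟩ := exists_smoothField_eq v
  obtain ⟨Y, hY, rfl⟩ := exists_smoothField_eq w
  have hc : SmoothOneFormOn (fun y ↦ c • η y) Set.univ := ContMDiffOn.const_smul_section hη
  have e : ∀ {X : Π x : M, Tan n x}, SmoothField X → ∀ u : Tan n x,
      mvfderiv (𝓡 (4 * n + 3)) (fun y ↦ (c • η y) (X y)) x u =
        c * mvfderiv (𝓡 (4 * n + 3)) (fun y ↦ η y (X y)) x u := by
    intro X hX u
    have := mvfderiv_fun_mul (mdifferentiableAt_const (c := c))
      (mdifferentiableAt_oneForm_apply hη Filter.univ_mem (hX.diffAt x))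
    simpa [mvfderiv_const] using congrArg (fun A : Tan n x →L[ℝ] ℝ ↦ A u) this
  rw [extDerivOneForm_apply hc Filter.univ_mem (hX.diffAt x) (hY.diffAt x),
    extDerivOneForm_apply hη Filter.univ_mem (hX.diffAt x) (hY.diffAt x), e hX, e hY, smul_apply,
    smul_eq_mul]
  ring

namespace AlmostThreeContactMetric

variable {𝒮 : AlmostThreeContactMetric n M} {α δ : ℝ} {x : M}

theorem mem_horizontal_iff {v : Tan n x} :
    v ∈ 𝒮.horizontal x ↔ (𝒮.model x).IsHorizontal v := 𝒮.mem_horizontal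

namespace IsThreeSasaki

theorem extDerivOneForm_smul_eq (h : 𝒮.IsThreeSasaki α δ) (i : Fin 3) (v w : Tan n x) :
    extDerivOneForm (fun y ↦ (-(1 / α)) • 𝒮.η i y) x v w =
      -(1 / α) * (𝒮.model x).g v ((𝒮.model x).Ω α δ i w) := by
  rw [extDerivOneForm_const_smul (𝒮.smooth_η i), h.extDerivOneForm_eq]

theorem isFrameOn (h : 𝒮.IsThreeSasaki α δ) :
    𝒮.qcData.IsFrameOn Set.univ (fun i x ↦ (-(1 / α)) • 𝒮.η i x) 𝒮.horizontalEnd where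
  isOpen := isOpen_univ
  smooth_η i := ContMDiffOn.const_smul_section (𝒮.smooth_η i)
  linearIndependent x _ := by
    rw [Fintype.linearIndependent_iff]
    intro c hc j
    have h1 := congrArg (fun A : Tan n x →L[ℝ] ℝ ↦ A (𝒮.ξ j x)) hc
    simp only [← model_ξ, sum_apply, smul_apply, ← model_η, (𝒮.model x).η_ξ] at h1
    simpa [h.1] using h1
  mem_H_iff x _ v := by
    refine (𝒮.mem_horizontal (x := x) (v := v)).trans (forall_congr' fun i ↦ ?_)
    simp [h.1]
  smooth_J i x _ X hX :=
    ContMDiffAt.clm_bundle_apply (F₁ := EuclideanSpace ℝ (Fin (4 * n + 3)))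
      (F₂ := EuclideanSpace ℝ (Fin (4 * n + 3))) (𝒮.smooth_φ i x) hX
  span_J _ _ := rfl
  J_sq i x _ := by
    ext v
    exact ((mem_horizontal_iff.1 v.2).φ_φ i).1
  J_mul x _ := by
    ext v
    exact ((mem_horizontal_iff.1 v.2).φ_φ 0).2.1
  metric_J i x _ v w := (mem_horizontal_iff.1 v.2).g_φ_φ i
  contact i x _ v w := by
    have hv := mem_horizontal_iff.1 v.2
    have hw := mem_horizontal_iff.1 w.2
    -- On horizontal vectors `Ω_i` is `2α φ_i`. The factor `-1/α` removes `α`, and its sign is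
    -- absorbed by moving `φ_i` to the first argument.
    rw [h.extDerivOneForm_smul_eq, ThreeContactSpace.Ω_apply, hw.N_eq_zero, hw.φH_eq, smul_zero,
      add_zero, map_smul, ← neg_eq_iff_eq_neg.2 ((𝒮.model x).φ_skew i v w)]
    have hα := h.1
    change 2 * (𝒮.model x).g ((𝒮.model x).φ i v) w = _
    simp only [smul_eq_mul]
    field_simp

theorem isQuaternionicContact (h : 𝒮.IsThreeSasaki α δ) : 𝒮.qcData.IsQuaternionicContact where
  metric_symm x v w := 𝒮.g.symm x v w
  metric_pos x v hv := 𝒮.g.pos x v fun h0 ↦ hv (Subtype.ext h0)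
  metric_smooth _ _ _ hX hY := contMDiffAt_metric 𝒮.g hX hY
  exists_frame _ := ⟨Set.univ, trivial, _, _, h.isFrameOn⟩

theorem isReebOn (h : 𝒮.IsThreeSasaki α δ) :
    𝒮.qcData.IsReebOn Set.univ (fun i x ↦ (-(1 / α)) • 𝒮.η i x) (fun i x ↦ (-α) • 𝒮.ξ i x) := by
  -- Since `Ω_i` preserves the horizontal space, every contraction `ξ_j ⌟ dη_i` vanishes on it,
  -- which is stronger than both Reeb conditions.
  have hd : ∀ (i j : Fin 3) (x : M) (v : 𝒮.horizontal x),
      extDerivOneForm (fun x ↦ (-(1 / α)) • 𝒮.η i x) x ((-α) • 𝒮.ξ j x) (v : Tan n x) = 0 := by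
    intro i j x v
    have hv := mem_horizontal_iff.1 v.2
    rw [h.extDerivOneForm_smul_eq, map_smul, LinearMap.smul_apply, ← model_ξ,
      ThreeContactSpace.g_ξ_left, ThreeContactSpace.Ω_apply, hv.N_eq_zero, hv.φH_eq, smul_zero,
      add_zero, map_smul, hv.φ i j]
    simp
  refine ⟨fun i x _ ↦ (𝒮.smoothField_ξ i).const_smul' (-α) x, fun x _ i j ↦ ?_,
    fun x _ i v ↦ hd i i x v, fun x _ i j v ↦ ?_⟩
  · have := (𝒮.model x).η_ξ i j
    rw [smul_apply, map_smul, ← model_ξ, ← model_η, this]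
    have hα := h.1
    split_ifs <;> simp [hα]
  · exact (hd j i x v).trans ((neg_eq_zero.2 (hd i j x v)).symm)

/-- In `Ω_i = 2α φH_i + 2δ N_i` the first summand sees only horizontal parts and gives `2ω_i`. The
second is a multiple of `η_{i+1} ∧ η_{i+2}`, which becomes `2αδ` after rescaling both forms. -/
theorem structure_equation (h : 𝒮.IsThreeSasaki α δ) (i : Fin 3) (x : M) (v w : Tan n x) :
    extDerivOneForm (fun y ↦ (-(1 / α)) • 𝒮.η i y) x v w =
      2 * qcFundamentalForm (fun j y ↦ (-(1 / α)) • 𝒮.η j y) (fun j y ↦ (-α) • 𝒮.ξ j y) i x v w +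
      2 * α * δ * ((-(1 / α) * 𝒮.η (i + 1) x v) * (-(1 / α) * 𝒮.η (i + 2) x w)
        - (-(1 / α) * 𝒮.η (i + 1) x w) * (-(1 / α) * 𝒮.η (i + 2) x v)) := by
  have hα := h.1
  have e : ∀ v : Tan n x, v - ∑ j, ((-(1 / α)) • 𝒮.η j x) v • (-α) • 𝒮.ξ j x = (𝒮.model x).hor v := by
    intro v
    rw [ThreeContactSpace.hor]
    congr 1
    refine Finset.sum_congr rfl fun j _ ↦ ?_
    rw [smul_smul, smul_apply, smul_eq_mul, ← model_η, ← model_ξ]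
    congr 1
    field_simp
  have hv := (𝒮.model x).isHorizontal_hor v
  have hw := (𝒮.model x).isHorizontal_hor w
  rw [qcFundamentalForm, e, e, h.extDerivOneForm_smul_eq, h.extDerivOneForm_smul_eq,
    ThreeContactSpace.Ω_apply, ThreeContactSpace.Ω_apply, ThreeContactSpace.φH_hor, hw.N_eq_zero,
    ThreeContactSpace.N_apply]
  have e2 : (𝒮.model x).g ((𝒮.model x).hor v) ((𝒮.model x).φH i w) =
      (𝒮.model x).g v ((𝒮.model x).φH i w) := by
    rw [← neg_eq_iff_eq_neg.2 ((𝒮.model x).φH_skew i _ w), ThreeContactSpace.φH_hor,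
      ThreeContactSpace.φH_skew, neg_neg]
  simp only [map_add, map_sub, map_smul, smul_zero, add_zero, smul_eq_mul, e2,
    ThreeContactSpace.g_ξ, model_η]
  field_simp
  ring

end IsThreeSasaki
end AlmostThreeContactMetric
end SasakiGeom
end

/-! ### Verification of the Biquard axioms and the qc-Einstein condition. -/

noncomputable section
namespace SasakiGeom

set_option linter.unusedSectionVars false

variable {n : ℕ} {M : Type*} [TopologicalSpace M]
  [ChartedSpace (EuclideanSpace ℝ (Fin (4 * n + 3))) M] [IsManifold (𝓡 (4 * n + 3)) ∞ M] [T2Space M]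

theorem QCData.hProj_of_mem {𝒬 : QCData n M} {V : Π x : M, Submodule ℝ (Tan n x)} {x : M}
    (hV : IsCompl (𝒬.H x) (V x)) {v : Tan n x} (hv : v ∈ 𝒬.H x) : 𝒬.hProj V x v = ⟨v, hv⟩ := by
  rw [QCData.hProj, dif_pos hV]
  exact Submodule.projectionOnto_apply_of_mem_left hV hv

theorem QCData.hProj_of_mem_compl {𝒬 : QCData n M} {V : Π x : M, Submodule ℝ (Tan n x)} {x : M}
    (hV : IsCompl (𝒬.H x) (V x)) {v : Tan n x} (hv : v ∈ V x) : 𝒬.hProj V x v = 0 := by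
  rw [QCData.hProj, dif_pos hV]
  exact (Submodule.projectionOnto_apply_eq_zero_iff hV).2 hv

namespace AlmostThreeContactMetric

/-- The span of the Reeb vector fields. -/
def vertical (𝒮 : AlmostThreeContactMetric n M) (α : ℝ) (x : M) : Submodule ℝ (Tan n x) :=
  Submodule.span ℝ (Set.range fun i ↦ (-α) • 𝒮.ξ i x)

variable {𝒮 : AlmostThreeContactMetric n M} {α δ : ℝ} {x : M}

theorem mem_vertical_iff (hα : α ≠ 0) {v : Tan n x} :
    v ∈ 𝒮.vertical α x ↔ (𝒮.model x).hor v = 0 := by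
  constructor
  · intro hv
    obtain ⟨c, rfl⟩ := (Submodule.mem_span_range_iff_exists_fun ℝ).1 hv
    rw [ThreeContactSpace.hor, sub_eq_zero]
    refine Finset.sum_congr rfl fun j _ ↦ ?_
    rw [smul_smul, ← model_ξ]
    congr 1
    simp [← model_ξ, (𝒮.model x).η_ξ]
  · intro hv
    have h1 := (𝒮.model x).hor_add_sum v
    rw [hv, zero_add] at h1
    rw [← h1]
    refine Submodule.sum_mem _ fun i _ ↦ ?_
    have : (𝒮.model x).ξ i = (-α)⁻¹ • ((-α) • 𝒮.ξ i x) := by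
      rw [smul_smul, inv_mul_cancel₀ (neg_ne_zero.2 hα), one_smul, model_ξ]
    rw [this]
    exact Submodule.smul_mem _ _ (Submodule.smul_mem _ _ (Submodule.subset_span ⟨i, rfl⟩))

theorem ξ_mem_vertical (hα : α ≠ 0) (i : Fin 3) : 𝒮.ξ i x ∈ 𝒮.vertical α x := by
  rw [mem_vertical_iff hα, ← model_ξ, ThreeContactSpace.hor, sum_fin_three _ i]
  simp only [(𝒮.model x).η_ξ_simps i]
  module

theorem T_mem_vertical (hα : α ≠ 0) (u v : Tan n x) : (𝒮.model x).T α δ u v ∈ 𝒮.vertical α x :=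
  Submodule.sum_mem _ fun i _ ↦ Submodule.smul_mem _ _ (ξ_mem_vertical hα i)

theorem isCompl_vertical (hα : α ≠ 0) (x : M) : IsCompl (𝒮.horizontal x) (𝒮.vertical α x) := by
  refine ⟨Submodule.disjoint_def.2 fun v hv hv' ↦ ?_, codisjoint_iff.2 (Submodule.eq_top_iff'.2 fun v ↦ ?_)⟩
  · rw [mem_vertical_iff hα, ThreeContactSpace.hor] at hv'
    simpa [mem_horizontal_iff.1 hv _] using hv'
  · rw [← (𝒮.model x).hor_add_sum v]
    exact Submodule.add_mem_sup (mem_horizontal_iff.2 ((𝒮.model x).isHorizontal_hor v))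
      (Submodule.sum_mem _ fun i _ ↦ Submodule.smul_mem _ _ (ξ_mem_vertical hα i))

theorem torsion_biquard (u v : Tan n x) :
    (𝒮.biquard α δ).torsion x u v = (𝒮.model x).T α δ u v := by
  obtain ⟨X, hX, rfl⟩ := exists_smoothField_eq u
  obtain ⟨Y, hY, rfl⟩ := exists_smoothField_eq v
  rw [CovariantDerivative.torsion_apply _ (hX.diffAt x) (hY.diffAt x),
    𝒮.biquard_torsion α δ (hX.diffAt x) (hY.diffAt x)]

/-- `T(ξ_i, v) = 2δ N_i v`, and `N_i` kills horizontal vectors. Hence the torsion endomorphisms of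
`H` are zero and the orthogonality axiom is automatic. -/
theorem T_vertical_horizontal (hα : α ≠ 0) {u v : Tan n x} (hu : u ∈ 𝒮.vertical α x)
    (hv : v ∈ 𝒮.horizontal x) : (𝒮.model x).T α δ u v = 0 := by
  have hv := mem_horizontal_iff.1 hv
  rw [mem_vertical_iff hα] at hu
  have h1 := (𝒮.model x).hor_add_sum u
  rw [hu, zero_add] at h1
  rw [← ThreeContactSpace.contorsion_sub, ← h1]
  simp only [map_sum, map_smul, LinearMap.sum_apply, LinearMap.smul_apply,
    ThreeContactSpace.contorsion_ξ_left, ThreeContactSpace.contorsion_ξ_right, hv.N_eq_zero]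
  simp

namespace IsThreeSasaki

theorem biquard_mem_horizontal (h : 𝒮.IsThreeSasaki α δ) {Y : Π x : M, Tan n x}
    (hY : ∀ y, Y y ∈ 𝒮.horizontal y) (hYd : DiffFieldAt Y x) (u : Tan n x) :
    𝒮.biquard α δ Y x u ∈ 𝒮.horizontal x := by
  refine mem_horizontal_iff.2 fun i ↦ ?_
  have hη : ∀ i y, 𝒮.η i y (Y y) = 0 := fun i y ↦ 𝒮.mem_horizontal.1 (hY y) i
  have h1 := h.mvfderiv_η i hYd u
  simp only [model_η, hη, mvfderiv_const, zero_apply, mul_zero, sub_zero, add_zero] at h1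
  exact h1.symm

theorem biquard_mem_vertical (h : 𝒮.IsThreeSasaki α δ) {Y : Π x : M, Tan n x}
    (hY : ∀ y, Y y ∈ 𝒮.vertical α y) (hYd : DiffFieldAt Y x) (u : Tan n x) :
    𝒮.biquard α δ Y x u ∈ 𝒮.vertical α x := by
  have e : Y = fun y ↦ 𝒮.η 0 y (Y y) • 𝒮.ξ 0 y + 𝒮.η 1 y (Y y) • 𝒮.ξ 1 y
      + 𝒮.η 2 y (Y y) • 𝒮.ξ 2 y := funext fun y ↦ by
    have h1 := (𝒮.model y).hor_add_sum (Y y)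
    rw [(mem_vertical_iff h.1).1 (hY y), zero_add, Fin.sum_univ_three] at h1
    exact h1.symm
  have d := fun i ↦ 𝒮.mdifferentiableAt_η_smul i i hYd
  have m : ∀ i, 𝒮.biquard α δ (fun y ↦ 𝒮.η i y (Y y) • 𝒮.ξ i y) x u ∈ 𝒮.vertical α x := fun i ↦ by
    rw [𝒮.cov_η_smul_ξ (𝒮.isSmoothMetric_biquard α δ) i i hYd]
    refine Submodule.add_mem _ (Submodule.smul_mem _ _ ?_)
      (Submodule.smul_mem _ _ (ξ_mem_vertical h.1 i))
    have := h.cov_ξ i u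
    rw [covξ]
    change 𝒮.biquard α δ (𝒮.ξ i) x u ∈ _
    rw [this]
    exact Submodule.sub_mem _ (Submodule.smul_mem _ _ (ξ_mem_vertical h.1 _))
      (Submodule.smul_mem _ _ (ξ_mem_vertical h.1 _))
  have d' : DiffFieldAt (fun y ↦ 𝒮.η 0 y (Y y) • 𝒮.ξ 0 y + 𝒮.η 1 y (Y y) • 𝒮.ξ 1 y) x :=
    mdifferentiableAt_add_section (d 0) (d 1)
  rw [e, cov_add _ d' (d 2), cov_add _ (d 0) (d 1)]
  exact Submodule.add_mem _ (Submodule.add_mem _ (m 0) (m 1)) (m 2)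

/-- The connection preserves `H`, so the projection in `hCov` does nothing. -/
theorem coe_hCov (h : 𝒮.IsThreeSasaki α δ) {Y : Π x : M, 𝒮.qcData.H x}
    (hY : DiffFieldAt (𝒮.qcData.toField Y) x) (u : Tan n x) :
    (𝒮.qcData.hCov (𝒮.vertical α) (𝒮.biquard α δ) Y x u : Tan n x) =
      𝒮.biquard α δ (𝒮.qcData.toField Y) x u := by
  rw [QCData.hCov, QCData.hProj_of_mem (isCompl_vertical h.1 x)
    (h.biquard_mem_horizontal (fun y ↦ (Y y).2) hY u)]

theorem isBiquard (h : 𝒮.IsThreeSasaki α δ) :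
    𝒮.qcData.IsBiquard (𝒮.vertical α) (𝒮.biquard α δ) where
  smooth := ⟨⟨fun {σ} hσ ↦ by
    have hs : SmoothField σ := fun y ↦ (hσ.contMDiffAt Filter.univ_mem).of_le (by simp)
    exact ((𝒮.isSmoothMetric_biquard α δ).smoothEndomorphism hs).contMDiffOn⟩⟩
  isCompl := isCompl_vertical h.1
  preserves_H x Y hY hYd u := h.biquard_mem_horizontal hY hYd u
  preserves_V x Y hY hYd u := h.biquard_mem_vertical hY hYd u
  metric x Y Z hY hZ u := by
    have h1 := (𝒮.isSmoothMetric_biquard α δ).metric hY hZ u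
    rw [← h.coe_hCov hY, ← h.coe_hCov hZ] at h1
    exact h1
  torsion_H x X Y hX hY := by
    have hb := 𝒮.biquard_torsion α δ hX hY
    have e : mlieBracket (𝓡 (4 * n + 3)) (𝒮.qcData.toField X) (𝒮.qcData.toField Y) x =
        (𝒮.biquard α δ (𝒮.qcData.toField Y) x (X x : Tan n x) -
          𝒮.biquard α δ (𝒮.qcData.toField X) x (Y x : Tan n x)) -
          (𝒮.model x).T α δ (X x : Tan n x) (Y x : Tan n x) := by
      rw [← (show _ = (𝒮.model x).T α δ (X x : Tan n x) (Y x : Tan n x) from hb)]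
      change _ = _ - (𝒮.biquard α δ (𝒮.qcData.toField Y) x (X x : Tan n x) -
        𝒮.biquard α δ (𝒮.qcData.toField X) x (Y x : Tan n x) - _)
      abel
    have hm : 𝒮.biquard α δ (𝒮.qcData.toField Y) x (X x : Tan n x) -
        𝒮.biquard α δ (𝒮.qcData.toField X) x (Y x : Tan n x) ∈ 𝒮.qcData.H x := Submodule.sub_mem _
      (h.biquard_mem_horizontal (fun y ↦ (Y y).2) hY (X x : Tan n x))
      (h.biquard_mem_horizontal (fun y ↦ (X y).2) hX (Y x : Tan n x))
    rw [torsion_biquard, e, map_sub,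
      QCData.hProj_of_mem (isCompl_vertical h.1 x) hm,
      QCData.hProj_of_mem_compl (isCompl_vertical h.1 x) (T_mem_vertical h.1 _ _), sub_zero]
    have : ∀ a t : Tan n x, t = -(a - t - a) := fun a t ↦ by abel
    exact this _ _
  torsion_V_mem x ξ hξ v := by
    rw [torsion_biquard, T_vertical_horizontal h.1 hξ v.2]
    exact Submodule.zero_mem _
  torsion_V_orthogonal x ξ hξ A _ e _ := by
    refine Finset.sum_eq_zero fun a _ ↦ ?_
    rw [torsion_biquard, T_vertical_horizontal h.1 hξ (e a).2, map_zero, map_zero]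
  parallel p := by
    refine ⟨Set.univ, trivial, _, _, _, h.isFrameOn, h.isReebOn, fun _ _ ↦ rfl, fun x _ u ↦ ?_⟩
    -- The rotation matrix of `cov_eq_rot`; it serves for `J` and `ξ` alike, as the common factor
    -- `-α` in the Reeb fields is constant.
    let a : Fin 3 → Fin 3 → ℝ := fun i j ↦ if j = i + 1 then 2 * δ * (𝒮.model x).η (i + 2) u
      else if j = i + 2 then -(2 * δ * (𝒮.model x).η (i + 1) u) else 0
    have ha : ∀ i, a i i = 0 ∧ a i (i + 1) = 2 * δ * (𝒮.model x).η (i + 2) u ∧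
        a i (i + 2) = -(2 * δ * (𝒮.model x).η (i + 1) u) := fun i ↦
      ⟨by simp [a], by simp [a], by simp [a]⟩
    refine ⟨a, fun i Y hY ↦ ?_, fun i ↦ ?_⟩
    · refine Subtype.ext ?_
      have hJ : DiffFieldAt (𝒮.qcData.toField fun y ↦ 𝒮.horizontalEnd i y (Y y)) x :=
        𝒮.mdifferentiableAt_φ i hY
      have h1 := h.cov_φ i hY u
      rw [← h.coe_hCov hY] at h1
      rw [sum_fin_three _ i]
      simp only [ha]
      change (𝒮.qcData.hCov (𝒮.vertical α) (𝒮.biquard α δ)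
        (fun y ↦ 𝒮.horizontalEnd i y (Y y)) x u : Tan n x)
        - (𝒮.model x).φ i (𝒮.qcData.hCov (𝒮.vertical α) (𝒮.biquard α δ) Y x u : Tan n x) =
        (0 : ℝ) • (𝒮.model x).φ i (Y x : Tan n x)
        + (2 * δ * (𝒮.model x).η (i + 2) u) • (𝒮.model x).φ (i + 1) (Y x : Tan n x)
        + (-(2 * δ * (𝒮.model x).η (i + 1) u)) • (𝒮.model x).φ (i + 2) (Y x : Tan n x)
      rw [h.coe_hCov hJ]
      refine (congrArg (· - _) h1).trans ?_
      change _ + _ - (𝒮.model x).φ i _ = _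
      rw [add_sub_cancel_right]
      change (2 * δ * (𝒮.model x).η (i + 2) u) • (𝒮.model x).φ (i + 1) (Y x : Tan n x)
        - (2 * δ * (𝒮.model x).η (i + 1) u) • (𝒮.model x).φ (i + 2) (Y x : Tan n x) = _
      module
    · have h1 := h.cov_ξ i u
      rw [cov_const_smul _ _ (𝒮.mdifferentiableAt_ξ i), smul_apply, h1, sum_fin_three _ i]
      simp only [ha, ← model_ξ]
      module

/-- The curvature preserves `H`, so the projection is harmless and `ricciH_eq` applies with `c =
4αδ` and `4n / 4 + 2 = n + 2`. -/
theorem qcRicci_eq (h : 𝒮.IsThreeSasaki α δ) {e : Fin (4 * n) → 𝒮.qcData.H x}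
    (he : 𝒮.qcData.IsOrthonormalFrame x e) (v w : 𝒮.qcData.H x) :
    𝒮.qcData.qcRicci (𝒮.vertical α) (𝒮.biquard α δ) x e v w =
      (n + 2) * (4 * α * δ) * 𝒮.qcData.metric x v w := by
  have hf : (𝒮.model x).HorizontalFrame fun a ↦ (e a : Tan n x) :=
    .of_orthonormal (fun a ↦ mem_horizontal_iff.1 (e a).2) he (by
      rw [finrank_model_H, Fintype.card_fin])
  have hR := h.biquardCurvature x
  have hw := mem_horizontal_iff.1 w.2
  have h1 := hR.ricciH_eq hf (mem_horizontal_iff.1 v.2) hw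
  have h2 : ∀ a, 𝒮.qcData.hProj (𝒮.vertical α) x
      (curvature (𝒮.biquard α δ) x (e a : Tan n x) (v : Tan n x) (w : Tan n x)) =
      ⟨_, mem_horizontal_iff.2 (hR.horizontal (e a : Tan n x) (v : Tan n x) hw)⟩ := fun a ↦
    QCData.hProj_of_mem (isCompl_vertical h.1 x) _
  simp only [QCData.qcRicci, h2]
  refine h1.trans ?_
  rw [Fintype.card_fin]
  push_cast
  change _ = _ * (𝒮.model x).g v w
  ring

theorem isQCEinstein (hn : 1 ≤ n) (h : 𝒮.IsThreeSasaki α δ) :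
    𝒮.qcData.IsQCEinstein (2 * α * δ) := by
  refine ⟨h.isQuaternionicContact, _, _, h.isBiquard, fun x e he ↦ ?_⟩
  have hs : 𝒮.qcData.qcScal (𝒮.vertical α) (𝒮.biquard α δ) x e =
      4 * n * ((n + 2) * (4 * α * δ)) := by
    simp only [QCData.qcScal, h.qcRicci_eq he, he _ _, if_true, mul_one, Finset.sum_const,
      Finset.card_univ, Fintype.card_fin, nsmul_eq_mul]
    push_cast
    ring
  -- Needed to cancel `4n` in `Scal / (4n)`.
  have hn0 : (n : ℝ) ≠ 0 := by
    have : (1 : ℝ) ≤ n := by exact_mod_cast hn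
    linarith
  refine ⟨fun v w ↦ ?_, ?_⟩
  · rw [h.qcRicci_eq he, hs]
    field_simp
  · rw [hs]
    ring

end IsThreeSasaki
end AlmostThreeContactMetric
end SasakiGeom
end

theorem mainTheorem4 (n : ℕ) (hn : 1 ≤ n) {M : Type*} [TopologicalSpace M] [T2Space M]
    [SecondCountableTopology M] [Nonempty M]
    [ChartedSpace (EuclideanSpace ℝ (Fin (4 * n + 3))) M] [IsManifold (𝓡 (4 * n + 3)) ∞ M]
    (𝒮 : AlmostThreeContactMetric n M) (α δ : ℝ) (h𝒮 : 𝒮.IsThreeSasaki α δ) :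
    (𝒮.qcData.IsQuaternionicContact ∧
      𝒮.qcData.IsFrameOn Set.univ (fun i x ↦ (-(1 / α)) • 𝒮.η i x) 𝒮.horizontalEnd ∧
      𝒮.qcData.IsReebOn Set.univ (fun i x ↦ (-(1 / α)) • 𝒮.η i x)
        (fun i x ↦ (-α) • 𝒮.ξ i x) ∧
      (∀ (i : Fin 3) (x : M) (v w : Tan n x),
        extDerivOneForm (fun y ↦ (-(1 / α)) • 𝒮.η i y) x v w =
          2 * qcFundamentalForm (fun j y ↦ (-(1 / α)) • 𝒮.η j y) (fun j y ↦ (-α) • 𝒮.ξ j y)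
            i x v w +
          2 * α * δ * ((-(1 / α) * 𝒮.η (i + 1) x v) * (-(1 / α) * 𝒮.η (i + 2) x w)
            - (-(1 / α) * 𝒮.η (i + 1) x w) * (-(1 / α) * 𝒮.η (i + 2) x v))) ∧
      𝒮.qcData.IsQCEinstein (2 * α * δ)) ∧
    (∀ (x : M) (v w : Tan n x),
      ricci 𝒮.g x v w =
        2 * α * (2 * δ * (n + 2) - 3 * α) * 𝒮.g.inner x v w +
          2 * (α - δ) * ((2 * n + 3) * α - δ) * ∑ i, 𝒮.η i x v * 𝒮.η i x w) ∧
    (IsEinstein 𝒮.g ↔ δ = α ∨ δ = (2 * n + 3) * α) := by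
  exact ⟨⟨h𝒮.isQuaternionicContact, h𝒮.isFrameOn, h𝒮.isReebOn, h𝒮.structure_equation,
    h𝒮.isQCEinstein hn⟩, h𝒮.ricci_eq, h𝒮.isEinstein_iff hn⟩
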